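/- Let $F$ be a field and let $q,h_1,h_2,e_1,\dots,e_{11}\in F^\times$. Let $F_q[x,y]$ be the quantum plane: the $F$-algebra with basis $x^iy^j$ ($i,j\ge 0$), with central scalars and $yx=q\,xy$. For $P=\sum a_{ij}x^iy^j$ write $P(0,0)=a_{00}$, and write $(r)_+=\max(r,0)$; an empty product is $1$. For data $\lambda=((d_1,d_2),(m_1,\dots,m_{11}))$ consider the following conditions on $P\in F_q[x,y]$: $(x)_\lambda$: $\displaystyle P=\sum_{i=0}^{d_1}x^i\prod_{t=i}^{m_{11}-1}(1+q^te_{11}y)\prod_{t=d_1-m_{10}}^{i-1}\Big(1+q^t\tfrac{h_2}{e_{10}}y\Big)U_i(y)$ with polynomials $U_i\in F[y]$ of degree at most $d_2-(i-d_1+m_{10})_+-(m_{11}-i)_+$; $(y)_\lambda$: $\displaystyle P=\sum_{i=0}^{d_2}\prod_{k=1}^{6}\prod_{t=i-m_k}^{-1}\Big(1+q^t\tfrac{1}{e_k}x\Big)\prod_{k=7}^{9}\prod_{t=0}^{i-d_2+m_k-1}\Big(1+q^t\tfrac{e_k}{h_1}x\Big)V_i(x)\,y^i$ with polynomials $V_i\in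 F[x]$ of degree at most $d_1-\sum_{k=1}^6(m_k-i)_+-\sum_{k=7}^9(i-d_2+m_k)_+$. Fix $\lambda=((6,3),(1,1,1,1,1,1,2,2,2,3,3))$ and assume the constraint $$h_1^6h_2^3=e_1e_2e_3e_4e_5e_6\,e_7^2e_8^2e_9^2\,e_{10}^3e_{11}^3 .\qquad(\ast)$$ (a) There is a unique $P_0\in F_q[x,y]$ which satisfies $(x)_\lambda$ and $(y)_\lambda$, in which the coefficient of $x^3y$ is $0$, and for which $P_0(0,0)=1$. The polynomials $P$ satisfying $(x)_\lambda$ and $(y)_\lambda$ are exactly $P=c_0P_0(x,y)+c_1x^3y$ with $c_0,c_1\in F$. (b) Now let $k$ be a field of constants (for instance $k=\mathbb C$), let $q\in k^\times$, and let $F=k(h_1,h_2,e_1,\dots,e_{11})$ be the field of rational functions in the parameters subject only to $(\ast)$, that is, $h_1,h_2,e_2,\dots,e_{11}$ are algebraically independent over $k$ and $e_1$ is determined by $(\ast)$. Let $\mathcal K$ be the skew field of fractions of $F_q[x,y]$. Let $W(E_8^{(1)})=\langle s_0,\dots,s_8\rangle$ be the affine Weyl group whose Dynkin diagram is the chain $1-2-\cdots-8$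 with the node $0$ joined to the node $3$. It acts on $\mathcal K$ by ring automorphisms fixing $k$, where each $s_i$ is the unique such automorphism with the following values on $h_1,h_2,e_1,\dots,e_{11},x,y$ (generators not mentioned are fixed): $$s_0:\ e_{10}\mapsto\tfrac{h_2}{e_{11}},\ e_{11}\mapsto\tfrac{h_2}{e_{10}},\ h_1\mapsto\tfrac{h_1h_2}{e_{10}e_{11}},\ x\mapsto x\,\frac{1+y\frac{h_2}{e_{10}}}{1+ye_{11}},$$ $$s_3:\ e_1\mapsto\tfrac{h_1}{e_7},\ e_7\mapsto\tfrac{h_1}{e_1},\ h_2\mapsto\tfrac{h_1h_2}{e_1e_7},\ y\mapsto\frac{1+x\frac{e_7}{h_1}}{1+\frac{x}{e_1}}\,y,$$ $$s_1:e_8\leftrightarrow e_9,\quad s_2:e_7\leftrightarrow e_8,\quad s_4:e_1\leftrightarrow e_2,\quad s_5:e_2\leftrightarrow e_3,\quad s_6:e_3\leftrightarrow e_4,\quad s_7:e_4\leftrightarrow e_5,\quad s_8:e_5\leftrightarrow e_6.$$ If $P=c_0P_0+c_1x^3y$ with $c_0\in F$, $c_1\in k$ and $P(0,0)=1$, then $P$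 is invariant under $W(E_8^{(1)})$ up to multiplicative factors: $$s_i(P)=P\ (i\ne 0,3),\qquad s_0(P)=P\prod_{t=0}^{2}\frac{1+q^t\frac{h_2}{e_{10}}y}{1+q^te_{11}y},\qquad s_3(P)=P\,\frac{1+\frac{e_7}{q h_1}x}{1+\frac{1}{q e_1}x}.$$ -/

import Mathlib

open Polynomial
open scoped nonZeroDivisors

universe u v

/-! ## The quantum plane and its skew field of fractions -/

/-- The multiplication on families of coefficients:
`(r xᵃ yᵇ) (s xᶜ yᵈ) = q ^ (b c) r s xᵃ⁺ᶜ yᵇ⁺ᵈ`, extended bilinearly. -/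
noncomputable def mulCoeffs (F : Type u) [Field F] (q : Fˣ) :
    (ℕ × ℕ →₀ F) →ₗ[F] (ℕ × ℕ →₀ F) →ₗ[F] (ℕ × ℕ →₀ F) :=
  Finsupp.lsum F fun a : ℕ × ℕ =>
    LinearMap.toSpanSingleton F ((ℕ × ℕ →₀ F) →ₗ[F] (ℕ × ℕ →₀ F))
      (Finsupp.lsum F fun b : ℕ × ℕ =>
        ((q ^ (a.2 * b.1) : Fˣ) : F) • Finsupp.lsingle (a + b))

theorem mulCoeffs_single (F : Type u) [Field F] (q : Fˣ) (a b : ℕ × ℕ) (r s : F) :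
    mulCoeffs F q (Finsupp.single a r) (Finsupp.single b s) =
      Finsupp.single (a + b) (((q ^ (a.2 * b.1) : Fˣ) : F) * (r * s)) := by
  simp only [mulCoeffs, Finsupp.lsum_single, LinearMap.toSpanSingleton_apply,
    LinearMap.smul_apply, Finsupp.lsingle_apply, Finsupp.smul_single, smul_eq_mul]
  congr 1
  ring

theorem mulCoeffs_apply (F : Type u) [Field F] (q : Fˣ) (P Q : ℕ × ℕ →₀ F) :
    mulCoeffs F q P Q = P.sum fun a r => Q.sum fun b s =>
      Finsupp.single (a + b) (((q ^ (a.2 * b.1) : Fˣ) : F) * (r * s)) := by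
  conv_lhs => rw [← Finsupp.sum_single P, ← Finsupp.sum_single Q]
  simp only [Finsupp.sum, map_sum, LinearMap.sum_apply, mulCoeffs_single]
  exact Finset.sum_comm

theorem mulCoeffs_support (F : Type u) [Field F] (q : Fˣ) (P Q : ℕ × ℕ →₀ F) (c : ℕ × ℕ)
    (hc : c ∈ (mulCoeffs F q P Q).support) : ∃ a ∈ P.support, ∃ b ∈ Q.support, a + b = c := by
  by_contra! H
  rw [Finsupp.mem_support_iff, mulCoeffs_apply] at hc
  apply hc
  simp only [Finsupp.sum, Finsupp.finsetSum_apply]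
  refine Finset.sum_eq_zero fun a ha => Finset.sum_eq_zero fun b hb => ?_
  exact Finsupp.single_eq_of_ne (H a ha b hb).symm

theorem mulCoeffs_ne_zero (F : Type u) [Field F] (q : Fˣ) (P Q : ℕ × ℕ →₀ F)
    (hP : P ≠ 0) (hQ : Q ≠ 0) : mulCoeffs F q P Q ≠ 0 := by
  obtain ⟨a, ha, b, hb, hu⟩ := UniqueSums.uniqueAdd_of_nonempty
    (Finsupp.support_nonempty_iff.2 hP) (Finsupp.support_nonempty_iff.2 hQ)
  have key : mulCoeffs F q P Q (a + b) = ((q ^ (a.2 * b.1) : Fˣ) : F) * (P a * Q b) := by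
    rw [mulCoeffs_apply]
    simp only [Finsupp.sum, Finsupp.finsetSum_apply]
    rw [Finset.sum_eq_single_of_mem a ha, Finset.sum_eq_single_of_mem b hb]
    · exact Finsupp.single_eq_same
    · intro b' hb' hne
      exact Finsupp.single_eq_of_ne fun h => hne (hu ha hb' h.symm).2
    · intro a' ha' hne
      refine Finset.sum_eq_zero fun b' hb' => ?_
      exact Finsupp.single_eq_of_ne fun h => hne (hu ha' hb' h.symm).1
  intro h0
  rw [h0, Finsupp.zero_apply] at key
  exact mul_ne_zero (Units.ne_zero _) (mul_ne_zero (Finsupp.mem_support_iff.1 ha)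
    (Finsupp.mem_support_iff.1 hb)) key.symm

theorem exists_map_eq_map {F : Type u} [Field F] {M : Type v} [AddCommGroup M] [Module F M]
    (V W : Submodule F M) (f g : M →ₗ[F] M) (hf : ∀ m ∈ V, f m ∈ W) (hg : ∀ m ∈ V, g m ∈ W)
    (hV : FiniteDimensional F V) (hW : FiniteDimensional F W)
    (h : Module.finrank F W < Module.finrank F V + Module.finrank F V) :
    ∃ a b, a ∈ V ∧ b ∈ V ∧ f a = g b ∧ (a ≠ 0 ∨ b ≠ 0) := by
  let φ : (V × V) →ₗ[F] W := (f.restrict hf).coprod (-(g.restrict hg))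
  have hker : LinearMap.ker φ ≠ ⊥ :=
    LinearMap.ker_ne_bot_of_finrank_lt (by rwa [Module.finrank_prod])
  obtain ⟨u, hu, hu0⟩ := (Submodule.ne_bot_iff _).1 hker
  refine ⟨u.1, u.2, u.1.2, u.2.2, ?_, ?_⟩
  · have := congrArg Subtype.val (LinearMap.mem_ker.1 hu)
    simp only [φ, LinearMap.coprod_apply, LinearMap.neg_apply, Submodule.coe_add,
      Submodule.coe_neg, LinearMap.coe_restrict_apply, ZeroMemClass.coe_zero] at this
    exact add_neg_eq_zero.1 this
  · by_contra! H
    exact hu0 (Prod.ext (Subtype.ext H.1) (Subtype.ext H.2))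

/-- Any two elements have a nontrivial common left multiple, by comparing dimensions of spaces of
polynomials of bounded bidegree. -/
theorem mulCoeffs_ore (F : Type u) [Field F] (q : Fˣ) (R S : ℕ × ℕ →₀ F) :
    ∃ A B : ℕ × ℕ →₀ F, mulCoeffs F q A R = mulCoeffs F q B S ∧ (A ≠ 0 ∨ B ≠ 0) := by
  let box : ℕ → Finset (ℕ × ℕ) := fun n => Finset.range n ×ˢ Finset.range n
  have hbox : ∀ n c, c ∈ box n ↔ c.1 < n ∧ c.2 < n := by simp [box]
  obtain ⟨d, hd0, hd⟩ : ∃ d, 0 < d ∧ ∀ c ∈ R.support ∪ S.support, c ∈ box d := by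
    refine ⟨(R.support ∪ S.support).sup (fun c => c.1 + c.2) + 1, Nat.succ_pos _, fun c hc => ?_⟩
    have : c.1 + c.2 ≤ _ := Finset.le_sup (f := fun c : ℕ × ℕ => c.1 + c.2) hc
    rw [hbox]; omega
  let V : ℕ → Submodule F (ℕ × ℕ →₀ F) := fun n => Finsupp.supported F F (box n : Set (ℕ × ℕ))
  have e : ∀ n, V n ≃ₗ[F] ((box n : Set (ℕ × ℕ)) →₀ F) := fun n =>
    Finsupp.supportedEquivFinsupp _
  have fd : ∀ n, FiniteDimensional F (V n) := fun n => (e n).symm.finiteDimensional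
  have hdim : ∀ n, Module.finrank F (V n) = n * n := fun n => by
    rw [(e n).finrank_eq, Module.finrank_finsupp_self]
    simp [box]
  have hmul : ∀ T : ℕ × ℕ →₀ F, T.support ⊆ R.support ∪ S.support → ∀ A ∈ V (3 * d),
      mulCoeffs F q A T ∈ V (4 * d) := by
    intro T hT A hA
    rw [Finsupp.mem_supported] at hA ⊢
    intro c hc
    obtain ⟨a, ha, b, hb, rfl⟩ := mulCoeffs_support F q A T c hc
    have h1 := (hbox _ _).1 (Finset.mem_coe.1 (hA ha))
    have h2 := (hbox _ _).1 (hd b (hT hb))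
    rw [Finset.mem_coe, hbox, Prod.fst_add, Prod.snd_add]
    omega
  obtain ⟨A, B, -, -, hAB, h0⟩ := exists_map_eq_map (V (3 * d)) (V (4 * d))
    ((mulCoeffs F q).flip R) ((mulCoeffs F q).flip S)
    (hmul R Finset.subset_union_left) (hmul S Finset.subset_union_right)
    (fd _) (fd _) (by rw [hdim, hdim]; nlinarith)
  exact ⟨A, B, hAB, h0⟩

/-- The quantum plane over `F`: polynomials `∑ aᵢⱼ xⁱ yʲ` with central coefficients in `F`, stored as
the finitely supported family of their coefficients `(i, j) ↦ aᵢⱼ` in the ordering `xⁱ yʲ`,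
with the multiplication determined by `y x = q x y`. -/
def QPlane (F : Type u) [Field F] (_q : Fˣ) : Type u := ℕ × ℕ →₀ F

namespace QPlane

variable {F : Type u} [Field F] {q : Fˣ}

noncomputable instance : AddCommGroup (QPlane F q) :=
  inferInstanceAs (AddCommGroup (ℕ × ℕ →₀ F))

noncomputable instance : Module F (QPlane F q) :=
  inferInstanceAs (Module F (ℕ × ℕ →₀ F))

/-- The term `r xⁱ yʲ`, where `a = (i, j)`. -/
noncomputable def term (a : ℕ × ℕ) (r : F) : QPlane F q := Finsupp.single a r

/-- The coefficient of `xⁱ yʲ` (with `x` to the left of `y`). -/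
def coeff (P : QPlane F q) (i j : ℕ) : F := Finsupp.toFun P (i, j)

noncomputable def mulHom : QPlane F q →ₗ[F] QPlane F q →ₗ[F] QPlane F q := mulCoeffs F q

noncomputable instance : Mul (QPlane F q) := ⟨fun P Q => mulHom P Q⟩

noncomputable instance : One (QPlane F q) := ⟨term (0, 0) 1⟩

theorem mul_def (P Q : QPlane F q) : P * Q = mulHom P Q := rfl

theorem one_def : (1 : QPlane F q) = term (0, 0) 1 := rfl

theorem term_mul_term (a b : ℕ × ℕ) (r s : F) :
    (term a r * term b s : QPlane F q) =
      term (a + b) (((q ^ (a.2 * b.1) : Fˣ) : F) * (r * s)) :=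
  mulCoeffs_single F q a b r s

theorem smul_term (a : ℕ × ℕ) (c r : F) :
    (c • term a r : QPlane F q) = term a (c * r) :=
  Finsupp.smul_single _ _ _

theorem induction_term {p : QPlane F q → Prop} (P : QPlane F q) (h0 : p 0)
    (hadd : ∀ A B, p A → p B → p (A + B)) (hterm : ∀ a r, p (term a r)) : p P :=
  Finsupp.induction_linear (motive := p) P h0 hadd hterm

theorem mul_add' (A B C : QPlane F q) : A * (B + C) = A * B + A * C :=
  (mulHom A).map_add B C

theorem add_mul' (A B C : QPlane F q) : (A + B) * C = A * C + B * C :=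
  LinearMap.map_add₂ mulHom A B C

theorem mul_zero' (A : QPlane F q) : A * 0 = 0 := (mulHom A).map_zero

theorem zero_mul' (A : QPlane F q) : 0 * A = 0 := LinearMap.map_zero₂ mulHom A

theorem mul_assoc' (A B C : QPlane F q) : A * B * C = A * (B * C) := by
  induction A using induction_term with
  | h0 => simp only [zero_mul']
  | hadd A A' h h' => simp only [add_mul', h, h']
  | hterm a r =>
    induction B using induction_term with
    | h0 => simp only [zero_mul', mul_zero']
    | hadd A A' h h' => simp only [add_mul', mul_add', h, h']
    | hterm b s =>
      induction C using induction_term with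
      | h0 => simp only [mul_zero']
      | hadd A A' h h' => simp only [mul_add', h, h']
      | hterm c t =>
        simp only [term_mul_term, add_assoc]
        congr 1
        push_cast [Prod.fst_add, Prod.snd_add]
        ring

theorem one_mul' (A : QPlane F q) : 1 * A = A := by
  induction A using induction_term with
  | h0 => simp only [mul_zero']
  | hadd A A' h h' => simp only [mul_add', h, h']
  | hterm a r => rw [one_def, term_mul_term]; simp [← Prod.zero_eq_mk]

theorem mul_one' (A : QPlane F q) : A * 1 = A := by
  induction A using induction_term with
  | h0 => simp only [zero_mul']
  | hadd A A' h h' => simp only [add_mul', h, h']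
  | hterm a r => rw [one_def, term_mul_term]; simp [← Prod.zero_eq_mk]

noncomputable instance : Ring (QPlane F q) :=
  { (inferInstance : AddCommGroup (QPlane F q)),
    (inferInstance : Mul (QPlane F q)), (inferInstance : One (QPlane F q)) with
    left_distrib := mul_add'
    right_distrib := add_mul'
    zero_mul := zero_mul'
    mul_zero := mul_zero'
    mul_assoc := mul_assoc'
    one_mul := one_mul'
    mul_one := mul_one' }

noncomputable instance : Algebra F (QPlane F q) :=
  Algebra.ofModule (fun r A B => LinearMap.map_smul₂ mulHom r A B)
    (fun r A B => (mulHom A).map_smul r B)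

variable (F q) in
/-- The variable `x`. -/
noncomputable def x : QPlane F q := term (1, 0) 1

variable (F q) in
/-- The variable `y`. -/
noncomputable def y : QPlane F q := term (0, 1) 1

theorem y_mul_x : y F q * x F q = (q : F) • (x F q * y F q) := by
  simp only [x, y, term_mul_term, smul_term]
  simp

theorem term_eq (i j : ℕ) (r : F) : (term (i, j) r : QPlane F q) = r • (x F q ^ i * y F q ^ j) := by
  have hx : ∀ i : ℕ, x F q ^ i = term (i, 0) 1 := by
    intro i
    induction i with
    | zero => rfl
    | succ i ih => rw [pow_succ, ih, x, term_mul_term]; simp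
  have hy : ∀ j : ℕ, y F q ^ j = term (0, j) 1 := by
    intro j
    induction j with
    | zero => rfl
    | succ j ih => rw [pow_succ, ih, y, term_mul_term]; simp
  rw [hx, hy, term_mul_term, smul_term]
  simp

instance : NoZeroDivisors (QPlane F q) where
  eq_zero_or_eq_zero_of_mul_eq_zero {P Q} h := by
    by_contra! H
    exact mulCoeffs_ne_zero F q P Q H.1 H.2 h

instance : Nontrivial (QPlane F q) :=
  inferInstanceAs (Nontrivial (ℕ × ℕ →₀ F))

theorem nonempty_oreSet : Nonempty (OreLocalization.OreSet (QPlane F q)⁰) := by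
  rw [OreLocalization.nonempty_oreSet_iff_of_noZeroDivisors]
  intro r s
  have hs : (s : QPlane F q) ≠ 0 := nonZeroDivisors.coe_ne_zero s
  by_cases hr : r = 0
  · exact ⟨0, 1, by simp [hr]⟩
  obtain ⟨A, B, hAB, h0⟩ := mulCoeffs_ore F q r (s : QPlane F q)
  have hAB' : (show QPlane F q from A) * r = (show QPlane F q from B) * (s : QPlane F q) := hAB
  have hA : (show QPlane F q from A) ≠ 0 := by
    intro hA
    rcases h0 with h | h
    · exact h hA
    · rw [hA, zero_mul] at hAB'
      rcases mul_eq_zero.1 hAB'.symm with h' | h'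
      · exact h h'
      · exact hs h'
  exact ⟨_, ⟨_, mem_nonZeroDivisors_of_ne_zero hA⟩, hAB'⟩

noncomputable instance : OreLocalization.OreSet (QPlane F q)⁰ := Classical.choice nonempty_oreSet

end QPlane

/-- The skew field of fractions of the quantum plane. -/
abbrev QField (F : Type u) [Field F] (q : Fˣ) : Type u :=
  OreLocalization (QPlane F q)⁰ (QPlane F q)

namespace QPlane

variable {F : Type u} [Field F] {q : Fˣ}

/-- The inclusion of the quantum plane in its skew field of fractions. -/
noncomputable def toQField : QPlane F q →+* QField F q := OreLocalization.numeratorRingHom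

/-- The polynomial `f(x)` in the variable `x` only. -/
noncomputable def evalX (f : F[X]) : QPlane F q := aeval (x F q) f

/-- The polynomial `f(y)` in the variable `y` only. -/
noncomputable def evalY (f : F[X]) : QPlane F q := aeval (y F q) f

end QPlane

/-! ## Parameters -/

/-- Non-zero values in `F` of the parameters `h₁`, `h₂`, `e₁, …, e₁₁`.
The parameter `e_k` is `e (k - 1)`, i.e. `e 0 = e₁`, …, `e 10 = e₁₁`. -/
@[ext] structure Params (F : Type u) [Field F] where
  h₁ : Fˣ
  h₂ : Fˣ
  e : Fin 11 → Fˣ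

namespace Params

variable {F : Type u} [Field F]

/-- `h₁⁶ h₂³ = e₁ e₂ e₃ e₄ e₅ e₆ e₇² e₈² e₉² e₁₀³ e₁₁³`. -/
def Constraint (p : Params F) : Prop :=
  p.h₁ ^ 6 * p.h₂ ^ 3 =
    p.e 0 * p.e 1 * p.e 2 * p.e 3 * p.e 4 * p.e 5 * p.e 6 ^ 2 * p.e 7 ^ 2 * p.e 8 ^ 2 *
      p.e 9 ^ 3 * p.e 10 ^ 3

/-- The values `s_i(h₁)`, `s_i(h₂)`, `s_i(e_k)` of the simple reflections on the parameters. -/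
def refl (p : Params F) : Fin 9 → Params F
  | 0 => { h₁ := p.h₁ * p.h₂ / (p.e 9 * p.e 10)
           h₂ := p.h₂
           e := Function.update (Function.update p.e 9 (p.h₂ / p.e 10)) 10 (p.h₂ / p.e 9) }
  | 1 => { p with e := p.e ∘ Equiv.swap 7 8 }
  | 2 => { p with e := p.e ∘ Equiv.swap 6 7 }
  | 3 => { h₁ := p.h₁
           h₂ := p.h₁ * p.h₂ / (p.e 0 * p.e 6)
           e := Function.update (Function.update p.e 0 (p.h₁ / p.e 6)) 6 (p.h₁ / p.e 0) }
  | 4 => { p with e := p.e ∘ Equiv.swap 0 1 }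
  | 5 => { p with e := p.e ∘ Equiv.swap 1 2 }
  | 6 => { p with e := p.e ∘ Equiv.swap 2 3 }
  | 7 => { p with e := p.e ∘ Equiv.swap 3 4 }
  | 8 => { p with e := p.e ∘ Equiv.swap 4 5 }

end Params

/-- The field of rational functions over `k` in the parameters subject to the constraint: the
constraint is solved for `e₁`, so that the other twelve parameters `h₁, h₂, e₂, …, e₁₁`
are independent variables. -/
abbrev ParamField (k : Type u) [Field k] : Type u := FractionRing (MvPolynomial (Fin 12) k)

/-- The independent variables of `ParamField k`: number `0` is `h₁`, number `1` is `h₂`, and number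
`j` is `e_j` for `2 ≤ j ≤ 11`. -/
noncomputable def paramVar (k : Type u) [Field k] (j : Fin 12) : (ParamField k)ˣ :=
  Units.mk0 (algebraMap (MvPolynomial (Fin 12) k) (ParamField k) (MvPolynomial.X j))
    ((map_ne_zero_iff _ (IsFractionRing.injective _ _)).2 (MvPolynomial.X_ne_zero j))

/-- The generic parameters subject to the constraint. -/
noncomputable def genericParams (k : Type u) [Field k] : Params (ParamField k) where
  h₁ := paramVar k 0
  h₂ := paramVar k 1
  e := ![paramVar k 0 ^ 6 * paramVar k 1 ^ 3 /
      (paramVar k 2 * paramVar k 3 * paramVar k 4 * paramVar k 5 * paramVar k 6 *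
        paramVar k 7 ^ 2 * paramVar k 8 ^ 2 * paramVar k 9 ^ 2 *
        paramVar k 10 ^ 3 * paramVar k 11 ^ 3),
    paramVar k 2, paramVar k 3, paramVar k 4, paramVar k 5, paramVar k 6, paramVar k 7,
    paramVar k 8, paramVar k 9, paramVar k 10, paramVar k 11]

theorem genericParams_constraint (k : Type u) [Field k] : (genericParams k).Constraint := by
  have h : ∀ A B C : (ParamField k)ˣ, A / B * C = A * (C / B) := fun A B C => by
    rw [div_mul_eq_mul_div, mul_div_assoc]
  have : ∀ e2 e3 e4 e5 e6 e7 e8 e9 e10 e11 H : (ParamField k)ˣ,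
      H = H / (e2 * e3 * e4 * e5 * e6 * e7 * e8 * e9 * e10 * e11) * e2 * e3 * e4 * e5 * e6 * e7 *
        e8 * e9 * e10 * e11 := by
    intro e2 e3 e4 e5 e6 e7 e8 e9 e10 e11 H
    rw [eq_comm]
    simp only [mul_assoc]
    exact div_mul_cancel _ _
  exact this _ _ _ _ _ _ _ _ _ _ _

/-- The constant `q` of `k`, seen in `ParamField k`. -/
noncomputable def qParam {k : Type u} [Field k] (q : kˣ) : (ParamField k)ˣ :=
  Units.map (algebraMap k (ParamField k)).toMonoidHom q

/-! ## The polynomials attached to degree/multiplicity data -/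

/-- Bidegree `(d₁, d₂)` and multiplicities `m₁, …, m₁₁`; the multiplicity `m_k` is `m (k - 1)`. -/
structure DegMult where
  d₁ : ℕ
  d₂ : ℕ
  m : Fin 11 → ℤ

/-- The data `((6, 3), (1⁶, 2³, 3²))`. -/
def e8Data : DegMult where
  d₁ := 6
  d₂ := 3
  m := ![1, 1, 1, 1, 1, 1, 2, 2, 2, 3, 3]

section Conditions

variable {F : Type u} [Field F]

/-- The linear polynomial `1 + a X`. -/
noncomputable def lin (a : Fˣ) : F[X] := 1 + C (a : F) * X

/-- All exponents of `f` are at most `n` (so `f = 0` if `n < 0`). -/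
def DegLE (f : F[X]) (n : ℤ) : Prop := ∀ j : ℕ, f.coeff j ≠ 0 → (j : ℤ) ≤ n

variable {q : Fˣ}

/-- The condition `(x)_μ`:
`P = ∑ᵢ xⁱ ∏_{t=i}^{m₁₁-1} (1 + qᵗ e₁₁ y) ∏_{t=d₁-m₁₀}^{i-1} (1 + qᵗ (h₂/e₁₀) y) Uᵢ(y)`, where
`Uᵢ` has degree at most `d₂ - (i - d₁ + m₁₀)₊ - (m₁₁ - i)₊`. -/
def CondX (μ : DegMult) (p : Params F) (P : QPlane F q) : Prop :=
  ∃ U : ℕ → F[X],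
    (∀ i ≤ μ.d₁, DegLE (U i)
      ((μ.d₂ : ℤ) - max ((i : ℤ) - μ.d₁ + μ.m 9) 0 - max (μ.m 10 - i) 0)) ∧
    P = ∑ i ∈ Finset.range (μ.d₁ + 1),
      QPlane.x F q ^ i * QPlane.evalY (
        (∏ t ∈ Finset.Icc (i : ℤ) (μ.m 10 - 1), lin (q ^ t * p.e 10)) *
        (∏ t ∈ Finset.Icc ((μ.d₁ : ℤ) - μ.m 9) ((i : ℤ) - 1), lin (q ^ t * (p.h₂ / p.e 9))) *
        U i)

/-- The condition `(y)_μ`: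
`P = ∑ᵢ ∏_{k=1}^{6} ∏_{t=i-m_k}^{-1} (1 + qᵗ e_k⁻¹ x) ∏_{k=7}^{9} ∏_{t=0}^{i-d₂+m_k-1}
(1 + qᵗ (e_k/h₁) x) Vᵢ(x) yⁱ`, where `Vᵢ` has degree at most
`d₁ - ∑_{k=1}^{6} (m_k - i)₊ - ∑_{k=7}^{9} (i - d₂ + m_k)₊`. -/
def CondY (μ : DegMult) (p : Params F) (P : QPlane F q) : Prop :=
  ∃ V : ℕ → F[X],
    (∀ i ≤ μ.d₂, DegLE (V i)
      ((μ.d₁ : ℤ) - ∑ k ∈ ({0, 1, 2, 3, 4, 5} : Finset (Fin 11)), max (μ.m k - i) 0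
        - ∑ k ∈ ({6, 7, 8} : Finset (Fin 11)), max ((i : ℤ) - μ.d₂ + μ.m k) 0)) ∧
    P = ∑ i ∈ Finset.range (μ.d₂ + 1),
      QPlane.evalX (
        (∏ k ∈ ({0, 1, 2, 3, 4, 5} : Finset (Fin 11)),
          ∏ t ∈ Finset.Icc ((i : ℤ) - μ.m k) (-1), lin (q ^ t * (p.e k)⁻¹)) *
        (∏ k ∈ ({6, 7, 8} : Finset (Fin 11)),
          ∏ t ∈ Finset.Icc (0 : ℤ) ((i : ℤ) - μ.d₂ + μ.m k - 1), lin (q ^ t * (p.e k / p.h₁))) *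
        V i) * QPlane.y F q ^ i

/-- `P` satisfies the conditions `(x)_μ` and `(y)_μ`. -/
def IsSolution (μ : DegMult) (p : Params F) (P : QPlane F q) : Prop :=
  CondX μ p P ∧ CondY μ p P

/-- `P₀` is a solution for the data `((6, 3), (1⁶, 2³, 3²))` whose coefficient of `x³ y` is `0` and
whose constant term `P₀(0, 0)` is `1`. -/
def IsBasePolynomial (p : Params F) (P₀ : QPlane F q) : Prop :=
  IsSolution e8Data p P₀ ∧ P₀.coeff 3 1 = 0 ∧ P₀.coeff 0 0 = 1

end Conditions

/-! ## The affine Weyl group and its action -/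

/-- Adjacency in the Dynkin diagram of type `E₈⁽¹⁾`: the chain `1 — 2 — ⋯ — 8`, and the node `0`
joined to the node `3`. -/
def e8Adj (i j : Fin 9) : Bool :=
  (i.val ≥ 1 && j.val == i.val + 1) || (j.val ≥ 1 && i.val == j.val + 1) ||
    (i.val == 0 && j.val == 3) || (i.val == 3 && j.val == 0)

/-- The Coxeter matrix of type `E₈⁽¹⁾`; its Coxeter group is the affine Weyl group `W(E₈⁽¹⁾)`. -/
def affineE8 : CoxeterMatrix (Fin 9) where
  M := Matrix.of fun i j => if i = j then 1 else if e8Adj i j then 3 else 2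
  isSymm := by
    refine Matrix.IsSymm.ext fun i j => ?_
    simp only [Matrix.of_apply]
    revert i j
    decide
  diagonal := by decide
  off_diagonal := by
    intro i j
    simp only [Matrix.of_apply]
    revert i j
    decide

section Action

variable {F : Type u} [Field F] {q : Fˣ}

/-- The value `s_i(x)`: it is `x (1 + y h₂/e₁₀) / (1 + y e₁₁)` for `i = 0`, and `x` otherwise. -/
noncomputable def reflX (p : Params F) (i : Fin 9) : QField F q :=
  if i = 0 then
    QPlane.toQField (QPlane.x F q) *
      (QPlane.toQField (QPlane.evalY (lin (p.h₂ / p.e 9))) /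
        QPlane.toQField (QPlane.evalY (lin (p.e 10))))
  else QPlane.toQField (QPlane.x F q)

/-- The value `s_i(y)`: it is `(1 + x e₇/h₁) / (1 + x/e₁) y` for `i = 3`, and `y` otherwise. -/
noncomputable def reflY (p : Params F) (i : Fin 9) : QField F q :=
  if i = 3 then
    QPlane.toQField (QPlane.evalX (lin (p.e 6 / p.h₁))) /
        QPlane.toQField (QPlane.evalX (lin (p.e 0)⁻¹)) *
      QPlane.toQField (QPlane.y F q)
  else QPlane.toQField (QPlane.y F q)

/-- An element of the coefficient field as an element of the skew field. -/
noncomputable def scalar (c : F) : QField F q := QPlane.toQField (algebraMap F (QPlane F q) c)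

/-- `φ` is the simple reflection `s_i` on the skew field generated over the constants `k` by the
parameters `p` and by `x`, `y`. -/
structure IsSimpleReflection (k : Type u) [Field k] [Algebra k F] (p : Params F) (i : Fin 9)
    (φ : RingAut (QField F q)) : Prop where
  map_const : ∀ c : k, φ (scalar (algebraMap k F c)) = scalar (algebraMap k F c)
  map_h₁ : φ (scalar (p.h₁ : F)) = scalar ((p.refl i).h₁ : F)
  map_h₂ : φ (scalar (p.h₂ : F)) = scalar ((p.refl i).h₂ : F)
  map_e : ∀ j, φ (scalar (p.e j : F)) = scalar ((p.refl i).e j : F)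
  map_x : φ (QPlane.toQField (QPlane.x F q)) = reflX p i
  map_y : φ (QPlane.toQField (QPlane.y F q)) = reflY p i

end Action

/-! Put a = e₁₁, b = h₂/e₁₀, and let E = ∏_{k≤6}(1 + x/e_k) and A = ∏_{k=7}^{9}(1 + e_k x/h₁) have
coefficients εₙ and αₙ. For the given data, column i of P (the coefficient of xⁱ) is a prescribed
product of |i - 3| linear factors times Uᵢ of degree at most 3 - |i - 3|. Rows 0, 1, 2, 3 are
E(x/q), 1, A(x), A(x)A(qx) times Vⱼ of degree at most 0, 6, 3, 0. The place (3, 1) lies in the one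
column and the one row without prescribed factors, so its coefficient c₁ is free.

Uniqueness in (a) is `eq_zero_of_isSolution`: if the coefficients at (0, 0) and (3, 1) vanish, rows
and columns are forced to vanish alternately, each having no more unknowns than places already known
to be zero. Existence is an explicit formula given twice, by columns (`solCol`) and by rows
(`solRow`). `solCol_coeff_eq` checks that the two agree at all 7 · 4 places; the constraint enters
there as ε₆ b³ = α₃² a³.

Part (b) holds because the two formulas display complementary symmetries. Apart from c₁, the Vⱼ
depend only on q, a, t = α₃ a / b and the elementary symmetric functions of the nine numbers 1/e_k
(k ≤ 6), e_k/h₁ (k = 7, 8, 9). Each s_i with i ≠ 0 fixes a and t and permutes the nine numbers. The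
Uᵢ are unchanged under s₀, which exchanges a and b and multiplies αₙ by (a/b)ⁿ. Since c₁ is a
constant, only the prescribed linear factors and the variables move. The q-shifts met when x and y
pass linear factors turn this change into one factor common to all columns (for s₀) or all rows (for
s₃).

For the action itself, reflections of the parameters extend to the field F because the reflected
parameters generate F again and so are algebraically independent. On the skew field, s₀ and s₃ are
conjugates of the coefficient action by the shears x ↦ x(1 + by) and y ↦ (1 + (e₇/h₁)x)y, hence
involutions. All Coxeter relations but one are short computations in a single variable; the braid
relation of 0 and 3 rests on the noncommutative identities `braid_identity_x` and
`braid_identity_y`. -/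

namespace QPlane

/-! ### Coefficients in normal order and commutation of linear factors with the variables. -/

section Coefficients

variable {F : Type u} [Field F] {q : Fˣ}

theorem ext_coeff {P Q : QPlane F q} (h : ∀ i j, P.coeff i j = Q.coeff i j) : P = Q :=
  Finsupp.ext fun a => h a.1 a.2

theorem coeff_add (P Q : QPlane F q) (i j : ℕ) :
    (P + Q).coeff i j = P.coeff i j + Q.coeff i j := rfl

theorem coeff_sub (P Q : QPlane F q) (i j : ℕ) :
    (P - Q).coeff i j = P.coeff i j - Q.coeff i j := rfl

theorem coeff_smul (c : F) (P : QPlane F q) (i j : ℕ) :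
    (c • P).coeff i j = c * P.coeff i j := rfl

theorem coeff_zero (i j : ℕ) : (0 : QPlane F q).coeff i j = 0 := rfl

theorem coeff_term (a : ℕ × ℕ) (r : F) (i j : ℕ) :
    (term a r : QPlane F q).coeff i j = if a = (i, j) then r else 0 := by
  classical
  exact Finsupp.single_apply

/-- The coefficient of `xⁱ yʲ`, as an additive map. -/
def coeffHom (i j : ℕ) : QPlane F q →+ F where
  toFun P := P.coeff i j
  map_zero' := rfl
  map_add' _ _ := rfl

theorem coeff_sum {ι : Type*} (s : Finset ι) (f : ι → QPlane F q) (i j : ℕ) :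
    (∑ k ∈ s, f k).coeff i j = ∑ k ∈ s, (f k).coeff i j :=
  map_sum (coeffHom i j) f s

theorem x_pow (i : ℕ) : x F q ^ i = term (i, 0) 1 := by
  rw [term_eq]; simp

theorem y_pow (j : ℕ) : y F q ^ j = term (0, j) 1 := by
  rw [term_eq]; simp

theorem algebraMap_eq_term (c : F) : algebraMap F (QPlane F q) c = term (0, 0) c := by
  rw [Algebra.algebraMap_eq_smul_one, one_def, smul_term, mul_one]

theorem coeff_x_pow_mul_evalY (i : ℕ) (f : F[X]) (m j : ℕ) :
    (x F q ^ i * evalY f).coeff m j = if i = m then f.coeff j else 0 := by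
  induction f using Polynomial.induction_on' with
  | add f g hf hg =>
    simp only [evalY, map_add, mul_add, coeff_add] at *
    rw [hf, hg]
    split_ifs <;> simp
  | monomial n c =>
    rw [evalY, aeval_monomial, algebraMap_eq_term, y_pow, x_pow, term_mul_term, term_mul_term,
      coeff_term, coeff_monomial]
    simp only [Prod.mk_add_mk, Prod.mk.injEq]
    split_ifs <;> simp_all

theorem coeff_evalX_mul_y_pow (f : F[X]) (j : ℕ) (i m : ℕ) :
    (evalX f * y F q ^ j).coeff i m = if j = m then f.coeff i else 0 := by
  induction f using Polynomial.induction_on' with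
  | add f g hf hg =>
    simp only [evalX, map_add, add_mul, coeff_add] at *
    rw [hf, hg]
    split_ifs <;> simp
  | monomial n c =>
    rw [evalX, aeval_monomial, algebraMap_eq_term, y_pow, x_pow, term_mul_term, term_mul_term,
      coeff_term, coeff_monomial]
    simp only [Prod.mk_add_mk, Prod.mk.injEq]
    split_ifs <;> simp_all

theorem coeff_sum_x_pow_mul_evalY (f : ℕ → F[X]) (n i j : ℕ) :
    (∑ k ∈ Finset.range n, x F q ^ k * evalY (f k)).coeff i j =
      if i < n then (f i).coeff j else 0 := by
  simp [coeff_sum, coeff_x_pow_mul_evalY]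

theorem coeff_sum_evalX_mul_y_pow (f : ℕ → F[X]) (n i j : ℕ) :
    (∑ k ∈ Finset.range n, evalX (f k) * y F q ^ k).coeff i j =
      if j < n then (f j).coeff i else 0 := by
  simp [coeff_sum, coeff_evalX_mul_y_pow]

theorem evalX_mul (f g : F[X]) : (evalX (f * g) : QPlane F q) = evalX f * evalX g :=
  map_mul (aeval (x F q)) f g

theorem evalY_mul (f g : F[X]) : (evalY (f * g) : QPlane F q) = evalY f * evalY g :=
  map_mul (aeval (y F q)) f g

theorem evalX_one : (evalX 1 : QPlane F q) = 1 := map_one (aeval (x F q))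

theorem evalY_one : (evalY 1 : QPlane F q) = 1 := map_one (aeval (y F q))

theorem evalX_lin (a : Fˣ) : (evalX (lin a) : QPlane F q) = 1 + (a : F) • x F q := by
  simp [evalX, lin, Algebra.smul_def]

theorem evalY_lin (a : Fˣ) : (evalY (lin a) : QPlane F q) = 1 + (a : F) • y F q := by
  simp [evalY, lin, Algebra.smul_def]

/-- The q-shifts of linear factors all come from this rule and its mirror image: passing a variable
multiplies the slope of a linear factor by q. -/
theorem evalY_lin_mul_x (a : Fˣ) :
    evalY (lin a) * x F q = x F q * evalY (lin (q * a)) := by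
  simp only [evalY_lin, add_mul, mul_add, smul_mul_assoc, y_mul_x, mul_smul_comm, one_mul,
    mul_one, smul_smul, Units.val_mul, mul_comm (q : F)]

theorem y_mul_evalX_lin (a : Fˣ) :
    y F q * evalX (lin a) = evalX (lin (q * a)) * y F q := by
  simp only [evalX_lin, add_mul, mul_add, smul_mul_assoc, y_mul_x, mul_smul_comm, one_mul,
    mul_one, smul_smul, Units.val_mul, mul_comm (q : F)]

theorem lin_ne_zero (a : Fˣ) : lin a ≠ 0 := fun h => by
  simpa [lin] using congrArg (fun f => f.coeff 0) h

theorem evalY_ne_zero {f : F[X]} (hf : f ≠ 0) : (evalY f : QPlane F q) ≠ 0 := by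
  intro h
  apply hf
  ext j
  have := coeff_x_pow_mul_evalY (q := q) 0 f 0 j
  rw [h, mul_zero, coeff_zero] at this
  simpa using this.symm

theorem evalX_ne_zero {f : F[X]} (hf : f ≠ 0) : (evalX f : QPlane F q) ≠ 0 := by
  intro h
  apply hf
  ext j
  have := coeff_evalX_mul_y_pow (q := q) f 0 j 0
  rw [h, zero_mul, coeff_zero] at this
  simpa using this.symm

end Coefficients

/-! ### Ring homomorphisms out of the quantum plane. -/

section Lift

variable {F : Type u} [Field F] {q : Fˣ} {R : Type v} [Ring R]

theorem pow_mul_pow_of_mul_eq {X Y c : R} (hc : ∀ r, Commute c r) (h : Y * X = c * (X * Y))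
    (j i : ℕ) : Y ^ j * X ^ i = c ^ (j * i) * (X ^ i * Y ^ j) := by
  have h1 : ∀ i, Y * X ^ i = c ^ i * (X ^ i * Y) := by
    intro i
    induction i with
    | zero => simp
    | succ i ih =>
      rw [pow_succ, ← mul_assoc, ih, mul_assoc, mul_assoc, h, ← mul_assoc (X ^ i) c,
        ← (hc (X ^ i)).eq]
      simp only [pow_succ, mul_assoc]
  induction j with
  | zero => simp
  | succ j ih =>
    rw [pow_succ, mul_assoc, h1, ← mul_assoc, ← ((hc (Y ^ j)).pow_left i).eq, mul_assoc,
      ← mul_assoc (Y ^ j), ih]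
    simp only [← mul_assoc, ← pow_add]
    congr 3
    rw [add_mul, one_mul, add_comm]

/-- The ring homomorphism from the quantum plane with prescribed values on the scalars and on the
two variables. -/
noncomputable def lift (σ : F →+* R) (X Y : R) (hσ : ∀ c r, Commute (σ c) r)
    (h : Y * X = σ q * (X * Y)) : QPlane F q →+* R :=
  let φ : QPlane F q →+ R := Finsupp.liftAddHom (M := F) (N := R) fun a : ℕ × ℕ =>
    (AddMonoidHom.mulRight (X ^ a.1 * Y ^ a.2)).comp σ.toAddMonoidHom
  have hφ : ∀ a r, φ (term a r) = σ r * (X ^ a.1 * Y ^ a.2) := fun a r =>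
    (Finsupp.liftAddHom_apply_single (M := F) (N := R) _ a r).trans rfl
  { φ with
    map_one' := by
      change φ 1 = 1
      rw [one_def, hφ]; simp
    map_mul' := by
      change ∀ P Q, φ (P * Q) = φ P * φ Q
      intro P Q
      induction P using induction_term with
      | h0 => simp
      | hadd A B hA hB => simp only [add_mul, map_add, hA, hB]
      | hterm a r =>
        induction Q using induction_term with
        | h0 => simp
        | hadd A B hA hB => simp only [mul_add, map_add, hA, hB]
        | hterm b s =>
          rw [term_mul_term, hφ, hφ, hφ]
          have key := pow_mul_pow_of_mul_eq (hσ q) h a.2 b.1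
          simp only [Units.val_pow_eq_pow_val, map_mul, map_pow, Prod.fst_add, Prod.snd_add]
          calc _ = σ r * σ s * X ^ a.1 * (σ q ^ (a.2 * b.1) * (X ^ b.1 * Y ^ a.2)) * Y ^ b.2 := by
                rw [((hσ (q : F) (σ r * σ s)).pow_left _).eq, pow_add, pow_add]
                have := ((hσ (q : F) (X ^ a.1)).pow_left (a.2 * b.1)).eq
                simp only [mul_assoc]
                rw [← mul_assoc (X ^ a.1) (σ q ^ _), ← this]
                simp only [mul_assoc]
            _ = _ := by
                rw [← key]
                have := (hσ s (X ^ a.1 * Y ^ a.2)).eq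
                simp only [mul_assoc] at this ⊢
                rw [← mul_assoc (Y ^ a.2) (σ s), ← mul_assoc (X ^ a.1) (Y ^ a.2 * σ s),
                  ← mul_assoc (X ^ a.1) (Y ^ a.2) (σ s), mul_assoc (X ^ a.1), ← this]
                simp only [mul_assoc] }

theorem lift_term (σ : F →+* R) (X Y : R) (hσ : ∀ c r, Commute (σ c) r)
    (h : Y * X = σ q * (X * Y)) (a : ℕ × ℕ) (r : F) :
    lift σ X Y hσ h (term a r) = σ r * (X ^ a.1 * Y ^ a.2) :=
  (Finsupp.liftAddHom_apply_single (M := F) (N := R) _ a r).trans rfl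

theorem lift_algebraMap (σ : F →+* R) (X Y : R) (hσ : ∀ c r, Commute (σ c) r)
    (h : Y * X = σ q * (X * Y)) (c : F) :
    lift σ X Y hσ h (algebraMap F _ c) = σ c := by
  rw [algebraMap_eq_term, lift_term]; simp

theorem lift_x (σ : F →+* R) (X Y : R) (hσ : ∀ c r, Commute (σ c) r)
    (h : Y * X = σ q * (X * Y)) : lift σ X Y hσ h (x F q) = X := by
  rw [x, lift_term]; simp

theorem lift_y (σ : F →+* R) (X Y : R) (hσ : ∀ c r, Commute (σ c) r)
    (h : Y * X = σ q * (X * Y)) : lift σ X Y hσ h (y F q) = Y := by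
  rw [y, lift_term]; simp

theorem ringHom_ext {f g : QPlane F q →+* R}
    (hc : ∀ c : F, f (algebraMap F _ c) = g (algebraMap F _ c))
    (hx : f (x F q) = g (x F q)) (hy : f (y F q) = g (y F q)) : f = g := by
  ext P
  induction P using induction_term with
  | h0 => simp
  | hadd A B hA hB => simp only [map_add, hA, hB]
  | hterm a r => rw [term_eq a.1 a.2 r, Algebra.smul_def]; simp [hc, hx, hy]

/-- Used with `S` the range of an endomorphism of the skew field, to reduce surjectivity to scalars
and the two variables. -/
theorem map_mem_of_gen (f : QPlane F q →+* R) (S : Subring R)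
    (hc : ∀ c : F, f (algebraMap F _ c) ∈ S) (hx : f (x F q) ∈ S) (hy : f (y F q) ∈ S)
    (P : QPlane F q) : f P ∈ S := by
  induction P using induction_term with
  | h0 => simp
  | hadd A B hA hB => rw [map_add]; exact S.add_mem hA hB
  | hterm a r =>
    rw [term_eq a.1 a.2 r, Algebra.smul_def]
    simp only [map_mul, map_pow]
    exact S.mul_mem (hc r) (S.mul_mem (S.pow_mem hx _) (S.pow_mem hy _))

end Lift

/-! ### Injectivity of endomorphisms through the filtration by lowest total degree. -/

section Order

variable {F : Type u} [Field F] {q : Fˣ}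

/-- All monomials of `P` have total degree at least `n`. -/
def OrderGE (n : ℕ) (P : QPlane F q) : Prop := ∀ i j, P.coeff i j ≠ 0 → n ≤ i + j

theorem OrderGE.mono {m n : ℕ} (h : m ≤ n) {P : QPlane F q} (hP : OrderGE n P) : OrderGE m P :=
  fun i j hij => h.trans (hP i j hij)

theorem OrderGE.add {n : ℕ} {P Q : QPlane F q} (hP : OrderGE n P) (hQ : OrderGE n Q) :
    OrderGE n (P + Q) := fun i j hij => by
  by_cases h : P.coeff i j = 0
  · exact hQ i j fun h' => hij (by rw [coeff_add, h, h', add_zero])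
  · exact hP i j h

theorem OrderGE.smul {n : ℕ} {P : QPlane F q} (c : F) (hP : OrderGE n P) :
    OrderGE n (c • P) := fun i j hij =>
  hP i j fun h => hij (by rw [coeff_smul, h, mul_zero])

theorem OrderGE.mul {m n : ℕ} {P Q : QPlane F q} (hP : OrderGE m P) (hQ : OrderGE n Q) :
    OrderGE (m + n) (P * Q) := fun i j hij => by
  obtain ⟨a, ha, b, hb, hab⟩ := mulCoeffs_support F q P Q (i, j) (Finsupp.mem_support_iff.2 hij)
  have h1 := hP a.1 a.2 (Finsupp.mem_support_iff.1 ha)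
  have h2 := hQ b.1 b.2 (Finsupp.mem_support_iff.1 hb)
  have h3 := congrArg Prod.fst hab
  have h4 := congrArg Prod.snd hab
  simp only [Prod.fst_add, Prod.snd_add] at h3 h4
  omega

theorem orderGE_term (a : ℕ × ℕ) (r : F) : OrderGE (a.1 + a.2) (term a r : QPlane F q) := by
  intro i j hij
  rw [coeff_term] at hij
  by_contra h
  exact hij (if_neg fun h' => h (by rw [h']))

/-- Telescoping of a difference of powers. The orders of both powers are carried along because the
induction step multiplies by them. -/
theorem OrderGE.pow_sub {P Q : QPlane F q} (hP : OrderGE 1 P)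
    (hQ : OrderGE 2 (Q - P)) (d : ℕ) :
    OrderGE (d + 1) (Q ^ d - P ^ d) ∧ OrderGE d (P ^ d) ∧ OrderGE d (Q ^ d) := by
  have hQ1 : OrderGE 1 Q := by simpa using (hQ.mono one_le_two).add hP
  induction d with
  | zero =>
    have h1 : OrderGE 0 (1 : QPlane F q) := fun _ _ _ => Nat.zero_le _
    refine ⟨fun i j hij => ?_, by simpa using h1, by simpa using h1⟩
    simp [coeff_zero] at hij
  | succ d ih =>
    obtain ⟨i1, i2, i3⟩ := ih
    refine ⟨?_, by rw [pow_succ]; exact i2.mul hP, by rw [pow_succ]; exact i3.mul hQ1⟩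
    have : Q ^ (d + 1) - P ^ (d + 1) = (Q ^ d - P ^ d) * Q + P ^ d * (Q - P) := by
      rw [pow_succ, pow_succ]; noncomm_ring
    rw [this]
    exact (i1.mul hQ1).add (i2.mul hQ)

theorem orderGE_map_term_sub (f : QPlane F q →+* QPlane F q)
    (hc : ∀ c : F, f (algebraMap F _ c) = algebraMap F _ c)
    (hx : OrderGE 2 (f (x F q) - x F q)) (hy : OrderGE 2 (f (y F q) - y F q))
    (a : ℕ × ℕ) (r : F) :
    OrderGE (a.1 + a.2 + 1) (f (term a r) - term a r) := by
  obtain ⟨x1, x2, x3⟩ := OrderGE.pow_sub (orderGE_term (1, 0) 1) hx a.1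
  obtain ⟨y1, y2, y3⟩ := OrderGE.pow_sub (orderGE_term (0, 1) 1) hy a.2
  have : f (term a r) - term a r = r • ((f (x F q) ^ a.1 - x F q ^ a.1) * f (y F q) ^ a.2 +
      x F q ^ a.1 * (f (y F q) ^ a.2 - y F q ^ a.2)) := by
    rw [term_eq a.1 a.2 r, Algebra.smul_def, Algebra.smul_def]
    simp only [map_mul, map_pow, hc]
    noncomm_ring
  rw [this]
  refine OrderGE.smul _ (OrderGE.add ?_ ?_)
  · exact (x1.mul y3).mono (by omega)
  · exact (OrderGE.mul x2 y1).mono (by omega)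

/-- An endomorphism over the scalars which is the identity on the terms of lowest degree is
injective. -/
theorem injective_of_orderGE (f : QPlane F q →+* QPlane F q)
    (hc : ∀ c : F, f (algebraMap F _ c) = algebraMap F _ c)
    (hx : OrderGE 2 (f (x F q) - x F q)) (hy : OrderGE 2 (f (y F q) - y F q)) :
    Function.Injective f := by
  -- On each monomial `f` is the identity up to higher total degree; additivity extends this to `P`.
  have step : ∀ d (P : QPlane F q), OrderGE d P → OrderGE (d + 1) (f P - P) := by
    intro d P hP
    have hs : f P - P = ∑ a ∈ Finsupp.support P,
        (f (term a (P.coeff a.1 a.2)) - term a (P.coeff a.1 a.2)) := by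
      have : P = ∑ a ∈ Finsupp.support P, (term a (P.coeff a.1 a.2) : QPlane F q) :=
        (Finsupp.sum_single P).symm
      conv_lhs => rw [this]
      rw [map_sum, ← Finset.sum_sub_distrib]
    rw [hs]
    have : ∀ s ⊆ Finsupp.support P, OrderGE (d + 1)
        (∑ a ∈ s, (f (term a (P.coeff a.1 a.2)) - term a (P.coeff a.1 a.2))) := by
      intro s
      induction s using Finset.induction_on with
      | empty => intro _ i j hij; simp [coeff_zero] at hij
      | insert a s ha ih =>
        intro hs
        rw [Finset.sum_insert ha]
        refine OrderGE.add ?_ (ih ((Finset.subset_insert _ _).trans hs))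
        refine (orderGE_map_term_sub f hc hx hy a _).mono ?_
        have := hP a.1 a.2 (Finsupp.mem_support_iff.1 (hs (Finset.mem_insert_self _ _)))
        omega
    exact this _ subset_rfl
  rw [injective_iff_map_eq_zero]
  intro P hP
  -- For `P` in the kernel, `f P - P = -P`, so every bound on the order of `P` improves by one.
  have all : ∀ d, OrderGE d P := by
    intro d
    induction d with
    | zero => exact fun _ _ _ => Nat.zero_le _
    | succ d ih =>
      have := step d P ih
      rw [hP, zero_sub] at this
      simpa using this.smul (-1)
  refine ext_coeff fun i j => ?_
  by_contra h
  have := all (i + j + 1) i j h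
  omega

end Order

end QPlane

/-! ### Extension of homomorphisms to the skew field of fractions. -/

namespace QField

open QPlane

variable {F : Type u} [Field F] {q : Fˣ}

theorem toQField_injective : Function.Injective (toQField : QPlane F q →+* QField F q) :=
  OreLocalization.numeratorHom_inj inf_le_left

theorem toQField_ne_zero {P : QPlane F q} (h : P ≠ 0) : P.toQField ≠ 0 := fun h' =>
  h (toQField_injective (h'.trans (map_zero _).symm))

theorem exists_eq_inv_mul (z : QField F q) :
    ∃ s r : QPlane F q, s ≠ 0 ∧ z = s.toQField⁻¹ * r.toQField := by
  induction z using OreLocalization.ind with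
  | _ r s =>
    refine ⟨s, r, nonZeroDivisors.coe_ne_zero s, ?_⟩
    have hs := toQField_ne_zero (nonZeroDivisors.coe_ne_zero s)
    rw [eq_inv_mul_iff_mul_eq₀ hs]
    exact OreLocalization.smul_cancel

theorem ringHom_ext {R : Type v} [DivisionRing R] {f g : QField F q →+* R}
    (hc : ∀ c : F, f (scalar c) = g (scalar c))
    (hx : f (x F q).toQField = g (x F q).toQField)
    (hy : f (y F q).toQField = g (y F q).toQField) : f = g := by
  have h : f.comp toQField = g.comp toQField := QPlane.ringHom_ext hc hx hy
  ext z
  obtain ⟨s, r, -, rfl⟩ := exists_eq_inv_mul z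
  have hP : ∀ P : QPlane F q, f P.toQField = g P.toQField := fun P => DFunLike.congr_fun h P
  simp only [map_mul, map_inv₀, hP]

/-- The extension of an injective endomorphism to the skew field of fractions. -/
noncomputable def map (f : QPlane F q →+* QPlane F q) (hf : Function.Injective f) :
    QField F q →+* QField F q :=
  OreLocalization.universalHom (toQField.comp f)
    (Units.liftRight ((toQField.comp f).toMonoidHom.comp (Submonoid.subtype _))
      (fun s => Units.mk0 (f s).toQField
        (toQField_ne_zero ((map_ne_zero_iff f hf).2 (nonZeroDivisors.coe_ne_zero s))))
      (fun _ => rfl))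
    (fun _ => rfl)

theorem map_toQField (f : QPlane F q →+* QPlane F q) (hf : Function.Injective f)
    (P : QPlane F q) : map f hf P.toQField = (f P).toQField :=
  OreLocalization.universalHom_commutes _ _ _

/-- Every element is a left fraction s⁻¹r, and the range of a homomorphism of skew fields is closed
under inverses. -/
theorem map_surjective (f : QPlane F q →+* QPlane F q) (hf : Function.Injective f)
    (hc : ∀ c : F, ∃ z, map f hf z = scalar c)
    (hx : ∃ z, map f hf z = (x F q).toQField) (hy : ∃ z, map f hf z = (y F q).toQField) :
    Function.Surjective (map f hf) := by
  intro z
  obtain ⟨s, r, -, rfl⟩ := exists_eq_inv_mul z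
  obtain ⟨s', hs⟩ := map_mem_of_gen toQField (map f hf).range hc hx hy s
  obtain ⟨r', hr⟩ := map_mem_of_gen toQField (map f hf).range hc hx hy r
  exact ⟨s'⁻¹ * r', by rw [map_mul, map_inv₀, hs, hr]⟩

/-- The extension of an endomorphism with dense image to an automorphism of the skew field of
fractions. -/
noncomputable def autOfMap (f : QPlane F q →+* QPlane F q) (hf : Function.Injective f)
    (hc : ∀ c : F, ∃ z, map f hf z = scalar c)
    (hx : ∃ z, map f hf z = (x F q).toQField) (hy : ∃ z, map f hf z = (y F q).toQField) :
    RingAut (QField F q) :=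
  RingEquiv.ofBijective (map f hf) ⟨(map f hf).injective, map_surjective f hf hc hx hy⟩

end QField

/-! ### The coefficient action and the two shears of the quantum plane. -/

namespace QPlane

variable {F : Type u} [Field F] {q : Fˣ}

/-- The action of a field automorphism on the coefficients. -/
noncomputable def coeffMap (σ : RingAut F) (hσ : σ q = q) : QPlane F q →+* QPlane F q :=
  lift ((algebraMap F _).comp σ.toRingHom) (x F q) (y F q) (fun c r => Algebra.commutes _ r) (by
    rw [y_mul_x, Algebra.smul_def]
    exact congrArg (fun c => algebraMap F (QPlane F q) c * _) hσ.symm)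

theorem coeffMap_algebraMap (σ : RingAut F) (hσ : σ q = q) (c : F) :
    coeffMap σ hσ (algebraMap F _ c) = algebraMap F (QPlane F q) (σ c) :=
  lift_algebraMap _ _ _ _ _ c

theorem coeffMap_x (σ : RingAut F) (hσ : σ q = q) : coeffMap σ hσ (x F q) = x F q :=
  lift_x _ _ _ _ _

theorem coeffMap_y (σ : RingAut F) (hσ : σ q = q) : coeffMap σ hσ (y F q) = y F q :=
  lift_y _ _ _ _ _

theorem coeffMap_injective (σ : RingAut F) (hσ : σ q = q) :
    Function.Injective (coeffMap σ hσ) := by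
  have hσ' : σ⁻¹ q = q := (RingEquiv.symm_apply_eq σ).2 hσ.symm
  have h : (coeffMap σ⁻¹ hσ').comp (coeffMap σ hσ) = RingHom.id (QPlane F q) := by
    refine ringHom_ext (fun c => ?_) ?_ ?_
    · simp only [RingHom.comp_apply, coeffMap_algebraMap, RingHom.id_apply]
      exact congrArg _ (σ.symm_apply_apply c)
    · simp only [RingHom.comp_apply, coeffMap_x, RingHom.id_apply]
    · simp only [RingHom.comp_apply, coeffMap_y, RingHom.id_apply]
  exact Function.LeftInverse.injective (g := coeffMap σ⁻¹ hσ') fun P => DFunLike.congr_fun h P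

/-- The endomorphism `x ↦ x (1 + b y)`, `y ↦ y` over the scalars. -/
noncomputable def shearX (b : Fˣ) : QPlane F q →+* QPlane F q :=
  lift (algebraMap F _) (x F q * evalY (lin b)) (y F q) (fun c r => Algebra.commutes _ r) (by
    rw [← mul_assoc, y_mul_x, ← Algebra.smul_def, smul_mul_assoc, mul_assoc, mul_assoc]
    congr 2
    rw [evalY_lin]
    simp [mul_add, add_mul])

/-- The endomorphism `x ↦ x`, `y ↦ (1 + c x) y` over the scalars. -/
noncomputable def shearY (c : Fˣ) : QPlane F q →+* QPlane F q :=
  lift (algebraMap F _) (x F q) (evalX (lin c) * y F q) (fun c r => Algebra.commutes _ r) (by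
    rw [mul_assoc, y_mul_x, ← Algebra.smul_def, mul_smul_comm, ← mul_assoc, ← mul_assoc]
    congr 2
    rw [evalX_lin]
    simp [mul_add, add_mul])

theorem shearX_algebraMap (b : Fˣ) (c : F) :
    shearX b (algebraMap F (QPlane F q) c) = algebraMap F _ c := lift_algebraMap _ _ _ _ _ c

theorem shearX_x (b : Fˣ) : shearX b (x F q) = x F q * evalY (lin b) := lift_x _ _ _ _ _

theorem shearX_y (b : Fˣ) : shearX b (y F q) = y F q := lift_y _ _ _ _ _

theorem shearY_algebraMap (b : Fˣ) (c : F) :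
    shearY b (algebraMap F (QPlane F q) c) = algebraMap F _ c := lift_algebraMap _ _ _ _ _ c

theorem shearY_x (c : Fˣ) : shearY c (x F q) = x F q := lift_x _ _ _ _ _

theorem shearY_y (c : Fˣ) : shearY c (y F q) = evalX (lin c) * y F q := lift_y _ _ _ _ _

theorem orderGE_zero (n : ℕ) : OrderGE n (0 : QPlane F q) := fun _ _ h => absurd rfl h

theorem shearX_injective (b : Fˣ) : Function.Injective (shearX b : QPlane F q →+* _) := by
  refine injective_of_orderGE _ (shearX_algebraMap b) ?_ ?_
  · rw [shearX_x, evalY_lin, mul_add, mul_one, add_sub_cancel_left, mul_smul_comm]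
    exact ((orderGE_term (1, 0) 1).mul (orderGE_term (0, 1) 1)).smul _
  · rw [shearX_y, sub_self]
    exact orderGE_zero 2

theorem shearY_injective (c : Fˣ) : Function.Injective (shearY c : QPlane F q →+* _) := by
  refine injective_of_orderGE _ (shearY_algebraMap c) ?_ ?_
  · rw [shearY_x, sub_self]
    exact orderGE_zero 2
  · rw [shearY_y, evalX_lin, add_mul, one_mul, add_sub_cancel_left, smul_mul_assoc]
    exact ((orderGE_term (1, 0) 1).mul (orderGE_term (0, 1) 1)).smul _

end QPlane

/-! ### Automorphisms of the skew field: coefficient action, shears and their conjugates. -/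

namespace QField

open QPlane

variable {F : Type u} [Field F] {q : Fˣ}

theorem algEval_toQField (φ : QField F q →+* QField F q) (σ : F →+* F)
    (hσ : ∀ c, φ (scalar c) = scalar (σ c)) {z : QPlane F q}
    (hz : φ z.toQField = z.toQField) (f : F[X]) :
    φ (aeval z f).toQField = (aeval z (f.map σ)).toQField := by
  induction f using Polynomial.induction_on' with
  | add f g hf hg => simp only [map_add, Polynomial.map_add, hf, hg]
  | monomial n c =>
    have := hσ c
    rw [scalar, scalar] at this
    simp only [aeval_monomial, Polynomial.map_monomial, map_mul, map_pow, hz, this]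

theorem evalY_toQField (φ : QField F q →+* QField F q) (σ : F →+* F)
    (hσ : ∀ c, φ (scalar c) = scalar (σ c))
    (hy : φ (y F q).toQField = (y F q).toQField) (f : F[X]) :
    φ (evalY f : QPlane F q).toQField = (evalY (f.map σ) : QPlane F q).toQField :=
  algEval_toQField φ σ hσ hy f

theorem evalX_toQField (φ : QField F q →+* QField F q) (σ : F →+* F)
    (hσ : ∀ c, φ (scalar c) = scalar (σ c))
    (hx : φ (x F q).toQField = (x F q).toQField) (f : F[X]) :
    φ (evalX f : QPlane F q).toQField = (evalX (f.map σ) : QPlane F q).toQField :=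
  algEval_toQField φ σ hσ hx f

theorem ringAut_evalY (φ : RingAut (QField F q)) (σ : RingAut F)
    (hσ : ∀ c, φ (scalar c) = scalar (σ c))
    (hy : φ (y F q).toQField = (y F q).toQField) (f : F[X]) :
    φ (evalY f : QPlane F q).toQField = (evalY (f.map (σ : F →+* F)) : QPlane F q).toQField :=
  evalY_toQField φ.toRingHom σ.toRingHom hσ hy f

theorem ringAut_evalX (φ : RingAut (QField F q)) (σ : RingAut F)
    (hσ : ∀ c, φ (scalar c) = scalar (σ c))
    (hx : φ (x F q).toQField = (x F q).toQField) (f : F[X]) :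
    φ (evalX f : QPlane F q).toQField = (evalX (f.map (σ : F →+* F)) : QPlane F q).toQField :=
  evalX_toQField φ.toRingHom σ.toRingHom hσ hx f

theorem lin_map (σ : F →+* F) (a : Fˣ) : (lin a).map σ = lin (Units.map σ.toMonoidHom a) := by
  simp [lin]

theorem ringAut_ext {φ ψ : RingAut (QField F q)}
    (hc : ∀ c : F, φ (scalar c) = ψ (scalar c))
    (hx : φ (x F q).toQField = ψ (x F q).toQField)
    (hy : φ (y F q).toQField = ψ (y F q).toQField) : φ = ψ := by
  have := ringHom_ext (f := φ.toRingHom) (g := ψ.toRingHom) hc hx hy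
  exact RingEquiv.ext fun z => DFunLike.congr_fun this z

/-- The action of a field automorphism on the coefficients. -/
noncomputable def coeffAut (σ : RingAut F) (hσ : σ q = q) : RingAut (QField F q) :=
  autOfMap (coeffMap σ hσ) (coeffMap_injective σ hσ)
    (fun c => ⟨scalar (σ.symm c), by
      rw [scalar, map_toQField, coeffMap_algebraMap, σ.apply_symm_apply, scalar]⟩)
    ⟨(x F q).toQField, by rw [map_toQField, coeffMap_x]⟩
    ⟨(y F q).toQField, by rw [map_toQField, coeffMap_y]⟩

theorem coeffAut_toQField (σ : RingAut F) (hσ : σ q = q) (P : QPlane F q) :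
    coeffAut σ hσ P.toQField = (coeffMap σ hσ P).toQField :=
  map_toQField _ (coeffMap_injective σ hσ) P

theorem coeffAut_scalar (σ : RingAut F) (hσ : σ q = q) (c : F) :
    coeffAut σ hσ (scalar c) = scalar (σ c) := by
  rw [scalar, coeffAut_toQField, coeffMap_algebraMap, scalar]

theorem coeffAut_x (σ : RingAut F) (hσ : σ q = q) :
    coeffAut σ hσ (x F q).toQField = (x F q).toQField := by
  rw [coeffAut_toQField, coeffMap_x]

theorem coeffAut_y (σ : RingAut F) (hσ : σ q = q) :
    coeffAut σ hσ (y F q).toQField = (y F q).toQField := by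
  rw [coeffAut_toQField, coeffMap_y]

theorem evalY_lin_ne_zero (b : Fˣ) : (evalY (lin b) : QPlane F q).toQField ≠ 0 :=
  toQField_ne_zero (evalY_ne_zero (lin_ne_zero b))

theorem evalX_lin_ne_zero (b : Fˣ) : (evalX (lin b) : QPlane F q).toQField ≠ 0 :=
  toQField_ne_zero (evalX_ne_zero (lin_ne_zero b))

theorem map_shearX_evalY (b : Fˣ) (f : F[X]) :
    map (shearX b) (shearX_injective b) (evalY f : QPlane F q).toQField =
      (evalY f : QPlane F q).toQField := by
  have := evalY_toQField (q := q) (map (shearX b) (shearX_injective b)) (RingHom.id F)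
    (fun c => by rw [scalar, map_toQField, shearX_algebraMap]; rfl)
    (by rw [map_toQField, shearX_y]) f
  rwa [Polynomial.map_id] at this

theorem map_shearY_evalX (c : Fˣ) (f : F[X]) :
    map (shearY c) (shearY_injective c) (evalX f : QPlane F q).toQField =
      (evalX f : QPlane F q).toQField := by
  have := evalX_toQField (q := q) (map (shearY c) (shearY_injective c)) (RingHom.id F)
    (fun c => by rw [scalar, map_toQField, shearY_algebraMap]; rfl)
    (by rw [map_toQField, shearY_x]) f
  rwa [Polynomial.map_id] at this

/-- A preimage of `x`: the shear becomes surjective once 1 + by is inverted. -/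
theorem map_shearX_mul_inv (b : Fˣ) :
    map (shearX b) (shearX_injective b)
      ((x F q).toQField * (evalY (lin b) : QPlane F q).toQField⁻¹) = (x F q).toQField := by
  rw [map_mul, map_inv₀, map_shearX_evalY, map_toQField, shearX_x, map_mul, mul_assoc,
    mul_inv_cancel₀ (evalY_lin_ne_zero b), mul_one]

theorem map_shearY_inv_mul (c : Fˣ) :
    map (shearY c) (shearY_injective c)
      ((evalX (lin c) : QPlane F q).toQField⁻¹ * (y F q).toQField) = (y F q).toQField := by
  rw [map_mul, map_inv₀, map_shearY_evalX, map_toQField, shearY_y, map_mul, ← mul_assoc,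
    inv_mul_cancel₀ (evalX_lin_ne_zero c), one_mul]

/-- The automorphism `x ↦ x (1 + b y)`, `y ↦ y` over the scalars. -/
noncomputable def shearAutX (b : Fˣ) : RingAut (QField F q) :=
  autOfMap (shearX b) (shearX_injective b)
    (fun c => ⟨scalar c, by rw [scalar, map_toQField, shearX_algebraMap]⟩)
    ⟨_, map_shearX_mul_inv b⟩
    ⟨(y F q).toQField, by rw [map_toQField, shearX_y]⟩

/-- The automorphism `x ↦ x`, `y ↦ (1 + c x) y` over the scalars. -/
noncomputable def shearAutY (c : Fˣ) : RingAut (QField F q) :=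
  autOfMap (shearY c) (shearY_injective c)
    (fun a => ⟨scalar a, by rw [scalar, map_toQField, shearY_algebraMap]⟩)
    ⟨(x F q).toQField, by rw [map_toQField, shearY_x]⟩
    ⟨_, map_shearY_inv_mul c⟩

theorem shearAutX_toQField (b : Fˣ) (P : QPlane F q) :
    shearAutX b P.toQField = (shearX b P).toQField := map_toQField _ (shearX_injective b) P

theorem shearAutX_scalar (b : Fˣ) (c : F) :
    shearAutX (q := q) b (scalar c) = scalar c := by
  rw [scalar, shearAutX_toQField, shearX_algebraMap]

theorem shearAutY_toQField (b : Fˣ) (P : QPlane F q) :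
    shearAutY b P.toQField = (shearY b P).toQField := map_toQField _ (shearY_injective b) P

theorem shearAutY_scalar (b : Fˣ) (c : F) :
    shearAutY (q := q) b (scalar c) = scalar c := by
  rw [scalar, shearAutY_toQField, shearY_algebraMap]

/-- The conjugate of the coefficient action `σ` under `x ↦ x (1 + b y)`. -/
noncomputable def twistX (σ : RingAut F) (hσ : σ q = q) (b : Fˣ) : RingAut (QField F q) :=
  shearAutX b * coeffAut σ hσ * (shearAutX b)⁻¹

/-- The conjugate of the coefficient action `σ` under `y ↦ (1 + c x) y`. -/
noncomputable def twistY (σ : RingAut F) (hσ : σ q = q) (c : Fˣ) : RingAut (QField F q) :=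
  shearAutY c * coeffAut σ hσ * (shearAutY c)⁻¹

theorem twistX_scalar (σ : RingAut F) (hσ : σ q = q) (b : Fˣ) (c : F) :
    twistX σ hσ b (scalar c) = scalar (σ c) := by
  have h : (shearAutX (q := q) b)⁻¹ (scalar c) = scalar c :=
    (RingEquiv.symm_apply_eq _).2 (shearAutX_scalar b c).symm
  rw [twistX, RingAut.mul_apply, RingAut.mul_apply, h, coeffAut_scalar, shearAutX_scalar]

theorem twistY_scalar (σ : RingAut F) (hσ : σ q = q) (b : Fˣ) (c : F) :
    twistY σ hσ b (scalar c) = scalar (σ c) := by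
  have h : (shearAutY (q := q) b)⁻¹ (scalar c) = scalar c :=
    (RingEquiv.symm_apply_eq _).2 (shearAutY_scalar b c).symm
  rw [twistY, RingAut.mul_apply, RingAut.mul_apply, h, coeffAut_scalar, shearAutY_scalar]

theorem twistX_y (σ : RingAut F) (hσ : σ q = q) (b : Fˣ) :
    twistX σ hσ b (y F q).toQField = (y F q).toQField := by
  have h1 : shearAutX b (y F q).toQField = (y F q).toQField := by
    rw [shearAutX_toQField, shearX_y]
  have h2 : (shearAutX (q := q) b)⁻¹ (y F q).toQField = (y F q).toQField :=
    (RingEquiv.symm_apply_eq _).2 h1.symm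
  rw [twistX, RingAut.mul_apply, RingAut.mul_apply, h2, coeffAut_y, h1]

theorem twistY_x (σ : RingAut F) (hσ : σ q = q) (b : Fˣ) :
    twistY σ hσ b (x F q).toQField = (x F q).toQField := by
  have h1 : shearAutY b (x F q).toQField = (x F q).toQField := by
    rw [shearAutY_toQField, shearY_x]
  have h2 : (shearAutY (q := q) b)⁻¹ (x F q).toQField = (x F q).toQField :=
    (RingEquiv.symm_apply_eq _).2 h1.symm
  rw [twistY, RingAut.mul_apply, RingAut.mul_apply, h2, coeffAut_x, h1]

/-- The three maps act in turn as x ↦ x(1 + by)⁻¹ ↦ x(1 + ay)⁻¹ ↦ x(1 + by)(1 + ay)⁻¹. -/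
theorem twistX_x (σ : RingAut F) (hσ : σ q = q) (a b : Fˣ) (hab : σ b = a) :
    twistX σ hσ b (x F q).toQField = (x F q).toQField *
      ((evalY (lin b) : QPlane F q).toQField / (evalY (lin a) : QPlane F q).toQField) := by
  have h2 : (shearAutX (q := q) b)⁻¹ (x F q).toQField =
      (x F q).toQField * (evalY (lin b) : QPlane F q).toQField⁻¹ :=
    (RingEquiv.symm_apply_eq _).2 (map_shearX_mul_inv b).symm
  have h3 : coeffAut σ hσ (evalY (lin b) : QPlane F q).toQField =
      (evalY (lin a) : QPlane F q).toQField := by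
    have := evalY_toQField (coeffAut σ hσ).toRingHom σ.toRingHom (coeffAut_scalar σ hσ)
      (coeffAut_y σ hσ) (lin b)
    rw [lin_map, show Units.map σ.toRingHom.toMonoidHom b = a from Units.ext hab] at this
    exact this
  rw [twistX, RingAut.mul_apply, RingAut.mul_apply, h2, map_mul, map_inv₀, coeffAut_x, h3,
    map_mul, map_inv₀, div_eq_mul_inv, ← mul_assoc]
  congr 2
  · rw [shearAutX_toQField, shearX_x, map_mul]
  · exact map_shearX_evalY b _

theorem twistY_y (σ : RingAut F) (hσ : σ q = q) (c d : Fˣ) (hcd : σ c = d) :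
    twistY σ hσ c (y F q).toQField =
      (evalX (lin c) : QPlane F q).toQField / (evalX (lin d) : QPlane F q).toQField *
        (y F q).toQField := by
  have h2 : (shearAutY (q := q) c)⁻¹ (y F q).toQField =
      (evalX (lin c) : QPlane F q).toQField⁻¹ * (y F q).toQField :=
    (RingEquiv.symm_apply_eq _).2 (map_shearY_inv_mul c).symm
  have h3 : coeffAut σ hσ (evalX (lin c) : QPlane F q).toQField =
      (evalX (lin d) : QPlane F q).toQField := by
    have := evalX_toQField (coeffAut σ hσ).toRingHom σ.toRingHom (coeffAut_scalar σ hσ)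
      (coeffAut_x σ hσ) (lin c)
    rw [lin_map, show Units.map σ.toRingHom.toMonoidHom c = d from Units.ext hcd] at this
    exact this
  -- The conjugation produces (1 + dx)⁻¹(1 + cx)y, while the quotient is written with the inverse
  -- second.
  have hcomm : Commute (evalX (lin d) : QPlane F q).toQField⁻¹
      (evalX (lin c) : QPlane F q).toQField := by
    refine Commute.inv_left₀ ?_
    rw [Commute, SemiconjBy, ← map_mul, ← map_mul, ← evalX_mul, ← evalX_mul, mul_comm]
  rw [twistY, RingAut.mul_apply, RingAut.mul_apply, h2, map_mul, map_inv₀, coeffAut_y, h3,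
    map_mul, map_inv₀, div_eq_mul_inv, ← hcomm.eq, mul_assoc]
  congr 2
  · exact map_shearY_evalX c _
  · rw [shearAutY_toQField, shearY_y, map_mul]

end QField

/-! ### The reflections on the parameters and their Coxeter relations. -/

namespace Params

variable {F : Type u} [Field F] {K : Type v} [Field K]

/-- The image of the parameters under a field homomorphism. -/
def map (τ : F →+* K) (p : Params F) : Params K where
  h₁ := Units.map τ.toMonoidHom p.h₁
  h₂ := Units.map τ.toMonoidHom p.h₂
  e j := Units.map τ.toMonoidHom (p.e j)

theorem ext_e {p p' : Params F} (h1 : p.h₁ = p'.h₁) (h2 : p.h₂ = p'.h₂)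
    (he : ∀ j, p.e j = p'.e j) : p = p' := Params.ext h1 h2 (funext he)

/-- The reflections are monomial in the parameters, hence natural in the field. This turns
identities between reflected parameters into identities between field automorphisms. -/
theorem map_refl (τ : F →+* K) (p : Params F) (i : Fin 9) :
    (p.refl i).map τ = (p.map τ).refl i := by
  fin_cases i <;> refine ext_e ?_ ?_ fun j => ?_ <;> simp [refl, map, Function.update_apply] <;>
    split_ifs <;> simp

/-- Both sides of the constraint acquire the same factor: (h₂/(e₁₀e₁₁))⁶ under s₀, (h₁/(e₁e₇))³
under s₃, and 1 under the other nodes, which exchange parameters of equal exponent. -/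
theorem refl_constraint {p : Params F} (hp : p.Constraint) (i : Fin 9) :
    (p.refl i).Constraint := by
  have h := congrArg Units.val hp
  rw [Constraint, ← Units.val_inj]
  push_cast at h
  fin_cases i
  all_goals simp [refl, Equiv.swap_apply_def]
  any_goals field_simp
  any_goals linear_combination h

theorem refl_refl (p : Params F) (i : Fin 9) : (p.refl i).refl i = p := by
  fin_cases i
  all_goals
    refine ext_e ?_ ?_ fun j => ?_
    any_goals fin_cases j
    all_goals simp [refl, Equiv.swap_apply_def]
    all_goals try (rw [← Units.val_inj]; push_cast; field_simp)

/-- The parameters with `e` permuted. -/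
def perm (p : Params F) (τ : Equiv.Perm (Fin 11)) : Params F := { p with e := p.e ∘ τ }

/-- The permutation of the indices of `e` belonging to a node other than `0` and `3`. -/
def nodePerm : Fin 9 → Equiv.Perm (Fin 11) :=
  ![1, Equiv.swap 7 8, Equiv.swap 6 7, 1, Equiv.swap 0 1, Equiv.swap 1 2, Equiv.swap 2 3,
    Equiv.swap 3 4, Equiv.swap 4 5]

theorem refl_eq_perm (p : Params F) {i : Fin 9} (h0 : i ≠ 0) (h3 : i ≠ 3) :
    p.refl i = p.perm (nodePerm i) := by
  fin_cases i
  · exact absurd rfl h0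
  · rfl
  · rfl
  · exact absurd rfl h3
  all_goals rfl

theorem perm_refl_zero (p : Params F) {τ : Equiv.Perm (Fin 11)} (h9 : τ 9 = 9) (h10 : τ 10 = 10) :
    (p.perm τ).refl 0 = (p.refl 0).perm τ := by
  have h9' : ∀ j, τ j = 9 ↔ j = 9 := fun j => by rw [← τ.injective.eq_iff (a := j), h9]
  have h10' : ∀ j, τ j = 10 ↔ j = 10 := fun j => by rw [← τ.injective.eq_iff (a := j), h10]
  refine ext_e ?_ rfl fun j => ?_
  · simp only [refl, perm, Function.comp_apply, h9, h10]
  · simp only [refl, perm, Function.comp_apply, Function.update_apply, h9, h10, h9', h10']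

theorem perm_refl_three (p : Params F) {τ : Equiv.Perm (Fin 11)} (h0 : τ 0 = 0) (h6 : τ 6 = 6) :
    (p.perm τ).refl 3 = (p.refl 3).perm τ := by
  have h0' : ∀ j, τ j = 0 ↔ j = 0 := fun j => by rw [← τ.injective.eq_iff (a := j), h0]
  have h6' : ∀ j, τ j = 6 ↔ j = 6 := fun j => by rw [← τ.injective.eq_iff (a := j), h6]
  refine ext_e rfl ?_ fun j => ?_
  · simp only [refl, perm, Function.comp_apply, h0, h6]
  · simp only [refl, perm, Function.comp_apply, Function.update_apply, h0, h6, h0', h6']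

/-- Since 0 and 3 are joined, a commuting pair contains at least one node that merely permutes `e`,
and this permutation fixes the indices which the other node uses. -/
theorem refl_comm (p : Params F) {i j : Fin 9} (hij : affineE8 i j = 2) :
    (p.refl i).refl j = (p.refl j).refl i := by
  have perm9 : ∀ i : Fin 9, affineE8 i 0 = 2 → nodePerm i 9 = 9 ∧ nodePerm i 10 = 10 := by decide
  have perm6 : ∀ i : Fin 9, affineE8 i 3 = 2 → nodePerm i 0 = 0 ∧ nodePerm i 6 = 6 := by decide
  have hperm : ∀ i j : Fin 9, affineE8 i j = 2 → i ≠ 0 → i ≠ 3 → j ≠ 0 → j ≠ 3 →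
      nodePerm i * nodePerm j = nodePerm j * nodePerm i := by
    intro i; fin_cases i <;> decide
  have ne : ∀ i j : Fin 9, affineE8 i j = 2 → i ≠ j := by
    intro i; fin_cases i <;> decide
  have n03 : ¬ affineE8 0 3 = 2 := by decide
  have symm : ∀ {i j : Fin 9}, affineE8 i j = 2 → affineE8 j i = 2 := fun {i j} h => by
    rw [affineE8.symmetric]; exact h
  have key : ∀ i j : Fin 9, affineE8 i j = 2 → i ≠ 0 → i ≠ 3 →
      (p.refl i).refl j = (p.refl j).refl i := by
    intro i j h i0 i3
    rw [refl_eq_perm p i0 i3, refl_eq_perm (p.refl j) i0 i3]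
    by_cases j0 : j = 0
    · subst j0
      exact perm_refl_zero p (perm9 i h).1 (perm9 i h).2
    by_cases j3 : j = 3
    · subst j3
      exact perm_refl_three p (perm6 i h).1 (perm6 i h).2
    rw [refl_eq_perm p j0 j3, refl_eq_perm _ j0 j3]
    exact ext_e rfl rfl fun l =>
      congrArg p.e (DFunLike.congr_fun (hperm i j h i0 i3 j0 j3) l)
  by_cases i0 : i = 0
  · subst i0
    refine (key j 0 (symm hij) (ne _ _ (symm hij)) fun h => n03 (h ▸ hij)).symm
  by_cases i3 : i = 3
  · subst i3
    refine (key j 3 (symm hij) (fun h => n03 (h ▸ symm hij)) (ne _ _ (symm hij))).symm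
  exact key i j hij i0 i3

theorem refl_braid_zero_three (p : Params F) :
    ((p.refl 0).refl 3).refl 0 = ((p.refl 3).refl 0).refl 3 := by
  refine ext_e ?_ ?_ fun j => ?_
  any_goals fin_cases j
  all_goals simp [refl]
  all_goals try (rw [← Units.val_inj]; push_cast; field_simp)

theorem refl_braid_three_two (p : Params F) :
    ((p.refl 3).refl 2).refl 3 = ((p.refl 2).refl 3).refl 2 := by
  refine ext_e ?_ ?_ fun j => ?_
  any_goals fin_cases j
  all_goals simp [refl, Equiv.swap_apply_def]
  all_goals try (rw [← Units.val_inj]; push_cast; field_simp)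

theorem refl_braid_three_four (p : Params F) :
    ((p.refl 3).refl 4).refl 3 = ((p.refl 4).refl 3).refl 4 := by
  refine ext_e ?_ ?_ fun j => ?_
  any_goals fin_cases j
  all_goals simp [refl, Equiv.swap_apply_def]
  all_goals try (rw [← Units.val_inj]; push_cast; field_simp)

theorem refl_braid (p : Params F) {i j : Fin 9} (hij : affineE8 i j = 3) :
    ((p.refl i).refl j).refl i = ((p.refl j).refl i).refl j := by
  have hperm : ∀ i j : Fin 9, affineE8 i j = 3 → i ≠ 0 → i ≠ 3 → j ≠ 0 → j ≠ 3 →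
      nodePerm i * nodePerm j * nodePerm i = nodePerm j * nodePerm i * nodePerm j := by
    intro i; fin_cases i <;> decide
  have nb0 : ∀ i : Fin 9, affineE8 i 0 = 3 → i = 3 := by decide
  have nb3 : ∀ i : Fin 9, affineE8 i 3 = 3 → i = 0 ∨ i = 2 ∨ i = 4 := by decide
  have symm : ∀ {i j : Fin 9}, affineE8 i j = 3 → affineE8 j i = 3 := fun {i j} h => by
    rw [affineE8.symmetric]; exact h
  by_cases i0 : i = 0
  · subst i0
    obtain rfl := nb0 j (symm hij)
    exact refl_braid_zero_three p
  by_cases j0 : j = 0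
  · subst j0
    obtain rfl := nb0 i hij
    exact (refl_braid_zero_three p).symm
  by_cases i3 : i = 3
  · subst i3
    obtain rfl | rfl | rfl := nb3 j (symm hij)
    exacts [absurd rfl j0, refl_braid_three_two p, refl_braid_three_four p]
  by_cases j3 : j = 3
  · subst j3
    obtain rfl | rfl | rfl := nb3 i hij
    exacts [absurd rfl i0, (refl_braid_three_two p).symm, (refl_braid_three_four p).symm]
  simp only [refl_eq_perm _ i0 i3, refl_eq_perm _ j0 j3]
  exact ext_e rfl rfl fun l => congrArg p.e (DFunLike.congr_fun (hperm i j hij i0 i3 j0 j3) l)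

/-- The twelve parameters other than `e₁`. -/
def free (p : Params F) : Fin 12 → Fˣ :=
  Fin.cons p.h₁ (Fin.cons p.h₂ fun j : Fin 10 => p.e j.succ)

theorem e_zero_eq {p : Params F} (hp : p.Constraint) :
    p.e 0 = p.h₁ ^ 6 * p.h₂ ^ 3 / (p.e 1 * p.e 2 * p.e 3 * p.e 4 * p.e 5 * p.e 6 ^ 2 *
      p.e 7 ^ 2 * p.e 8 ^ 2 * p.e 9 ^ 3 * p.e 10 ^ 3) := by
  rw [eq_div_iff_mul_eq', hp]
  simp only [mul_assoc]

theorem ext_free {p p' : Params F} (hp : p.Constraint) (hp' : p'.Constraint)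
    (h : ∀ j, p.free j = p'.free j) : p = p' := by
  have h1 : p.h₁ = p'.h₁ := h 0
  have h2 : p.h₂ = p'.h₂ := h 1
  have he : ∀ j : Fin 10, p.e j.succ = p'.e j.succ := fun j => h j.succ.succ
  refine ext_e h1 h2 fun j => Fin.cases ?_ he j
  rw [e_zero_eq hp, e_zero_eq hp', h1, h2, show p.e 1 = p'.e 1 from he 0,
    show p.e 2 = p'.e 2 from he 1, show p.e 3 = p'.e 3 from he 2, show p.e 4 = p'.e 4 from he 3,
    show p.e 5 = p'.e 5 from he 4, show p.e 6 = p'.e 6 from he 5, show p.e 7 = p'.e 7 from he 6,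
    show p.e 8 = p'.e 8 from he 7, show p.e 9 = p'.e 9 from he 8,
    show p.e 10 = p'.e 10 from he 9]

theorem map_constraint (τ : F →+* K) {p : Params F} (hp : p.Constraint) :
    (p.map τ).Constraint := by
  have := congrArg (Units.map τ.toMonoidHom) hp
  simp only [map_mul, map_pow] at this
  exact this

/-- All parameters lie in the subfield `E`. -/
def Mem (p : Params F) (E : Subfield F) : Prop :=
  (p.h₁ : F) ∈ E ∧ (p.h₂ : F) ∈ E ∧ ∀ j, (p.e j : F) ∈ E

theorem Mem.refl {p : Params F} {E : Subfield F} (hp : p.Mem E) (i : Fin 9) :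
    (p.refl i).Mem E := by
  obtain ⟨h1, h2, he⟩ := hp
  have zero : (p.refl 0).Mem E := by
    refine ⟨?_, h2, fun j => ?_⟩
    · simpa [Params.refl] using E.div_mem (E.mul_mem h1 h2) (E.mul_mem (he 9) (he 10))
    · simp only [Params.refl, Function.update_apply]
      split_ifs
      · simpa using E.div_mem h2 (he 9)
      · simpa using E.div_mem h2 (he 10)
      · exact he j
  have three : (p.refl 3).Mem E := by
    refine ⟨h1, ?_, fun j => ?_⟩
    · simpa [Params.refl] using E.div_mem (E.mul_mem h1 h2) (E.mul_mem (he 0) (he 6))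
    · simp only [Params.refl, Function.update_apply]
      split_ifs
      · simpa using E.div_mem h1 (he 0)
      · simpa using E.div_mem h1 (he 6)
      · exact he j
  fin_cases i
  · exact zero
  on_goal 3 => exact three
  all_goals exact ⟨h1, h2, fun j => he _⟩

theorem mem_of_free {p : Params F} (hp : p.Constraint) {E : Subfield F}
    (h : ∀ j, (p.free j : F) ∈ E) : p.Mem E := by
  have h1 : (p.h₁ : F) ∈ E := h 0
  have h2 : (p.h₂ : F) ∈ E := h 1
  have he : ∀ j : Fin 10, (p.e j.succ : F) ∈ E := fun j => h j.succ.succ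
  refine ⟨h1, h2, fun j => Fin.cases ?_ he j⟩
  have h0 := congrArg Units.val (e_zero_eq hp)
  push_cast at h0
  rw [h0]
  have e1 := he 0; have e2 := he 1; have e3 := he 2; have e4 := he 3; have e5 := he 4
  have e6 := he 5; have e7 := he 6; have e8 := he 7; have e9 := he 8; have e10 := he 9
  simp only [Fin.reduceSucc] at e1 e2 e3 e4 e5 e6 e7 e8 e9 e10
  apply_rules [E.div_mem, E.mul_mem, pow_mem]

end Params

/-! ### The reflections as automorphisms of the field of parameters. -/

section ParamField

variable (k : Type u) [Field k]

theorem genericParams_free (j : Fin 12) : (genericParams k).free j = paramVar k j := by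
  fin_cases j <;> rfl

variable {k}

theorem paramField_hom_ext {K : Type v} [Field K] {f g : ParamField k →+* K}
    (hc : ∀ c : k, f (algebraMap k _ c) = g (algebraMap k _ c))
    (h : (genericParams k).map f = (genericParams k).map g) : f = g := by
  refine IsFractionRing.injective_comp_algebraMap (A := MvPolynomial (Fin 12) k) ?_
  refine MvPolynomial.ringHom_ext (fun c => ?_) fun j => ?_
  · simpa [IsScalarTower.algebraMap_apply k (MvPolynomial (Fin 12) k) (ParamField k)] using hc c
  · have h1 : ((genericParams k).map f).free j = ((genericParams k).map g).free j := by rw [h]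
    have h2 : ∀ τ : ParamField k →+* K, ((genericParams k).map τ).free j =
        Units.map τ.toMonoidHom (paramVar k j) := fun τ => by fin_cases j <;> rfl
    rw [h2, h2] at h1
    exact congrArg Units.val h1

theorem algebraicIndependent_paramVar :
    AlgebraicIndependent k fun j => (paramVar k j : ParamField k) := by
  rw [algebraicIndependent_iff_injective_aeval]
  have : (MvPolynomial.aeval fun j => (paramVar k j : ParamField k)) =
      IsScalarTower.toAlgHom k (MvPolynomial (Fin 12) k) (ParamField k) := by
    refine MvPolynomial.algHom_ext fun j => ?_
    simp [paramVar]
  rw [this]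
  exact IsFractionRing.injective _ _

theorem intermediateField_eq_top {E : IntermediateField k (ParamField k)}
    (h : ∀ j, (paramVar k j : ParamField k) ∈ E) : E = ⊤ := by
  rw [eq_top_iff]
  intro z _
  obtain ⟨a, b, -, rfl⟩ := IsFractionRing.div_surjective (A := MvPolynomial (Fin 12) k) z
  have : ∀ a : MvPolynomial (Fin 12) k, algebraMap _ (ParamField k) a ∈ E := by
    intro a
    induction a using MvPolynomial.induction_on with
    | C c =>
      have := E.algebraMap_mem c
      rwa [IsScalarTower.algebraMap_apply k (MvPolynomial (Fin 12) k) (ParamField k)] at this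
    | add a b ha hb => rw [map_add]; exact E.add_mem ha hb
    | mul_X a j ha => rw [map_mul]; exact E.mul_mem ha (h j)
  exact E.div_mem (this a) (this b)

/-- The field has transcendence degree at least 12, witnessed by the independent variables, so
twelve generators cannot satisfy a relation. -/
theorem algebraicIndependent_of_adjoin_eq_top (u : Fin 12 → ParamField k)
    (h : IntermediateField.adjoin k (Set.range u) = ⊤) : AlgebraicIndependent k u := by
  have alg : Algebra.IsAlgebraic (Algebra.adjoin k (Set.range u)) (ParamField k) := by
    refine ⟨fun z => ?_⟩
    have hz : z ∈ IntermediateField.adjoin k (Set.range u) := h ▸ IntermediateField.mem_top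
    obtain ⟨r, hr, s, hs, rfl⟩ := IntermediateField.mem_adjoin_iff_div.1 hz
    have h1 := isAlgebraic_algebraMap (A := ParamField k)
      (⟨r, hr⟩ : Algebra.adjoin k (Set.range u))
    have h2 := isAlgebraic_algebraMap (A := ParamField k)
      (⟨s, hs⟩ : Algebra.adjoin k (Set.range u))
    rw [div_eq_mul_inv]
    exact h1.mul h2.inv
  refine (Algebra.IsAlgebraic.isTranscendenceBasis_of_lift_le_trdeg_of_finite k u ?_).1
  have := (algebraicIndependent_paramVar (k := k)).lift_cardinalMk_le_trdeg
  simpa using this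

/-- Reflecting twice returns the original parameters, so the field generated by the reflected ones
contains every independent variable. -/
theorem algebraicIndependent_refl (i : Fin 9) :
    AlgebraicIndependent k fun j => (((genericParams k).refl i).free j : ParamField k) := by
  refine algebraicIndependent_of_adjoin_eq_top _ (intermediateField_eq_top fun j => ?_)
  set E := IntermediateField.adjoin k
    (Set.range fun j => (((genericParams k).refl i).free j : ParamField k))
  have h1 : ((genericParams k).refl i).Mem E.toSubfield :=
    Params.mem_of_free (Params.refl_constraint (genericParams_constraint k) i) fun j =>
      IntermediateField.subset_adjoin k _ ⟨j, rfl⟩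
  have h2 := h1.refl i
  rw [Params.refl_refl] at h2
  rw [← genericParams_free]
  exact Fin.cases h2.1 (fun j => Fin.cases h2.2.1 (fun j => h2.2.2 _) j) j

/-- The endomorphism `s_i` of the field of parameters. -/
noncomputable def reflHom (i : Fin 9) : ParamField k →+* ParamField k :=
  IsFractionRing.lift (algebraicIndependent_iff_injective_aeval.1 (algebraicIndependent_refl i) :
    Function.Injective ((MvPolynomial.aeval fun j =>
      (((genericParams k).refl i).free j : ParamField k) :
        MvPolynomial (Fin 12) k →ₐ[k] ParamField k) : MvPolynomial (Fin 12) k →+* ParamField k))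

theorem reflHom_algebraMap (i : Fin 9) (c : k) :
    reflHom i (algebraMap k (ParamField k) c) = algebraMap k _ c := by
  rw [IsScalarTower.algebraMap_apply k (MvPolynomial (Fin 12) k) (ParamField k), reflHom,
    IsFractionRing.lift_algebraMap]
  exact (MvPolynomial.aeval _).commutes c

theorem map_reflHom (i : Fin 9) :
    (genericParams k).map (reflHom i) = (genericParams k).refl i := by
  have hg := genericParams_constraint k
  refine Params.ext_free (Params.map_constraint _ hg) (Params.refl_constraint hg i) fun j => ?_
  have h2 : ((genericParams k).map (reflHom i)).free j =
      Units.map (reflHom (k := k) i).toMonoidHom (paramVar k j) := by fin_cases j <;> rfl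
  rw [h2, ← Units.val_inj]
  change reflHom i (algebraMap _ _ (MvPolynomial.X j)) = _
  rw [reflHom, IsFractionRing.lift_algebraMap]
  exact MvPolynomial.aeval_X _ j

theorem Params.map_comp {F K L : Type*} [Field F] [Field K] [Field L] (f : F →+* K) (g : K →+* L)
    (p : Params F) : p.map (g.comp f) = (p.map f).map g := rfl

/-- By naturality the composite sends the generic parameters to their double reflection;
homomorphisms agreeing on constants and generic parameters coincide. The commutation and braid
relations below follow in the same way. -/
theorem reflHom_comp_self (i : Fin 9) :
    (reflHom (k := k) i).comp (reflHom i) = RingHom.id _ := by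
  refine paramField_hom_ext (fun c => ?_) ?_
  · simp only [RingHom.comp_apply, reflHom_algebraMap, RingHom.id_apply]
  · rw [Params.map_comp, map_reflHom, Params.map_refl, map_reflHom, Params.refl_refl]
    rfl

/-- The automorphism `s_i` of the field of parameters. -/
noncomputable def reflAut (i : Fin 9) : RingAut (ParamField k) :=
  RingEquiv.ofRingHom (reflHom i) (reflHom i) (reflHom_comp_self i) (reflHom_comp_self i)

theorem reflAut_algebraMap (i : Fin 9) (c : k) :
    reflAut i (algebraMap k (ParamField k) c) = algebraMap k _ c := reflHom_algebraMap i c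

theorem reflAut_h₁ (i : Fin 9) :
    reflAut i ((genericParams k).h₁ : ParamField k) = ((genericParams k).refl i).h₁ :=
  congrArg (fun p : Params (ParamField k) => (p.h₁ : ParamField k)) (map_reflHom i)

theorem reflAut_h₂ (i : Fin 9) :
    reflAut i ((genericParams k).h₂ : ParamField k) = ((genericParams k).refl i).h₂ :=
  congrArg (fun p : Params (ParamField k) => (p.h₂ : ParamField k)) (map_reflHom i)

theorem reflAut_e (i : Fin 9) (j : Fin 11) :
    reflAut i ((genericParams k).e j : ParamField k) = ((genericParams k).refl i).e j :=
  congrArg (fun p : Params (ParamField k) => (p.e j : ParamField k)) (map_reflHom i)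

theorem val_qParam (q : kˣ) : (qParam q : ParamField k) = algebraMap k (ParamField k) q :=
  Units.coe_map _ q

theorem reflAut_q (i : Fin 9) (q : kˣ) : reflAut i (qParam q : ParamField k) = qParam q := by
  rw [val_qParam, reflAut_algebraMap]

theorem reflAut_reflAut (i : Fin 9) (z : ParamField k) : reflAut i (reflAut i z) = z :=
  (reflAut i).apply_symm_apply z

theorem reflAut_comm {i j : Fin 9} (hij : affineE8 i j = 2) (z : ParamField k) :
    reflAut i (reflAut j z) = reflAut j (reflAut i z) := by
  have : (reflHom (k := k) i).comp (reflHom j) = (reflHom j).comp (reflHom i) := by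
    refine paramField_hom_ext (fun c => ?_) ?_
    · simp only [RingHom.comp_apply, reflHom_algebraMap]
    · simp only [Params.map_comp, map_reflHom, Params.map_refl]
      exact Params.refl_comm _ hij
  exact DFunLike.congr_fun this z

theorem reflAut_braid {i j : Fin 9} (hij : affineE8 i j = 3) (z : ParamField k) :
    reflAut i (reflAut j (reflAut i z)) = reflAut j (reflAut i (reflAut j z)) := by
  have : (reflHom (k := k) i).comp ((reflHom j).comp (reflHom i)) =
      (reflHom j).comp ((reflHom i).comp (reflHom j)) := by
    refine paramField_hom_ext (fun c => ?_) ?_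
    · simp only [RingHom.comp_apply, reflHom_algebraMap]
    · simp only [Params.map_comp, map_reflHom, Params.map_refl]
      exact Params.refl_braid _ hij
  exact DFunLike.congr_fun this z

end ParamField

/-! ### Two identities in a skew field behind the braid relation of the nodes 0 and 3. -/

section Braid

variable {F : Type u} [Field F] {K : Type v} [DivisionRing K] [Algebra F K]

/-- In the application X = s₀(x), Y = s₃(y), Y' = s₀(Y), and b d / c = s₃(b). The numerators 1 +
(bd/c)Y and 1 + (bd/c)Y' both become the same element N after left multiplication by 1 + dx and 1 +
dX respectively. Only the three displayed relations enter, no commutation rule between x and y. -/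
theorem braid_identity_x {a b c d : F} (hb : b ≠ 0) (hc : c ≠ 0) (hd : d ≠ 0)
    {x y X Y Y' : K} (hx : x ≠ 0) (hX0 : X ≠ 0) (h1 : 1 + b • y ≠ 0) (h2 : 1 + d • x ≠ 0)
    (h3 : 1 + (b * d / c) • Y ≠ 0) (h5 : 1 + d • X ≠ 0)
    (h7 : 1 + (b * d / c) • Y' ≠ 0)
    (hX : X * (1 + a • y) = x * (1 + b • y)) (hY : (1 + d • x) * Y = (1 + c • x) * y)
    (hY' : (1 + d • X) * Y' = (1 + (c * a / b) • X) * y) :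
    x * ((1 + (b * d / c) • Y) * (1 + a • Y)⁻¹) =
      X * ((1 + (b * d / c) • Y') * (1 + b • Y')⁻¹) := by
  set N : K := 1 + d • x + (b * d / c) • y + (b * d) • (x * y) with hN
  have e1 : (1 + d • x) * (1 + (b * d / c) • Y) = N := by
    linear_combination (norm := skip) (b * d / c) • hY
    rw [hN]
    simp only [mul_add, add_mul, smul_mul_assoc, mul_smul_comm, mul_one, one_mul]
    match_scalars <;> field_simp <;> ring
  have e2 : (1 + d • X) * (1 + (b * d / c) • Y') = N := by
    linear_combination (norm := skip) (b * d / c) • hY' + d • hX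
    rw [hN]
    simp only [mul_add, add_mul, smul_mul_assoc, mul_smul_comm, mul_one, one_mul]
    match_scalars <;> field_simp <;> ring
  have hN0 : N ≠ 0 := e1 ▸ mul_ne_zero h2 h3
  have i1 : (1 + (b * d / c) • Y)⁻¹ = N⁻¹ * (1 + d • x) := by
    rw [← e1, mul_inv_rev, mul_assoc, inv_mul_cancel₀ h2, mul_one]
  have i2 : (1 + (b * d / c) • Y')⁻¹ = N⁻¹ * (1 + d • X) := by
    rw [← e2, mul_inv_rev, mul_assoc, inv_mul_cancel₀ h5, mul_one]
  -- A quotient of two affine functions of Y is a constant plus a multiple of the inverse of the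
  -- denominator, so after inverting both sides everything is linear in N⁻¹.
  have q1 : (1 + a • Y) * (1 + (b * d / c) • Y)⁻¹ =
      (a * c / (b * d)) • 1 + (1 - a * c / (b * d)) • (N⁻¹ * (1 + d • x)) := by
    rw [← i1]
    have : 1 + a • Y = (a * c / (b * d)) • (1 + (b * d / c) • Y) +
        (1 - a * c / (b * d)) • (1 : K) := by
      match_scalars <;> field_simp
      ring
    rw [this, add_mul, smul_mul_assoc, mul_inv_cancel₀ h3, smul_mul_assoc, one_mul]
  have q2 : (1 + b • Y') * (1 + (b * d / c) • Y')⁻¹ =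
      (c / d) • 1 + (1 - c / d) • (N⁻¹ * (1 + d • X)) := by
    rw [← i2]
    have : 1 + b • Y' = (c / d) • (1 + (b * d / c) • Y') + (1 - c / d) • (1 : K) := by
      match_scalars <;> field_simp
      ring
    rw [this, add_mul, smul_mul_assoc, mul_inv_cancel₀ h7, smul_mul_assoc, one_mul]
  apply inv_injective
  rw [mul_inv_rev, mul_inv_rev, inv_inv, mul_inv_rev, mul_inv_rev, inv_inv, q1, q2]
  -- The element x(1 + by) = X(1 + ay) absorbs both x⁻¹ and X⁻¹ on its left; clearing N⁻¹ as well
  -- leaves a multiple of `hX`.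
  apply mul_right_cancel₀ (mul_ne_zero hx h1)
  apply mul_left_cancel₀ hN0
  have r1 : x⁻¹ * (x * (1 + b • y)) = 1 + b • y := inv_mul_cancel_left₀ hx _
  have r2 : X⁻¹ * (x * (1 + b • y)) = 1 + a • y := by
    rw [← hX, inv_mul_cancel_left₀ hX0]
  rw [mul_assoc _ x⁻¹, mul_assoc _ X⁻¹, r1, r2]
  simp only [add_mul, mul_add, smul_mul_assoc, mul_smul_comm, one_mul, mul_one,
    mul_inv_cancel_left₀ hN0, mul_inv_cancel₀ hN0, mul_assoc] at hX ⊢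
  have hX' : X + a • (X * y) = x + b • (x * y) := hX
  linear_combination (norm := skip) ((1 - c / d) * d) • (-hX')
  rw [hN]
  simp only [add_mul, smul_mul_assoc, one_mul, mul_assoc]
  match_scalars <;> field_simp <;> ring

/-- The mirror image: here X' = s₃(X) and c a / b = s₀(c), the common element is B, and denominators
are cleared on the other side. -/
theorem braid_identity_y {a b c d : F} (ha : a ≠ 0) (hb : b ≠ 0) (hc : c ≠ 0)
    {x y X Y X' : K} (hy : y ≠ 0) (hY0 : Y ≠ 0) (h1 : 1 + a • y ≠ 0) (h2 : 1 + c • x ≠ 0)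
    (h3 : 1 + (c * a / b) • X ≠ 0) (h5 : 1 + a • Y ≠ 0) (h7 : 1 + (c * a / b) • X' ≠ 0)
    (hX : X * (1 + a • y) = x * (1 + b • y)) (hY : (1 + d • x) * Y = (1 + c • x) * y)
    (hX' : X' * (1 + a • Y) = x * (1 + (b * d / c) • Y)) :
    (1 + (c * a / b) • X) * (1 + d • X)⁻¹ * y =
      (1 + (c * a / b) • X') * (1 + c • X')⁻¹ * Y := by
  set B : K := 1 + (c * a / b) • x + a • y + (a * c) • (x * y) with hB
  have e1 : (1 + (c * a / b) • X) * (1 + a • y) = B := by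
    linear_combination (norm := skip) (c * a / b) • hX
    rw [hB]
    simp only [mul_add, add_mul, smul_mul_assoc, mul_smul_comm, mul_one, one_mul]
    match_scalars <;> field_simp <;> ring
  have e2 : (1 + (c * a / b) • X') * (1 + a • Y) = B := by
    linear_combination (norm := skip) (c * a / b) • hX' + a • hY
    rw [hB]
    simp only [mul_add, add_mul, smul_mul_assoc, mul_smul_comm, mul_one, one_mul]
    match_scalars <;> field_simp <;> ring
  have hB0 : B ≠ 0 := e1 ▸ mul_ne_zero h3 h1
  have i1 : (1 + (c * a / b) • X)⁻¹ = (1 + a • y) * B⁻¹ := by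
    rw [← e1, mul_inv_rev, mul_inv_cancel_left₀ h1]
  have i2 : (1 + (c * a / b) • X')⁻¹ = (1 + a • Y) * B⁻¹ := by
    rw [← e2, mul_inv_rev, mul_inv_cancel_left₀ h5]
  have q1 : (1 + d • X) * (1 + (c * a / b) • X)⁻¹ =
      (b * d / (a * c)) • 1 + (1 - b * d / (a * c)) • ((1 + a • y) * B⁻¹) := by
    rw [← i1]
    have : 1 + d • X = (b * d / (a * c)) • (1 + (c * a / b) • X) +
        (1 - b * d / (a * c)) • (1 : K) := by
      match_scalars <;> field_simp
      ring
    rw [this, add_mul, smul_mul_assoc, mul_inv_cancel₀ h3, smul_mul_assoc, one_mul]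
  have q2 : (1 + c • X') * (1 + (c * a / b) • X')⁻¹ =
      (b / a) • 1 + (1 - b / a) • ((1 + a • Y) * B⁻¹) := by
    rw [← i2]
    have : 1 + c • X' = (b / a) • (1 + (c * a / b) • X') + (1 - b / a) • (1 : K) := by
      match_scalars <;> field_simp
      ring
    rw [this, add_mul, smul_mul_assoc, mul_inv_cancel₀ h7, smul_mul_assoc, one_mul]
  apply inv_injective
  rw [mul_inv_rev, mul_inv_rev, inv_inv, mul_inv_rev, mul_inv_rev, inv_inv, q1, q2]
  apply mul_left_cancel₀ (mul_ne_zero h2 hy)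
  apply mul_right_cancel₀ hB0
  have r1 : (1 + c • x) * y * y⁻¹ = 1 + c • x := mul_inv_cancel_right₀ hy _
  have r2 : (1 + c • x) * y * Y⁻¹ = 1 + d • x := by
    rw [← hY, mul_inv_cancel_right₀ hY0]
  rw [← mul_assoc _ y⁻¹, ← mul_assoc _ Y⁻¹, r1, r2]
  simp only [add_mul, mul_add, smul_mul_assoc, mul_smul_comm, one_mul, mul_one,
    inv_mul_cancel₀ hB0, mul_assoc] at hY ⊢
  linear_combination (norm := skip) ((1 - b / a) * a) • (-hY)
  rw [hB]
  simp only [mul_add, mul_smul_comm, mul_one]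
  match_scalars <;> field_simp <;> ring

end Braid

/-! ### Uniqueness of the simple reflections. -/

namespace QField

open QPlane

/-- The conditions prescribe values only on constants and parameters; they determine all scalars
because these form the fraction field of the polynomial ring in the free parameters. -/
theorem isSimpleReflection_ext {k : Type u} [Field k] {q : (ParamField k)ˣ} {i : Fin 9}
    {φ ψ : RingAut (QField (ParamField k) q)}
    (hφ : IsSimpleReflection k (genericParams k) i φ)
    (hψ : IsSimpleReflection k (genericParams k) i ψ) : φ = ψ := by
  let ι : ParamField k →+* QField (ParamField k) q := toQField.comp (algebraMap _ _)
  have h : (φ.toRingHom.comp ι) = (ψ.toRingHom.comp ι) := by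
    suffices (φ.toRingHom.comp ι).comp (algebraMap (MvPolynomial (Fin 12) k) (ParamField k)) =
      (ψ.toRingHom.comp ι).comp (algebraMap (MvPolynomial (Fin 12) k) (ParamField k)) by
      ext z
      obtain ⟨a, b, -, rfl⟩ := IsFractionRing.div_surjective (A := MvPolynomial (Fin 12) k) z
      rw [map_div₀, map_div₀]
      exact congrArg₂ _ (DFunLike.congr_fun this a) (DFunLike.congr_fun this b)
    refine MvPolynomial.ringHom_ext (fun c => ?_) fun j => ?_
    · exact (hφ.map_const c).trans (hψ.map_const c).symm
    · change φ (scalar (paramVar k j : ParamField k)) = ψ (scalar (paramVar k j : ParamField k))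
      rw [← genericParams_free]
      refine Fin.cases ?_ (fun j => Fin.cases ?_ (fun j => ?_) j) j
      · exact hφ.map_h₁.trans hψ.map_h₁.symm
      · exact hφ.map_h₂.trans hψ.map_h₂.symm
      · exact (hφ.map_e _).trans (hψ.map_e _).symm
  exact ringAut_ext (fun c => DFunLike.congr_fun h c) (hφ.map_x.trans hψ.map_x.symm)
    (hφ.map_y.trans hψ.map_y.symm)

end QField

/-! ### The simple reflections on the skew field and their Coxeter relations. -/

section Reflections

open QPlane QField

variable {F : Type u} [Field F] {q : Fˣ} {p : Params F}

/-- Automorphisms of the coefficient field which act on the parameters as the simple reflections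
and satisfy the Coxeter relations. -/
structure ReflectionData (q : Fˣ) (p : Params F) where
  /-- The action of a node on the coefficients. -/
  aut : Fin 9 → RingAut F
  map_q : ∀ i, aut i (q : F) = q
  map_h₁ : ∀ i, aut i (p.h₁ : F) = (p.refl i).h₁
  map_h₂ : ∀ i, aut i (p.h₂ : F) = (p.refl i).h₂
  map_e : ∀ i j, aut i (p.e j : F) = (p.refl i).e j
  self : ∀ i z, aut i (aut i z) = z
  comm : ∀ {i j}, affineE8 i j = 2 → ∀ z, aut i (aut j z) = aut j (aut i z)
  braid : ∀ {i j}, affineE8 i j = 3 →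
    ∀ z, aut i (aut j (aut i z)) = aut j (aut i (aut j z))

namespace ReflectionData

variable (D : ReflectionData q p)

/-- The simple reflections on the skew field. -/
noncomputable def simpleReflection (i : Fin 9) : RingAut (QField F q) :=
  if i = 0 then
    twistX (D.aut i) (D.map_q i) (p.h₂ / p.e 9)
  else if i = 3 then
    twistY (D.aut i) (D.map_q i) (p.e 6 / p.h₁)
  else coeffAut (D.aut i) (D.map_q i)

theorem simpleReflection_scalar (i : Fin 9) (c : F) :
    D.simpleReflection i (scalar c) = scalar (D.aut i c) := by
  unfold simpleReflection
  split_ifs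
  · exact twistX_scalar _ _ _ _
  · exact twistY_scalar _ _ _ _
  · exact coeffAut_scalar _ _ _

theorem aut_zero_div : D.aut 0
    ((p.h₂ / p.e 9 : Fˣ) : F) = p.e 10 := by
  simp [D.map_h₂, D.map_e, Params.refl]

theorem aut_zero_e : D.aut 0 (p.e 10 : F) =
    (p.h₂ / p.e 9 : Fˣ) := by
  simp [D.map_e, Params.refl]

theorem aut_three_div : D.aut 3
    ((p.e 6 / p.h₁ : Fˣ) : F) = ((p.e 0)⁻¹ : Fˣ) := by
  simp [D.map_h₁, D.map_e, Params.refl]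
  field_simp

theorem aut_three_inv : D.aut 3
    (((p.e 0)⁻¹ : Fˣ) : F) =
      (p.e 6 / p.h₁ : Fˣ) := by
  simp [D.map_e, Params.refl]

theorem simpleReflection_x (i : Fin 9) :
    D.simpleReflection i (x _ q).toQField = reflX p i := by
  unfold simpleReflection reflX
  split_ifs with h0 h3
  · subst h0
    exact twistX_x _ _ _ _ D.aut_zero_div
  · exact twistY_x _ _ _
  · exact coeffAut_x _ _

theorem simpleReflection_y (i : Fin 9) :
    D.simpleReflection i (y _ q).toQField = reflY p i := by
  unfold simpleReflection reflY
  split_ifs with h0 h3 h3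
  · exact absurd (h0.symm.trans h3) (by decide)
  · exact twistX_y _ _ _
  · subst h3
    exact twistY_y _ _ _ _ D.aut_three_div
  · exact coeffAut_y _ _

theorem isSimpleReflection {k : Type u} [Field k] [Algebra k F]
    (hk : ∀ i (c : k), D.aut i (algebraMap k F c) = algebraMap k F c) (i : Fin 9) :
    IsSimpleReflection k p i (D.simpleReflection i) where
  map_const c := by rw [simpleReflection_scalar, hk]
  map_h₁ := by rw [simpleReflection_scalar, D.map_h₁]
  map_h₂ := by rw [simpleReflection_scalar, D.map_h₂]
  map_e j := by rw [simpleReflection_scalar, D.map_e]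
  map_x := D.simpleReflection_x i
  map_y := D.simpleReflection_y i

theorem simpleReflection_x_of_ne {i : Fin 9} (h : i ≠ 0) :
    D.simpleReflection i (x _ q).toQField = (x _ q).toQField := by
  rw [simpleReflection_x, reflX, if_neg h]

theorem simpleReflection_y_of_ne {i : Fin 9} (h : i ≠ 3) :
    D.simpleReflection i (y _ q).toQField = (y _ q).toQField := by
  rw [simpleReflection_y, reflY, if_neg h]

theorem simpleReflection_evalX {i : Fin 9} (h : i ≠ 0) (f : F[X]) :
    D.simpleReflection i (evalX f : QPlane _ q).toQField =
      (evalX (f.map (D.aut i : F →+* F)) : QPlane _ q).toQField :=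
  ringAut_evalX _ _ (D.simpleReflection_scalar i)
    (D.simpleReflection_x_of_ne h) f

theorem simpleReflection_evalY {i : Fin 9} (h : i ≠ 3) (f : F[X]) :
    D.simpleReflection i (evalY f : QPlane _ q).toQField =
      (evalY (f.map (D.aut i : F →+* F)) : QPlane _ q).toQField :=
  ringAut_evalY _ _ (D.simpleReflection_scalar i)
    (D.simpleReflection_y_of_ne h) f

theorem lin_map_of_eq {F K : Type*} [Field F] [Field K] {σ : F →+* K} {a : Fˣ} {b : Kˣ}
    (h : σ a = b) : (lin a).map σ = lin b := by
  simp [lin, h]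

theorem simpleReflection_linX {i : Fin 9} (h : i ≠ 0) {a b : Fˣ}
    (hab : D.aut i (a : F) = b) :
    D.simpleReflection i (evalX (lin a) : QPlane _ q).toQField =
      (evalX (lin b) : QPlane _ q).toQField := by
  rw [D.simpleReflection_evalX h, lin_map_of_eq (b := b) hab]

theorem simpleReflection_linY {i : Fin 9} (h : i ≠ 3) {a b : Fˣ}
    (hab : D.aut i (a : F) = b) :
    D.simpleReflection i (evalY (lin a) : QPlane _ q).toQField =
      (evalY (lin b) : QPlane _ q).toQField := by
  rw [D.simpleReflection_evalY h, lin_map_of_eq (b := b) hab]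

theorem coeffAut_mul_self {F : Type u} [Field F] {q : Fˣ} (σ : RingAut F) (hσ : σ q = q)
    (h : ∀ z, σ (σ z) = z) : coeffAut σ hσ * coeffAut σ hσ = 1 := by
  refine ringAut_ext (fun c => ?_) ?_ ?_
  · rw [RingAut.mul_apply, coeffAut_scalar, coeffAut_scalar, h]; rfl
  · rw [RingAut.mul_apply, coeffAut_x, coeffAut_x]; rfl
  · rw [RingAut.mul_apply, coeffAut_y, coeffAut_y]; rfl

theorem simpleReflection_mul_self (i : Fin 9) :
    D.simpleReflection i * D.simpleReflection i = 1 := by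
  have h := coeffAut_mul_self (D.aut i) (D.map_q i) ((D.self i))
  have conj : ∀ g s : RingAut (QField F q), s * s = 1 →
      (g * s * g⁻¹) * (g * s * g⁻¹) = 1 := fun g s hs => by
    rw [show g * s * g⁻¹ * (g * s * g⁻¹) = g * (s * s) * g⁻¹ by group, hs, mul_one,
      mul_inv_cancel]
  unfold simpleReflection
  split_ifs
  · exact conj _ _ h
  · exact conj _ _ h
  · exact h

theorem simpleReflection_reflX {i j : Fin 9} (hij : affineE8 i j = 2) (i0 : i ≠ 0) (i3 : i ≠ 3) :
    D.simpleReflection i (reflX (q := q) p j) =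
      reflX p j := by
  unfold reflX
  split_ifs with j0
  · subst j0
    have h9 : (p.refl i).h₂ = p.h₂ ∧
        (p.refl i).e 9 = p.e 9 ∧
        (p.refl i).e 10 = p.e 10 := by
      fin_cases i
      · exact absurd rfl i0
      · exact ⟨rfl, rfl, rfl⟩
      · exact ⟨rfl, rfl, rfl⟩
      · exact absurd rfl i3
      all_goals exact ⟨rfl, rfl, rfl⟩
    rw [map_mul, map_div₀, D.simpleReflection_x_of_ne i0,
      D.simpleReflection_linY i3 (b := p.h₂ / p.e 9),
      D.simpleReflection_linY i3 (b := p.e 10)]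
    · rw [D.map_e, h9.2.2]
    · simp only [Units.val_div_eq_div_val, map_div₀, D.map_h₂, D.map_e, h9.1, h9.2.1]
  · exact D.simpleReflection_x_of_ne i0

theorem simpleReflection_reflY {i j : Fin 9} (hij : affineE8 i j = 2) (i0 : i ≠ 0) (i3 : i ≠ 3) :
    D.simpleReflection i (reflY (q := q) p j) =
      reflY p j := by
  unfold reflY
  split_ifs with j0
  · subst j0
    have h9 : (p.refl i).h₁ = p.h₁ ∧
        (p.refl i).e 0 = p.e 0 ∧
        (p.refl i).e 6 = p.e 6 := by
      have : i = 1 ∨ i = 5 ∨ i = 6 ∨ i = 7 ∨ i = 8 := by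
        revert i; decide
      obtain rfl | rfl | rfl | rfl | rfl := this <;> exact ⟨rfl, rfl, rfl⟩
    rw [map_mul, map_div₀, D.simpleReflection_y_of_ne i3,
      D.simpleReflection_linX i0 (b := p.e 6 / p.h₁),
      D.simpleReflection_linX i0 (b := (p.e 0)⁻¹)]
    · simp only [Units.val_inv_eq_inv_val, map_inv₀, D.map_e, h9.2.1]
    · simp only [Units.val_div_eq_div_val, map_div₀, D.map_h₁, D.map_e, h9.1, h9.2.2]
  · exact D.simpleReflection_y_of_ne i3

theorem simpleReflection_comm {i j : Fin 9} (hij : affineE8 i j = 2) :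
    D.simpleReflection i * D.simpleReflection j = D.simpleReflection j * D.simpleReflection i := by
  have key : ∀ i j : Fin 9, affineE8 i j = 2 → i ≠ 0 → i ≠ 3 →
      D.simpleReflection i * D.simpleReflection j =
        D.simpleReflection j * D.simpleReflection i := by
    intro i j h i0 i3
    refine ringAut_ext (fun c => ?_) ?_ ?_
    · simp only [RingAut.mul_apply, simpleReflection_scalar, D.comm h]
    · rw [RingAut.mul_apply, RingAut.mul_apply, D.simpleReflection_x_of_ne i0,
        simpleReflection_x, D.simpleReflection_reflX h i0 i3]
    · rw [RingAut.mul_apply, RingAut.mul_apply, D.simpleReflection_y_of_ne i3,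
        simpleReflection_y, D.simpleReflection_reflY h i0 i3]
  have symm : ∀ {i j : Fin 9}, affineE8 i j = 2 → affineE8 j i = 2 := fun {i j} h => by
    rw [affineE8.symmetric]; exact h
  have n03 : ¬ affineE8 0 3 = 2 := by decide
  have n30 : ¬ affineE8 3 0 = 2 := by decide
  have n00 : ¬ affineE8 0 0 = 2 := by decide
  have n33 : ¬ affineE8 3 3 = 2 := by decide
  by_cases i0 : i = 0
  · subst i0
    exact (key j 0 (symm hij) (fun h => n00 (h ▸ hij)) fun h => n03 (h ▸ hij)).symm
  by_cases i3 : i = 3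
  · subst i3
    exact (key j 3 (symm hij) (fun h => n30 (h ▸ hij)) fun h => n33 (h ▸ hij)).symm
  exact key i j hij i0 i3

theorem toQField_evalX_comm {F : Type u} [Field F] {q : Fˣ} (f g : F[X]) :
    Commute (evalX f : QPlane F q).toQField (evalX g : QPlane F q).toQField := by
  rw [Commute, SemiconjBy, ← map_mul, ← map_mul, ← evalX_mul, ← evalX_mul, mul_comm]

theorem toQField_evalY_comm {F : Type u} [Field F] {q : Fˣ} (f g : F[X]) :
    Commute (evalY f : QPlane F q).toQField (evalY g : QPlane F q).toQField := by
  rw [Commute, SemiconjBy, ← map_mul, ← map_mul, ← evalY_mul, ← evalY_mul, mul_comm]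

theorem mul_mul_apply {K : Type*} [Mul K] [Add K] (φ ψ χ : RingAut K) (z : K) :
    (φ * ψ * χ) z = φ (ψ (χ z)) := rfl

theorem simpleReflection_braid_scalar {i j : Fin 9} (hij : affineE8 i j = 3) (c : F) :
    (D.simpleReflection i * D.simpleReflection j * D.simpleReflection i) (scalar c) =
      (D.simpleReflection j * D.simpleReflection i * D.simpleReflection j) (scalar c) := by
  simp only [RingAut.mul_apply, simpleReflection_scalar, D.braid hij]

theorem simpleReflection_braid_of_ne {i j : Fin 9} (hij : affineE8 i j = 3)
    (i0 : i ≠ 0) (i3 : i ≠ 3) (j0 : j ≠ 0) (j3 : j ≠ 3) :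
    D.simpleReflection i * D.simpleReflection j * D.simpleReflection i =
      D.simpleReflection j * D.simpleReflection i * D.simpleReflection j := by
  refine ringAut_ext (D.simpleReflection_braid_scalar hij) ?_ ?_
  · simp only [RingAut.mul_apply, D.simpleReflection_x_of_ne i0, D.simpleReflection_x_of_ne j0]
  · simp only [RingAut.mul_apply, D.simpleReflection_y_of_ne i3, D.simpleReflection_y_of_ne j3]

theorem reflY_three {F : Type u} [Field F] {q : Fˣ} (p : Params F) : reflY (q := q) p 3 =
    (evalX (lin (p.e 6 / p.h₁)) : QPlane F q).toQField /
      (evalX (lin (p.e 0)⁻¹) : QPlane F q).toQField * (y F q).toQField := if_pos rfl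

theorem reflX_zero {F : Type u} [Field F] {q : Fˣ} (p : Params F) : reflX (q := q) p 0 =
    (x F q).toQField * ((evalY (lin (p.h₂ / p.e 9)) : QPlane F q).toQField /
      (evalY (lin (p.e 10)) : QPlane F q).toQField) := if_pos rfl

theorem div_mul_div_mul_of_commute {K : Type*} [DivisionRing K] {f g h z : K} (hf : f ≠ 0)
    (hfh : Commute f h) (hfg : Commute f g) (hgh : Commute g h) :
    f / h * (g / f * z) = g / h * z := by
  have h2 : Commute h⁻¹ f := hfh.symm.inv_left₀
  rw [← mul_assoc, div_eq_mul_inv, div_eq_mul_inv, ← h2.eq, mul_assoc h⁻¹, ← mul_assoc f,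
    hfg.eq, mul_assoc g, mul_inv_cancel₀ hf, mul_one, div_eq_mul_inv, hgh.inv_right₀.eq]

/-- Both sides multiply y by (1 + (e₇/h₁)x)/(1 + x/e₂): on the longer side the factor 1 + x/e₁
cancels, all factors being polynomials in x and hence commuting. -/
theorem simpleReflection_braid_three_four :
    D.simpleReflection 3 * D.simpleReflection 4 * D.simpleReflection 3 =
      D.simpleReflection 4 * D.simpleReflection 3 * D.simpleReflection 4 := by
  have n3 : (3 : Fin 9) ≠ 0 := by decide
  have n4 : (4 : Fin 9) ≠ 0 := by decide
  have m4 : (4 : Fin 9) ≠ 3 := by decide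
  have h : affineE8 3 4 = 3 := by decide
  refine ringAut_ext (D.simpleReflection_braid_scalar h) ?_ ?_
  · rw [mul_mul_apply, mul_mul_apply, D.simpleReflection_x_of_ne n3,
      D.simpleReflection_x_of_ne n4, D.simpleReflection_x_of_ne n3,
      D.simpleReflection_x_of_ne n4]
  · have hc4 : D.aut 4 ((p.e 6 / p.h₁ : Fˣ) : F) = (p.e 6 / p.h₁ : Fˣ) := by
      simp only [Units.val_div_eq_div_val, map_div₀, D.map_e, D.map_h₁]; rfl
    have hd4 : D.aut 4 (((p.e 0)⁻¹ : Fˣ) : F) = ((p.e 1)⁻¹ : Fˣ) := by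
      simp only [Units.val_inv_eq_inv_val, map_inv₀, D.map_e]; rfl
    have hd3 : D.aut 3 (((p.e 1)⁻¹ : Fˣ) : F) = ((p.e 1)⁻¹ : Fˣ) := by
      simp only [Units.val_inv_eq_inv_val, map_inv₀, D.map_e]; rfl
    rw [mul_mul_apply, mul_mul_apply, D.simpleReflection_y_of_ne m4, simpleReflection_y, reflY_three, map_mul, map_div₀,
      D.simpleReflection_y_of_ne m4, D.simpleReflection_linX n4 hc4,
      D.simpleReflection_linX n4 hd4, map_mul, map_div₀, simpleReflection_y, reflY_three,
      D.simpleReflection_linX n3 D.aut_three_div, D.simpleReflection_linX n3 hd3]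
    exact div_mul_div_mul_of_commute (evalX_lin_ne_zero _) (toQField_evalX_comm _ _)
      (toQField_evalX_comm _ _) (toQField_evalX_comm _ _)

theorem simpleReflection_braid_three_two :
    D.simpleReflection 3 * D.simpleReflection 2 * D.simpleReflection 3 =
      D.simpleReflection 2 * D.simpleReflection 3 * D.simpleReflection 2 := by
  have n3 : (3 : Fin 9) ≠ 0 := by decide
  have n2 : (2 : Fin 9) ≠ 0 := by decide
  have m2 : (2 : Fin 9) ≠ 3 := by decide
  have h : affineE8 3 2 = 3 := by decide
  refine ringAut_ext (D.simpleReflection_braid_scalar h) ?_ ?_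
  · rw [mul_mul_apply, mul_mul_apply, D.simpleReflection_x_of_ne n3,
      D.simpleReflection_x_of_ne n2, D.simpleReflection_x_of_ne n3,
      D.simpleReflection_x_of_ne n2]
  · have hc2 : D.aut 2 ((p.e 6 / p.h₁ : Fˣ) : F) = (p.e 7 / p.h₁ : Fˣ) := by
      simp only [Units.val_div_eq_div_val, map_div₀, D.map_e, D.map_h₁]; rfl
    have hd2 : D.aut 2 (((p.e 0)⁻¹ : Fˣ) : F) = ((p.e 0)⁻¹ : Fˣ) := by
      simp only [Units.val_inv_eq_inv_val, map_inv₀, D.map_e]; rfl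
    have hc3 : D.aut 3 ((p.e 7 / p.h₁ : Fˣ) : F) = (p.e 7 / p.h₁ : Fˣ) := by
      simp only [Units.val_div_eq_div_val, map_div₀, D.map_e, D.map_h₁]; rfl
    have hd3 : D.aut 3 (((p.e 0)⁻¹ : Fˣ) : F) = (p.e 6 / p.h₁ : Fˣ) := by
      rw [Units.val_inv_eq_inv_val, map_inv₀, D.map_e]
      simp [Params.refl]
    rw [mul_mul_apply, mul_mul_apply, D.simpleReflection_y_of_ne m2, simpleReflection_y, reflY_three, map_mul, map_div₀,
      D.simpleReflection_y_of_ne m2, D.simpleReflection_linX n2 hc2,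
      D.simpleReflection_linX n2 hd2, map_mul, map_div₀, simpleReflection_y, reflY_three,
      D.simpleReflection_linX n3 hc3, D.simpleReflection_linX n3 hd3, ← mul_assoc,
      div_mul_div_cancel₀ (evalX_lin_ne_zero _)]

theorem scalar_eq_algebraMap (c : F) : (scalar c : QField F q) = algebraMap F (QField F q) c := rfl

theorem simpleReflection_smul (i : Fin 9) (c : F) (z : QField F q) :
    D.simpleReflection i (c • z) = D.aut i c • D.simpleReflection i z := by
  rw [Algebra.smul_def, map_mul, ← scalar_eq_algebraMap, simpleReflection_scalar,
    scalar_eq_algebraMap, ← Algebra.smul_def]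

theorem toQField_smul (c : F) (P : QPlane F q) : (c • P).toQField = c • P.toQField := by
  rw [Algebra.smul_def, map_mul, Algebra.smul_def]; rfl

theorem toQField_evalX_lin (c : Fˣ) :
    (evalX (lin c) : QPlane F q).toQField = 1 + (c : F) • (x F q).toQField := by
  rw [evalX_lin, map_add, map_one, toQField_smul]

theorem toQField_evalY_lin (c : Fˣ) :
    (evalY (lin c) : QPlane F q).toQField = 1 + (c : F) • (y F q).toQField := by
  rw [evalY_lin, map_add, map_one, toQField_smul]

theorem simpleReflection_braid_zero_three :
    D.simpleReflection 0 * D.simpleReflection 3 * D.simpleReflection 0 =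
      D.simpleReflection 3 * D.simpleReflection 0 * D.simpleReflection 3 := by
  have n3 : (3 : Fin 9) ≠ 0 := by decide
  have m0 : (0 : Fin 9) ≠ 3 := by decide
  have h : affineE8 0 3 = 3 := by decide
  -- The four slopes: s₀ exchanges a and b, s₃ exchanges c and d, while s₃ multiplies b by d/c and
  -- s₀ multiplies c by a/b.
  obtain ⟨a, ha⟩ : ∃ a : F, a = p.e 10 := ⟨_, rfl⟩
  obtain ⟨b, hb⟩ : ∃ b : F, b = (p.h₂ / p.e 9 : Fˣ) := ⟨_, rfl⟩
  obtain ⟨c, hc⟩ : ∃ c : F, c = (p.e 6 / p.h₁ : Fˣ) := ⟨_, rfl⟩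
  obtain ⟨d, hd⟩ : ∃ d : F, d = ((p.e 0)⁻¹ : Fˣ) := ⟨_, rfl⟩
  have a0 : a ≠ 0 := ha ▸ Units.ne_zero _
  have b0 : b ≠ 0 := hb ▸ Units.ne_zero _
  have c0 : c ≠ 0 := hc ▸ Units.ne_zero _
  have d0 : d ≠ 0 := hd ▸ Units.ne_zero _
  have a3 : D.aut 3 a = a := ha ▸ D.map_e 3 10
  have b3 : D.aut 3 b = b * d / c := by
    simp only [hb, hc, hd, Units.val_div_eq_div_val, map_div₀, D.map_h₂, D.map_e]
    simp [Params.refl]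
    field_simp
  have c3 : D.aut 3 c = d := by rw [hc, hd]; exact D.aut_three_div
  have d3 : D.aut 3 d = c := by rw [hc, hd]; exact D.aut_three_inv
  have a1 : D.aut 0 a = b := by rw [ha, hb]; exact D.aut_zero_e
  have b1 : D.aut 0 b = a := by rw [ha, hb]; exact D.aut_zero_div
  have c1 : D.aut 0 c = c * a / b := by
    simp only [ha, hb, hc, Units.val_div_eq_div_val, map_div₀, D.map_h₁, D.map_e]
    simp [Params.refl]
    field_simp
  have d1 : D.aut 0 d = d := by
    rw [hd, Units.val_inv_eq_inv_val, map_inv₀, D.map_e]; rfl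
  obtain ⟨ξ, hξ⟩ : ∃ ξ, ξ = (x F q).toQField := ⟨_, rfl⟩
  obtain ⟨η, hη⟩ : ∃ η, η = (y F q).toQField := ⟨_, rfl⟩
  obtain ⟨X, hX⟩ : ∃ X, X = D.simpleReflection 0 ξ := ⟨_, rfl⟩
  obtain ⟨Y, hY⟩ : ∃ Y, Y = D.simpleReflection 3 η := ⟨_, rfl⟩
  have sx : D.simpleReflection 3 ξ = ξ := hξ ▸ D.simpleReflection_x_of_ne n3
  have sy : D.simpleReflection 0 η = η := hη ▸ D.simpleReflection_y_of_ne m0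
  have ξ0 : ξ ≠ 0 := hξ ▸ toQField_ne_zero fun h => by
    simpa [x, coeff_term, QPlane.coeff_zero] using congrArg (fun P => coeff P 1 0) h
  have η0 : η ≠ 0 := hη ▸ toQField_ne_zero fun h => by
    simpa [y, coeff_term, QPlane.coeff_zero] using congrArg (fun P => coeff P 0 1) h
  have X0 : X ≠ 0 := hX ▸ (map_ne_zero_iff _ (D.simpleReflection 0).injective).2 ξ0
  have Y0 : Y ≠ 0 := hY ▸ (map_ne_zero_iff _ (D.simpleReflection 3).injective).2 η0
  have lx : ∀ r : F, r ≠ 0 → 1 + r • ξ ≠ 0 := fun r hr => by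
    have := evalX_lin_ne_zero (q := q) (Units.mk0 r hr)
    rwa [toQField_evalX_lin, ← hξ] at this
  have ly : ∀ r : F, r ≠ 0 → 1 + r • η ≠ 0 := fun r hr => by
    have := evalY_lin_ne_zero (q := q) (Units.mk0 r hr)
    rwa [toQField_evalY_lin, ← hη] at this
  have map_lin : ∀ (i : Fin 9) (r : F) (z : QField F q), D.simpleReflection i (1 + r • z) =
      1 + D.aut i r • D.simpleReflection i z := fun i r z => by
    rw [map_add, map_one, simpleReflection_smul]
  -- If 1 + r s_i(z) vanished, applying the involution s_i would make 1 + s_i(r) z vanish. This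
  -- provides all the denominators from those in x and y alone.
  have ne_map : ∀ (i : Fin 9) (r : F) (z : QField F q), 1 + D.aut i r • z ≠ 0 →
      1 + r • D.simpleReflection i z ≠ 0 := fun i r z hz h0 => hz (by
    have := congrArg (D.simpleReflection i) h0
    rw [map_lin, map_zero] at this
    have e := DFunLike.congr_fun (D.simpleReflection_mul_self i) z
    rw [RingAut.mul_apply] at e
    rwa [e] at this)
  have nz : ∀ (i : Fin 9) (r : F), r ≠ 0 → D.aut i r ≠ 0 := fun i r hr =>
    (map_ne_zero_iff _ (D.aut i).injective).2 hr
  have lX : ∀ r : F, r ≠ 0 → 1 + r • X ≠ 0 := fun r hr =>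
    hX ▸ ne_map 0 r ξ (lx _ (nz 0 r hr))
  have lY : ∀ r : F, r ≠ 0 → 1 + r • Y ≠ 0 := fun r hr =>
    hY ▸ ne_map 3 r η (ly _ (nz 3 r hr))
  have lX' : ∀ r : F, r ≠ 0 → 1 + r • D.simpleReflection 3 X ≠ 0 := fun r hr =>
    ne_map 3 r X (lX _ (nz 3 r hr))
  have lY' : ∀ r : F, r ≠ 0 → 1 + r • D.simpleReflection 0 Y ≠ 0 := fun r hr =>
    ne_map 0 r Y (lY _ (nz 0 r hr))
  have fX : X = ξ * ((1 + b • η) * (1 + a • η)⁻¹) := by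
    rw [hX, hξ, simpleReflection_x, reflX_zero, toQField_evalY_lin, toQField_evalY_lin,
      div_eq_mul_inv, ha, hb, hη]
  have fY : Y = (1 + c • ξ) * (1 + d • ξ)⁻¹ * η := by
    rw [hY, hη, simpleReflection_y, reflY_three, toQField_evalX_lin, toQField_evalX_lin,
      div_eq_mul_inv, hc, hd, hξ]
  have comm : ∀ (r s : F) (z : QField F q), Commute (1 + r • z) (1 + s • z) := fun r s z =>
    (Commute.one_left _).add_left (((Commute.one_right z).add_right
      ((Commute.refl z).smul_right s)).smul_left r)
  have relX : X * (1 + a • η) = ξ * (1 + b • η) := by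
    rw [fX, mul_assoc, inv_mul_cancel_right₀ (ly a a0)]
  have relY : (1 + d • ξ) * Y = (1 + c • ξ) * η := by
    rw [fY, (comm c d ξ).inv_right₀.eq, mul_assoc, mul_inv_cancel_left₀ (lx d d0)]
  have fX3 : D.simpleReflection 3 X = ξ * ((1 + (b * d / c) • Y) * (1 + a • Y)⁻¹) := by
    rw [fX, map_mul, map_mul, map_inv₀, map_lin, map_lin, sx, b3, a3, ← hY]
  have fY0 : D.simpleReflection 0 Y = (1 + (c * a / b) • X) * (1 + d • X)⁻¹ * η := by
    rw [fY, map_mul, map_mul, map_inv₀, map_lin, map_lin, sy, c1, d1, ← hX]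
  have relX3 : D.simpleReflection 3 X * (1 + a • Y) = ξ * (1 + (b * d / c) • Y) := by
    rw [fX3, mul_assoc, inv_mul_cancel_right₀ (lY a a0)]
  have relY0 : (1 + d • X) * D.simpleReflection 0 Y = (1 + (c * a / b) • X) * η := by
    rw [fY0, (comm _ d X).inv_right₀.eq, mul_assoc, mul_inv_cancel_left₀ (lX d d0)]
  have β0 : b * d / c ≠ 0 := div_ne_zero (mul_ne_zero b0 d0) c0
  have κ0 : c * a / b ≠ 0 := div_ne_zero (mul_ne_zero c0 a0) b0
  refine ringAut_ext (D.simpleReflection_braid_scalar h) ?_ ?_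
  · rw [mul_mul_apply, mul_mul_apply, ← hξ, sx, ← hX, fX3, map_mul, map_mul, map_inv₀, map_lin, map_lin, ← hX, a1]
    have : D.aut 0 (b * d / c) = b * d / c := by
      rw [map_div₀, map_mul, b1, c1, d1]
      field_simp
    rw [this]
    exact (braid_identity_x b0 c0 d0 ξ0 X0 (ly b b0) (lx d d0) (lY _ β0) (lX d d0)
      (lY' _ β0) relX relY relY0).symm
  · rw [mul_mul_apply, mul_mul_apply, ← hη, sy, ← hY, fY0, map_mul, map_mul, map_inv₀, map_lin, map_lin, ← hY, d3]
    have : D.aut 3 (c * a / b) = c * a / b := by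
      rw [map_div₀, map_mul, b3, c3, a3]
      field_simp
    rw [this]
    exact braid_identity_y a0 b0 c0 η0 Y0 (ly a a0) (lx c c0) (lX _ κ0) (lY a a0)
      (lX' _ κ0) relX relY relX3

theorem simpleReflection_braid {i j : Fin 9} (hij : affineE8 i j = 3) :
    D.simpleReflection i * D.simpleReflection j * D.simpleReflection i =
      D.simpleReflection j * D.simpleReflection i * D.simpleReflection j := by
  have nb0 : ∀ i : Fin 9, affineE8 i 0 = 3 → i = 3 := by decide
  have nb3 : ∀ i : Fin 9, affineE8 i 3 = 3 → i = 0 ∨ i = 2 ∨ i = 4 := by decide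
  have symm : affineE8 j i = 3 := by rw [affineE8.symmetric]; exact hij
  by_cases i0 : i = 0
  · subst i0
    obtain rfl := nb0 j symm
    exact D.simpleReflection_braid_zero_three
  by_cases j0 : j = 0
  · subst j0
    obtain rfl := nb0 i hij
    exact D.simpleReflection_braid_zero_three.symm
  by_cases i3 : i = 3
  · subst i3
    obtain rfl | rfl | rfl := nb3 j symm
    exacts [absurd rfl j0, D.simpleReflection_braid_three_two, D.simpleReflection_braid_three_four]
  by_cases j3 : j = 3
  · subst j3
    obtain rfl | rfl | rfl := nb3 i hij
    exacts [absurd rfl i0, D.simpleReflection_braid_three_two.symm,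
      D.simpleReflection_braid_three_four.symm]
  exact D.simpleReflection_braid_of_ne hij i0 i3 j0 j3

theorem isLiftable : affineE8.IsLiftable D.simpleReflection := by
  intro i j
  have hM : ∀ i j : Fin 9, affineE8 i j = 1 ∧ i = j ∨ affineE8 i j = 2 ∨ affineE8 i j = 3 := by
    intro i; fin_cases i <;> decide
  have inv : ∀ (i : Fin 9) (z : RingAut (QField F q)),
      D.simpleReflection i * (D.simpleReflection i * z) = z := fun i z => by
    rw [← mul_assoc, simpleReflection_mul_self, one_mul]
  obtain ⟨h, rfl⟩ | h | h := hM i j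
  · rw [h, pow_one, simpleReflection_mul_self]
  · rw [h, pow_two, mul_assoc, ← mul_assoc (D.simpleReflection j), ← D.simpleReflection_comm h,
      mul_assoc, inv, simpleReflection_mul_self]
  · have hb := D.simpleReflection_braid h
    rw [h, pow_succ, pow_two]
    calc _ = (D.simpleReflection i * D.simpleReflection j * D.simpleReflection i) *
          (D.simpleReflection j * D.simpleReflection i * D.simpleReflection j) := by
          simp only [mul_assoc]
      _ = 1 := by
          rw [hb]
          simp only [mul_assoc, inv, simpleReflection_mul_self]

/-- The action of the affine Weyl group on the skew field. -/
noncomputable def action : affineE8.Group →* RingAut (QField F q) :=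
  affineE8.toCoxeterSystem.lift ⟨D.simpleReflection, D.isLiftable⟩

theorem action_simple (i : Fin 9) : D.action (affineE8.simple i) = D.simpleReflection i :=
  affineE8.toCoxeterSystem.lift_apply_simple D.isLiftable i

end ReflectionData

end Reflections

/-- The reflections of the field of parameters. -/
noncomputable def genericReflectionData {k : Type u} [Field k] (q : kˣ) :
    ReflectionData (qParam q) (genericParams k) where
  aut := reflAut
  map_q i := reflAut_q i q
  map_h₁ := reflAut_h₁
  map_h₂ := reflAut_h₂
  map_e := reflAut_e
  self := reflAut_reflAut
  comm := reflAut_comm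
  braid := reflAut_braid

/-! ### Linearity of the conditions and their form for the data at hand. -/

section Solutions

open QPlane

variable {F : Type u} [Field F] {q : Fˣ}

theorem DegLE.add {f g : F[X]} {n : ℤ} (hf : DegLE f n) (hg : DegLE g n) : DegLE (f + g) n :=
  fun j hj => by
    by_cases h : f.coeff j = 0
    · exact hg j fun h' => hj (by rw [Polynomial.coeff_add, h, h', add_zero])
    · exact hf j h

theorem DegLE.smul {f : F[X]} {n : ℤ} (c : F) (hf : DegLE f n) : DegLE (c • f) n :=
  fun j hj => hf j fun h => hj (by rw [Polynomial.coeff_smul, h, smul_zero])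

theorem DegLE.coeff_eq_zero {f : F[X]} {n : ℤ} (hf : DegLE f n) {j : ℕ} (hj : n < j) :
    f.coeff j = 0 := by
  by_contra h
  exact absurd (hf j h) (not_le.2 hj)

theorem evalX_add (f g : F[X]) : (evalX (f + g) : QPlane F q) = evalX f + evalX g :=
  map_add (aeval (x F q)) f g

theorem evalY_add (f g : F[X]) : (evalY (f + g) : QPlane F q) = evalY f + evalY g :=
  map_add (aeval (y F q)) f g

theorem evalX_smul (c : F) (f : F[X]) : (evalX (c • f) : QPlane F q) = c • evalX f :=
  map_smul (aeval (x F q)) c f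

theorem evalY_smul (c : F) (f : F[X]) : (evalY (c • f) : QPlane F q) = c • evalY f :=
  map_smul (aeval (y F q)) c f

theorem CondX.add {μ : DegMult} {p : Params F} {P Q : QPlane F q} (hP : CondX μ p P)
    (hQ : CondX μ p Q) : CondX μ p (P + Q) := by
  obtain ⟨U, hU, rfl⟩ := hP
  obtain ⟨V, hV, rfl⟩ := hQ
  refine ⟨fun i => U i + V i, fun i hi => (hU i hi).add (hV i hi), ?_⟩
  simp only [mul_add, evalY_add, Finset.sum_add_distrib]

theorem CondX.smul {μ : DegMult} {p : Params F} {P : QPlane F q} (c : F) (hP : CondX μ p P) :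
    CondX μ p (c • P) := by
  obtain ⟨U, hU, rfl⟩ := hP
  refine ⟨fun i => c • U i, fun i hi => (hU i hi).smul c, ?_⟩
  simp only [mul_smul_comm, evalY_smul, Finset.smul_sum]

theorem CondY.add {μ : DegMult} {p : Params F} {P Q : QPlane F q} (hP : CondY μ p P)
    (hQ : CondY μ p Q) : CondY μ p (P + Q) := by
  obtain ⟨U, hU, rfl⟩ := hP
  obtain ⟨V, hV, rfl⟩ := hQ
  refine ⟨fun i => U i + V i, fun i hi => (hU i hi).add (hV i hi), ?_⟩
  simp only [mul_add, add_mul, evalX_add, Finset.sum_add_distrib]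

theorem CondY.smul {μ : DegMult} {p : Params F} {P : QPlane F q} (c : F) (hP : CondY μ p P) :
    CondY μ p (c • P) := by
  obtain ⟨U, hU, rfl⟩ := hP
  refine ⟨fun i => c • U i, fun i hi => (hU i hi).smul c, ?_⟩
  simp only [mul_smul_comm, smul_mul_assoc, evalX_smul, Finset.smul_sum]

theorem IsSolution.add {μ : DegMult} {p : Params F} {P Q : QPlane F q} (hP : IsSolution μ p P)
    (hQ : IsSolution μ p Q) : IsSolution μ p (P + Q) := ⟨hP.1.add hQ.1, hP.2.add hQ.2⟩

theorem IsSolution.smul {μ : DegMult} {p : Params F} {P : QPlane F q} (c : F)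
    (hP : IsSolution μ p P) : IsSolution μ p (c • P) := ⟨hP.1.smul c, hP.2.smul c⟩

theorem prod_Icc_int {M : Type*} [CommMonoid M] (m n : ℕ) (f : ℤ → M) :
    ∏ t ∈ Finset.Icc (m : ℤ) ((n : ℤ) - 1), f t = ∏ t ∈ Finset.Ico m n, f (t : ℤ) := by
  refine Finset.prod_nbij' Int.toNat Nat.cast ?_ ?_ ?_ ?_ ?_
  all_goals simp only [Finset.mem_Icc, Finset.mem_Ico]
  · intro t ht; omega
  · intro t ht; omega
  · intro t ht; omega
  · intro t ht; omega
  · intro t ht; rw [Int.toNat_of_nonneg (by omega)]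

/-- The factor of the coefficient of `xⁱ` prescribed by `(x)`. -/
noncomputable def colFactor (q a b : Fˣ) (i : ℕ) : F[X] :=
  -- The first 3 is m₁₁, the second is d₁ - m₁₀; at most one of the two products is nonempty.
  (∏ t ∈ Finset.Ico i 3, lin (q ^ t * a)) * ∏ t ∈ Finset.Ico 3 i, lin (q ^ t * b)

/-- The factor of the coefficient of `yʲ` prescribed by `(y)`. -/
noncomputable def rowFactor (q : Fˣ) (p : Params F) (j : ℕ) : F[X] :=
  -- As m_k = 1 for k ≤ 6, only t = -1 occurs, and only for j = 0. In the second product j - d₂ +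
  -- m_k = j - 1, and truncated subtraction gives the empty product at j = 0.
  (∏ k ∈ ({0, 1, 2, 3, 4, 5} : Finset (Fin 11)), ∏ _t ∈ Finset.Ico j 1, lin (q⁻¹ * (p.e k)⁻¹)) *
    ∏ k ∈ ({6, 7, 8} : Finset (Fin 11)), ∏ t ∈ Finset.range (j - 1), lin (q ^ t * (p.e k / p.h₁))

/-- The degree bound for the coefficient of `xⁱ`. -/
def colDegree (i : ℕ) : ℤ := 3 - max ((i : ℤ) - 3) 0 - max (3 - (i : ℤ)) 0

/-- The degree bound for the coefficient of `yʲ`. -/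
def rowDegree (j : ℕ) : ℤ := 6 - 6 * max (1 - (j : ℤ)) 0 - 3 * max ((j : ℤ) - 1) 0

theorem condX_iff (p : Params F) (P : QPlane F q) : CondX e8Data p P ↔
    ∃ U : ℕ → F[X], (∀ i ≤ 6, DegLE (U i) (colDegree i)) ∧
      P = ∑ i ∈ Finset.range 7,
        x F q ^ i * evalY (colFactor q (p.e 10) (p.h₂ / p.e 9) i * U i) := by
  have hdeg : ∀ i : ℕ, ((e8Data.d₂ : ℕ) : ℤ) - max ((i : ℤ) - (e8Data.d₁ : ℕ) + e8Data.m 9) 0 -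
      max (e8Data.m 10 - i) 0 = colDegree i := fun i => by
    change (3 : ℤ) - max ((i : ℤ) - 6 + 3) 0 - max (3 - (i : ℤ)) 0 = _
    rw [colDegree]; congr 3; ring
  have hfac : ∀ i : ℕ,
      (∏ t ∈ Finset.Icc (i : ℤ) (e8Data.m 10 - 1), lin (q ^ t * p.e 10)) *
        (∏ t ∈ Finset.Icc (((e8Data.d₁ : ℕ) : ℤ) - e8Data.m 9) ((i : ℤ) - 1),
          lin (q ^ t * (p.h₂ / p.e 9))) = colFactor q (p.e 10) (p.h₂ / p.e 9) i := fun i => by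
    change (∏ t ∈ Finset.Icc (i : ℤ) (((3 : ℕ) : ℤ) - 1), lin (q ^ t * p.e 10)) *
        (∏ t ∈ Finset.Icc ((3 : ℕ) : ℤ) ((i : ℤ) - 1), lin (q ^ t * (p.h₂ / p.e 9))) = _
    rw [prod_Icc_int, prod_Icc_int, colFactor]
    simp only [zpow_natCast]
  unfold CondX
  simp only [hdeg, hfac]
  rfl

theorem condY_iff (p : Params F) (P : QPlane F q) : CondY e8Data p P ↔
    ∃ V : ℕ → F[X], (∀ j ≤ 3, DegLE (V j) (rowDegree j)) ∧
      P = ∑ j ∈ Finset.range 4, evalX (rowFactor q p j * V j) * y F q ^ j := by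
  have m1 : ∀ k ∈ ({0, 1, 2, 3, 4, 5} : Finset (Fin 11)), e8Data.m k = 1 := by decide
  have m2 : ∀ k ∈ ({6, 7, 8} : Finset (Fin 11)), e8Data.m k = 2 := by decide
  have hdeg : ∀ j : ℕ, ((e8Data.d₁ : ℕ) : ℤ) -
      ∑ k ∈ ({0, 1, 2, 3, 4, 5} : Finset (Fin 11)), max (e8Data.m k - j) 0 -
      ∑ k ∈ ({6, 7, 8} : Finset (Fin 11)), max ((j : ℤ) - (e8Data.d₂ : ℕ) + e8Data.m k) 0 =
        rowDegree j := fun j => by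
    rw [Finset.sum_congr rfl fun k hk => by rw [m1 k hk],
      Finset.sum_congr (s₁ := {6, 7, 8}) rfl fun k hk => by rw [m2 k hk], Finset.sum_const,
      Finset.sum_const, rowDegree]
    change (6 : ℤ) - 6 • max (1 - (j : ℤ)) 0 - 3 • max ((j : ℤ) - 3 + 2) 0 = _
    rw [nsmul_eq_mul, nsmul_eq_mul, show (j : ℤ) - 3 + 2 = j - 1 by ring]
    rfl
  have hfac : ∀ j : ℕ,
      (∏ k ∈ ({0, 1, 2, 3, 4, 5} : Finset (Fin 11)),
        ∏ t ∈ Finset.Icc ((j : ℤ) - e8Data.m k) (-1), lin (q ^ t * (p.e k)⁻¹)) *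
      (∏ k ∈ ({6, 7, 8} : Finset (Fin 11)),
        ∏ t ∈ Finset.Icc (0 : ℤ) ((j : ℤ) - (e8Data.d₂ : ℕ) + e8Data.m k - 1),
          lin (q ^ t * (p.e k / p.h₁))) = rowFactor q p j := fun j => by
    rw [rowFactor]
    congr 1
    · refine Finset.prod_congr rfl fun k hk => ?_
      rw [m1 k hk]
      rcases j with _ | j
      · simp
      · rw [Finset.Icc_eq_empty (by push_cast; omega), Finset.Ico_eq_empty (by omega)]
        rfl
    · refine Finset.prod_congr rfl fun k hk => ?_
      rw [m2 k hk]
      change ∏ t ∈ Finset.Icc (0 : ℤ) ((j : ℤ) - 3 + 2 - 1), lin (q ^ t * (p.e k / p.h₁)) = _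
      rcases j with _ | j
      · rfl
      · rw [show ((j + 1 : ℕ) : ℤ) - 3 + 2 - 1 = (j : ℤ) - 1 by push_cast; ring,
          show (0 : ℤ) = ((0 : ℕ) : ℤ) from rfl, prod_Icc_int, Nat.Ico_zero_eq_range]
        simp only [zpow_natCast, Nat.add_sub_cancel]
  unfold CondY
  simp only [hdeg, hfac]
  rfl

end Solutions

/-! ### Expansion of the prescribed factors, and uniqueness of the solution. -/

section ExplicitSolution

open QPlane

variable {F : Type u} [Field F]

/-- The polynomial with the given list of coefficients. -/
noncomputable def ofList (l : List F) : F[X] :=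
  ∑ i ∈ Finset.range l.length, C (l.getD i 0) * X ^ i

theorem coeff_ofList (l : List F) (j : ℕ) : (ofList l).coeff j = l.getD j 0 := by
  simp only [ofList, finsetSum_coeff, coeff_C_mul, coeff_X_pow, mul_ite, mul_one, mul_zero,
    Finset.sum_ite_eq, Finset.mem_range]
  split_ifs with h
  · rfl
  · rw [List.getD_eq_default _ _ (not_lt.1 h)]

theorem eq_ofList {f : F[X]} (l : List F) (h : ∀ j < l.length, f.coeff j = l.getD j 0)
    (h' : ∀ j, l.length ≤ j → f.coeff j = 0) : f = ofList l := by
  ext j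
  rw [coeff_ofList]
  rcases lt_or_ge j l.length with hj | hj
  · exact h j hj
  · rw [h' j hj, List.getD_eq_default _ _ hj]

theorem DegLE.ofList {l : List F} {n : ℤ} (h : (l.length : ℤ) ≤ n + 1) : DegLE (ofList l) n := by
  intro j hj
  by_contra hn
  rw [coeff_ofList, List.getD_eq_default _ _ (by omega)] at hj
  exact hj rfl

theorem DegLE.eq_ofList {f : F[X]} {n : ℤ} (hf : DegLE f n) (l : List F) (hl : n < l.length)
    (h : ∀ j < l.length, f.coeff j = l.getD j 0) : f = _root_.ofList l :=
  _root_.eq_ofList l h fun j hj => hf.coeff_eq_zero (by omega)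

section LinProd

variable {ι : Type*} (s : Finset ι) (z : ι → Fˣ)

theorem lin_coeff_zero (a : Fˣ) : (lin a).coeff 0 = 1 := by simp [lin]

theorem natDegree_lin_le (a : Fˣ) : (lin a).natDegree ≤ 1 := by
  unfold lin; compute_degree

theorem prod_lin_coeff_zero : (∏ k ∈ s, lin (z k)).coeff 0 = 1 := by
  rw [coeff_zero_prod]
  exact Finset.prod_eq_one fun k _ => lin_coeff_zero _

theorem prod_lin_coeff_of_lt {j : ℕ} (hj : s.card < j) : (∏ k ∈ s, lin (z k)).coeff j = 0 := by
  refine coeff_eq_zero_of_natDegree_lt (lt_of_le_of_lt ?_ hj)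
  refine (natDegree_prod_le _ _).trans ?_
  simpa using Finset.sum_le_sum fun k (_ : k ∈ s) => natDegree_lin_le (z k)

theorem prod_lin_coeff_card : (∏ k ∈ s, lin (z k)).coeff s.card = ∏ k ∈ s, (z k : F) := by
  have := coeff_prod_of_natDegree_le (s := s) (fun k => lin (z k)) 1
    (fun k _ => natDegree_lin_le (z k))
  simpa [lin, coeff_one] using this

/-- Scaling all slopes by c is the substitution X ↦ cX. -/
theorem prod_lin_scale_coeff (c : Fˣ) (j : ℕ) :
    (∏ k ∈ s, lin (c * z k)).coeff j = (c : F) ^ j * (∏ k ∈ s, lin (z k)).coeff j := by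
  have : ∏ k ∈ s, lin (c * z k) = (∏ k ∈ s, lin (z k)).comp (C (c : F) * X) := by
    rw [prod_comp]
    refine Finset.prod_congr rfl fun k _ => ?_
    simp only [lin, add_comp, one_comp, mul_comp, C_comp, X_comp, Units.val_mul, C_mul]
    ring
  rw [this, comp_C_mul_X_coeff, mul_comm]

end LinProd

/-- `∏_{k=1}^{6} (1 + x / e_k)`. -/
noncomputable def polyE (p : Params F) : F[X] :=
  ∏ k ∈ ({0, 1, 2, 3, 4, 5} : Finset (Fin 11)), lin (p.e k)⁻¹

/-- `∏_{k=7}^{9} (1 + e_k x / h₁)`. -/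
noncomputable def polyA (p : Params F) : F[X] :=
  ∏ k ∈ ({6, 7, 8} : Finset (Fin 11)), lin (p.e k / p.h₁)

theorem polyE_eq (p : Params F) : polyE p = ofList [1, (polyE p).coeff 1, (polyE p).coeff 2,
    (polyE p).coeff 3, (polyE p).coeff 4, (polyE p).coeff 5, (polyE p).coeff 6] := by
  refine eq_ofList _ (fun j hj => ?_) fun j hj => prod_lin_coeff_of_lt _ _ hj
  simp only [List.length_cons, List.length_nil] at hj
  interval_cases j
  · exact prod_lin_coeff_zero _ _
  all_goals rfl

theorem polyA_eq (p : Params F) : polyA p = ofList [1, (polyA p).coeff 1, (polyA p).coeff 2,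
    (polyA p).coeff 3] := by
  refine eq_ofList _ (fun j hj => ?_) fun j hj => prod_lin_coeff_of_lt _ _ hj
  simp only [List.length_cons, List.length_nil] at hj
  interval_cases j
  · exact prod_lin_coeff_zero _ _
  all_goals rfl

theorem polyA_coeff_three (p : Params F) : (polyA p).coeff 3 =
    (p.e 6 / p.h₁ * (p.e 7 / p.h₁ * (p.e 8 / p.h₁)) : Fˣ) := by
  have h := prod_lin_coeff_card ({6, 7, 8} : Finset (Fin 11)) fun k => p.e k / p.h₁
  have hc : ({6, 7, 8} : Finset (Fin 11)).card = 3 := by decide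
  rw [hc] at h
  rw [polyA, h, Finset.prod_insert (by decide), Finset.prod_insert (by decide),
    Finset.prod_singleton]
  simp only [Units.val_mul]

theorem polyE_coeff_six (p : Params F) : (polyE p).coeff 6 =
    ((p.e 0)⁻¹ * ((p.e 1)⁻¹ * ((p.e 2)⁻¹ * ((p.e 3)⁻¹ * ((p.e 4)⁻¹ * (p.e 5)⁻¹)))) : Fˣ) := by
  have h := prod_lin_coeff_card ({0, 1, 2, 3, 4, 5} : Finset (Fin 11)) fun k => (p.e k)⁻¹
  have hc : ({0, 1, 2, 3, 4, 5} : Finset (Fin 11)).card = 6 := by decide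
  rw [hc] at h
  rw [polyE, h, Finset.prod_insert (by decide), Finset.prod_insert (by decide),
    Finset.prod_insert (by decide), Finset.prod_insert (by decide), Finset.prod_insert (by decide),
    Finset.prod_singleton]
  simp only [Units.val_mul]

/-- The constraint divided by (h₁²e₁₀)³e₁⋯e₆, rewritten with leading coefficients. This is the only
form in which it enters the construction of the solution. -/
theorem polyE_coeff_six_mul (p : Params F) (hp : p.Constraint) :
    (polyE p).coeff 6 * ((p.h₂ / p.e 9 : Fˣ) : F) ^ 3 =
      (polyA p).coeff 3 ^ 2 * (p.e 10 : F) ^ 3 := by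
  have h := congrArg Units.val hp
  push_cast at h
  rw [polyE_coeff_six, polyA_coeff_three]
  push_cast
  field_simp
  linear_combination h

section Expansions

variable (q a b : Fˣ)

theorem colFactor_zero_mul (u : F) : colFactor q a b 0 * ofList [u] =
    ofList [u, (1 + q + q ^ 2) * a * u, (q + q ^ 2 + q ^ 3) * a ^ 2 * u, q ^ 3 * a ^ 3 * u] := by
  simp [colFactor, ofList, Finset.sum_range_succ, Finset.prod_range_succ, lin]
  ring

theorem colFactor_one_mul (u v : F) : colFactor q a b 1 * ofList [u, v] =
    ofList [u, (q + q ^ 2) * a * u + v, q ^ 3 * a ^ 2 * u + (q + q ^ 2) * a * v,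
      q ^ 3 * a ^ 2 * v] := by
  simp [colFactor, ofList, Finset.sum_range_succ, Finset.prod_Ico_eq_prod_range,
    Finset.prod_range_succ, lin]
  ring

theorem colFactor_two_mul (u v w : F) : colFactor q a b 2 * ofList [u, v, w] =
    ofList [u, q ^ 2 * a * u + v, q ^ 2 * a * v + w, q ^ 2 * a * w] := by
  simp [colFactor, ofList, Finset.sum_range_succ, lin]
  ring

theorem colFactor_three_mul (f : F[X]) : colFactor q a b 3 * f = f := by
  simp [colFactor]

theorem colFactor_four_mul (u v w : F) : colFactor q a b 4 * ofList [u, v, w] =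
    ofList [u, q ^ 3 * b * u + v, q ^ 3 * b * v + w, q ^ 3 * b * w] := by
  simp [colFactor, ofList, Finset.sum_range_succ, lin]
  ring

theorem colFactor_five_mul (u v : F) : colFactor q a b 5 * ofList [u, v] =
    ofList [u, (q ^ 3 + q ^ 4) * b * u + v, q ^ 7 * b ^ 2 * u + (q ^ 3 + q ^ 4) * b * v,
      q ^ 7 * b ^ 2 * v] := by
  simp [colFactor, ofList, Finset.sum_range_succ, Finset.prod_Ico_eq_prod_range,
    Finset.prod_range_succ, lin]
  ring

theorem colFactor_six_mul (u : F) : colFactor q a b 6 * ofList [u] =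
    ofList [u, (q ^ 3 + q ^ 4 + q ^ 5) * b * u, (q ^ 7 + q ^ 8 + q ^ 9) * b ^ 2 * u,
      q ^ 12 * b ^ 3 * u] := by
  simp [colFactor, ofList, Finset.sum_range_succ, Finset.prod_Ico_eq_prod_range,
    Finset.prod_range_succ, lin]
  ring

theorem rowFactor_zero_coeff (p : Params F) (j : ℕ) :
    (rowFactor q p 0).coeff j = ((q : F)⁻¹) ^ j * (polyE p).coeff j := by
  have := prod_lin_scale_coeff ({0, 1, 2, 3, 4, 5} : Finset (Fin 11)) (fun k => (p.e k)⁻¹) q⁻¹ j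
  simp only [rowFactor, Nat.Ico_zero_eq_range, Finset.prod_range_one, zero_tsub,
    Finset.range_zero, Finset.prod_empty, Finset.prod_const_one, mul_one]
  rw [this, polyE, Units.val_inv_eq_inv_val]

theorem rowFactor_one (p : Params F) : rowFactor q p 1 = 1 := by
  simp [rowFactor]

theorem rowFactor_two (p : Params F) : rowFactor q p 2 = polyA p := by
  simp [rowFactor, polyA]

theorem rowFactor_three (p : Params F) : rowFactor q p 3 =
    polyA p * ∏ k ∈ ({6, 7, 8} : Finset (Fin 11)), lin (q * (p.e k / p.h₁)) := by
  have : ∀ k, ∏ t ∈ Finset.range (3 - 1), lin (q ^ t * (p.e k / p.h₁)) =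
      lin (p.e k / p.h₁) * lin (q * (p.e k / p.h₁)) := fun k => by
    simp [Finset.prod_range_succ]
  rw [rowFactor, Finset.prod_congr rfl fun k _ => by rw [Finset.Ico_eq_empty (by omega),
    Finset.prod_empty], Finset.prod_const_one, one_mul, Finset.prod_congr rfl fun k _ => this k,
    Finset.prod_mul_distrib, polyA]

theorem rowFactor_three_eq (p : Params F) (α1 α2 α3 : F) (hA : polyA p = ofList [1, α1, α2, α3]) :
    rowFactor q p 3 = ofList [1, (1 + q) * α1, (1 + q ^ 2) * α2 + q * α1 ^ 2,
      (1 + q ^ 3) * α3 + (q + q ^ 2) * α1 * α2, (q + q ^ 3) * α1 * α3 + q ^ 2 * α2 ^ 2,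
      (q ^ 2 + q ^ 3) * α2 * α3, q ^ 3 * α3 ^ 2] := by
  have h : ∏ k ∈ ({6, 7, 8} : Finset (Fin 11)), lin (q * (p.e k / p.h₁)) =
      ofList [1, q * α1, q ^ 2 * α2, q ^ 3 * α3] := by
    ext j
    rw [prod_lin_scale_coeff _ fun k => p.e k / p.h₁]
    change (q : F) ^ j * (polyA p).coeff j = _
    rw [hA, coeff_ofList, coeff_ofList]
    rcases j with _ | _ | _ | _ | j <;> simp
  rw [rowFactor_three, h, hA]
  simp [ofList, Finset.sum_range_succ]
  ring

theorem ofList_mul_ofList_four (α1 α2 α3 v0 v1 v2 v3 : F) :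
    ofList [1, α1, α2, α3] * ofList [v0, v1, v2, v3] =
      ofList [v0, α1 * v0 + v1, α2 * v0 + α1 * v1 + v2, α3 * v0 + α2 * v1 + α1 * v2 + v3,
        α3 * v1 + α2 * v2 + α1 * v3, α3 * v2 + α2 * v3, α3 * v3] := by
  simp [ofList, Finset.sum_range_succ]
  ring

end Expansions

theorem coeff_eq_of_condX {q : Fˣ} {P : QPlane F q} {f : ℕ → F[X]} {n : ℕ}
    (h : P = ∑ i ∈ Finset.range n, x F q ^ i * evalY (f i)) {i : ℕ} (hi : i < n) (j : ℕ) :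
    P.coeff i j = (f i).coeff j := by
  rw [h, coeff_sum_x_pow_mul_evalY, if_pos hi]

theorem coeff_eq_of_condY {q : Fˣ} {P : QPlane F q} {f : ℕ → F[X]} {n : ℕ}
    (h : P = ∑ j ∈ Finset.range n, evalX (f j) * y F q ^ j) {j : ℕ} (hj : j < n) (i : ℕ) :
    P.coeff i j = (f j).coeff i := by
  rw [h, coeff_sum_evalX_mul_y_pow, if_pos hj]

/-- The 7 × 4 table of coefficients is cleared from its border inwards, in the order of rows `R` and
columns `C` below. Each time the multiplier `U i` or `V j` has as many coefficients as there are
zeros used, and the resulting linear system is triangular. -/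
theorem eq_zero_of_isSolution {q : Fˣ} {p : Params F} {P : QPlane F q}
    (hP : IsSolution e8Data p P) (h00 : P.coeff 0 0 = 0) (h31 : P.coeff 3 1 = 0) : P = 0 := by
  obtain ⟨U, hU, hX⟩ := (condX_iff p P).1 hP.1
  obtain ⟨V, hV, hY⟩ := (condY_iff p P).1 hP.2
  have cX : ∀ {i : ℕ}, i < 7 → ∀ j, P.coeff i j =
      (colFactor q (p.e 10) (p.h₂ / p.e 9) i * U i).coeff j := fun hi j => coeff_eq_of_condX hX hi j
  have cY : ∀ {j : ℕ}, j < 4 → ∀ i, P.coeff i j = (rowFactor q p j * V j).coeff i :=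
    fun hj i => coeff_eq_of_condY hY hj i
  have q0 : (q : F) ≠ 0 := q.ne_zero
  have a0 : (p.e 10 : F) ≠ 0 := Units.ne_zero _
  have b0 : ((p.h₂ / p.e 9 : Fˣ) : F) ≠ 0 := Units.ne_zero _
  have α0 : (polyA p).coeff 3 ≠ 0 := by rw [polyA_coeff_three]; exact Units.ne_zero _
  have hA := polyA_eq p
  generalize p.h₂ / p.e 9 = b at *
  generalize p.e 10 = a at *
  generalize (polyA p).coeff 1 = α1, (polyA p).coeff 2 = α2, (polyA p).coeff 3 = α3 at *
  have one : ∀ {f : F[X]}, DegLE f 0 → f = ofList [f.coeff 0] := fun hf =>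
    hf.eq_ofList _ (by simp) (by simp)
  have two : ∀ {f : F[X]}, DegLE f 1 → f = ofList [f.coeff 0, f.coeff 1] := fun hf =>
    hf.eq_ofList _ (by simp) fun j hj => by
      simp only [List.length_cons, List.length_nil] at hj; interval_cases j <;> rfl
  have three : ∀ {f : F[X]}, DegLE f 2 → f = ofList [f.coeff 0, f.coeff 1, f.coeff 2] := fun hf =>
    hf.eq_ofList _ (by simp) fun j hj => by
      simp only [List.length_cons, List.length_nil] at hj; interval_cases j <;> rfl
  have four : ∀ {f : F[X]}, DegLE f 3 →
      f = ofList [f.coeff 0, f.coeff 1, f.coeff 2, f.coeff 3] := fun hf =>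
    hf.eq_ofList _ (by simp) fun j hj => by
      simp only [List.length_cons, List.length_nil] at hj; interval_cases j <;> rfl
  have zero_of_const : ∀ {f g : F[X]}, DegLE f 0 → (g * f).coeff 0 = 0 → g.coeff 0 = 1 → f = 0 := by
    intro f g hf h hg
    rw [mul_coeff_zero, hg, one_mul] at h
    rw [one hf, h]
    simp [ofList]
  have R0 : ∀ i, P.coeff i 0 = 0 := by
    have : V 0 = 0 := zero_of_const (hV 0 (by omega)) ((cY (by omega) 0).symm.trans h00) (by
      rw [rowFactor_zero_coeff, pow_zero, one_mul]; exact prod_lin_coeff_zero _ _)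
    intro i
    rw [cY (by omega), this, mul_zero, Polynomial.coeff_zero]
  have C0 : ∀ j, P.coeff 0 j = 0 := by
    have : U 0 = 0 := by
      have h := cX (i := 0) (by omega) 0
      rw [one (hU 0 (by omega)), colFactor_zero_mul, coeff_ofList, h00] at h
      rw [one (hU 0 (by omega)), ← show 0 = (U 0).coeff 0 from h]
      simp [ofList]
    intro j
    rw [cX (by omega), this, mul_zero, Polynomial.coeff_zero]
  have R3 : ∀ i, P.coeff i 3 = 0 := by
    have : V 3 = 0 := zero_of_const (hV 3 (by omega)) ((cY (by omega) 0).symm.trans (C0 3)) (by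
      rw [rowFactor_three_eq q p _ _ _ hA, coeff_ofList]; rfl)
    intro i
    rw [cY (by omega), this, mul_zero, Polynomial.coeff_zero]
  have C6 : ∀ j, P.coeff 6 j = 0 := by
    have : U 6 = 0 := by
      have h := cX (i := 6) (by omega) 0
      rw [one (hU 6 (by omega)), colFactor_six_mul, coeff_ofList, R0] at h
      rw [one (hU 6 (by omega)), ← show 0 = (U 6).coeff 0 from h]
      simp [ofList]
    intro j
    rw [cX (by omega), this, mul_zero, Polynomial.coeff_zero]
  -- Two unknowns, read off at y⁰ and y³, where rows 0 and 3 vanish; likewise for column 5.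
  have C1 : ∀ j, P.coeff 1 j = 0 := by
    have : U 1 = 0 := by
      have h := cX (i := 1) (by omega)
      rw [two (hU 1 (by omega)), colFactor_one_mul] at h
      have h0 := h 0
      have h3 := h 3
      simp only [R0, R3, coeff_ofList, List.getD_cons_zero, List.getD_cons_succ] at h0 h3
      have h1 : (U 1).coeff 1 = 0 := by
        simpa [q0, a0] using h3.symm
      rw [two (hU 1 (by omega)), ← h0, h1]
      simp [ofList, Finset.sum_range_succ]
    intro j
    rw [cX (by omega), this, mul_zero, Polynomial.coeff_zero]
  have C5 : ∀ j, P.coeff 5 j = 0 := by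
    have : U 5 = 0 := by
      have h := cX (i := 5) (by omega)
      rw [two (hU 5 (by omega)), colFactor_five_mul] at h
      have h0 := h 0
      have h3 := h 3
      simp only [R0, R3, coeff_ofList, List.getD_cons_zero, List.getD_cons_succ] at h0 h3
      have h1 : (U 5).coeff 1 = 0 := by
        simpa [q0, b0, -Units.val_div_eq_div_val] using h3.symm
      rw [two (hU 5 (by omega)), ← h0, h1]
      simp [ofList, Finset.sum_range_succ]
    intro j
    rw [cX (by omega), this, mul_zero, Polynomial.coeff_zero]
  -- Four unknowns against the zeros in columns 0, 1, 5, 6: the two lowest coefficients are solved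
  -- from below, the two highest from above, where the leading coefficient α₃ ≠ 0 is needed.
  have R2 : ∀ i, P.coeff i 2 = 0 := by
    have : V 2 = 0 := by
      have h := cY (j := 2) (by omega)
      rw [four (hV 2 (by omega)), rowFactor_two, hA, ofList_mul_ofList_four] at h
      have h0 := h 0
      have h1 := h 1
      have h5 := h 5
      have h6 := h 6
      simp only [C0, C1, C5, C6, coeff_ofList, List.getD_cons_zero, List.getD_cons_succ]
        at h0 h1 h5 h6
      rw [← h0, mul_zero, zero_add] at h1
      have h3 : (V 2).coeff 3 = 0 := by simpa [α0] using h6.symm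
      have h2 : (V 2).coeff 2 = 0 := by simpa [α0, h3] using h5.symm
      rw [four (hV 2 (by omega)), ← h0, ← h1, h2, h3]
      simp [ofList, Finset.sum_range_succ]
    intro i
    rw [cY (by omega), this, mul_zero, Polynomial.coeff_zero]
  -- Three unknowns against the zeros in rows 0, 2, 3; likewise for column 4. The coefficient at y¹
  -- is not needed.
  have C2 : ∀ j, P.coeff 2 j = 0 := by
    have : U 2 = 0 := by
      have h := cX (i := 2) (by omega)
      rw [three (hU 2 (by omega)), colFactor_two_mul] at h
      have h0 := h 0
      have h2 := h 2
      have h3 := h 3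
      simp only [R0, R2, R3, coeff_ofList, List.getD_cons_zero, List.getD_cons_succ] at h0 h2 h3
      have h2' : (U 2).coeff 2 = 0 := by simpa [q0, a0] using h3.symm
      have h1 : (U 2).coeff 1 = 0 := by simpa [q0, a0, h2'] using h2.symm
      rw [three (hU 2 (by omega)), ← h0, h1, h2']
      simp [ofList, Finset.sum_range_succ]
    intro j
    rw [cX (by omega), this, mul_zero, Polynomial.coeff_zero]
  have C4 : ∀ j, P.coeff 4 j = 0 := by
    have : U 4 = 0 := by
      have h := cX (i := 4) (by omega)
      rw [three (hU 4 (by omega)), colFactor_four_mul] at h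
      have h0 := h 0
      have h2 := h 2
      have h3 := h 3
      simp only [R0, R2, R3, coeff_ofList, List.getD_cons_zero, List.getD_cons_succ] at h0 h2 h3
      have h2' : (U 4).coeff 2 = 0 := by simpa [q0, b0] using h3.symm
      have h1 : (U 4).coeff 1 = 0 := by simpa [q0, b0, h2'] using h2.symm
      rw [three (hU 4 (by omega)), ← h0, h1, h2']
      simp [ofList, Finset.sum_range_succ]
    intro j
    rw [cX (by omega), this, mul_zero, Polynomial.coeff_zero]
  refine ext_coeff fun i j => ?_
  rw [QPlane.coeff_zero]
  by_cases hi : i < 7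
  · by_cases hj : j < 4
    · interval_cases i
      · exact C0 j
      · exact C1 j
      · exact C2 j
      · interval_cases j
        exacts [R0 3, h31, R2 3, R3 3]
      · exact C4 j
      · exact C5 j
      · exact C6 j
    · rw [hY, coeff_sum_evalX_mul_y_pow, if_neg hj]
  · rw [hX, coeff_sum_x_pow_mul_evalY, if_neg hi]

end ExplicitSolution

/-! ### The explicit solution, by columns and by rows. -/

section ExplicitSolution

open QPlane

variable {F : Type u} [Field F]

/-- The polynomials `Uᵢ(y)` of the solution with constant term `1`; `c₁` is the coefficient of
`x³ y`. -/
noncomputable def colPoly (q a b c₁ : F) (ε α : ℕ → F) : ℕ → F[X]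
  | 0 => 1
  | 1 => ofList [ε 1 / q, a * (1 + q) * α 1]
  -- The entries are built from aⁿαₙ, 1/a + 1/b, b²/(aα₃) and other combinations preserved by a ↔ b,
  -- αₙ ↦ (a/b)ⁿαₙ.
  | 2 => ofList [ε 2 / q ^ 2,
      a ^ 2 * α 2 * (1 / a + 1 / b) + a * α 1 * ε 1 + ε 5 * b ^ 2 / (a * α 3),
      q * a ^ 2 * ((1 + q ^ 2) * α 2 + q * α 1 ^ 2)]
  | 3 => ofList [ε 3 / q ^ 3, c₁,
      q * (1 + q + q ^ 2) * α 3 * a ^ 3 * (1 / a + 1 / b) + q ^ 2 * a ^ 2 * ε 1 * α 2 +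
        q ^ 2 * a ^ 3 * α 1 * α 2 * (1 / a + 1 / b) + q ^ 2 * α 1 * ε 5 * b ^ 2 / α 3,
      q ^ 3 * a ^ 3 * ((1 + q ^ 3) * α 3 + (q + q ^ 2) * α 1 * α 2)]
  | 4 => ofList [ε 4 / q ^ 4,
      q⁻¹ * (α 3 * a ^ 2 / b * (ε 1 + α 1) + b * ε 5 * α 2 / α 3 + α 3 * a ^ 3 * α 1 / b ^ 2),
      a ^ 3 / b * ((q + q ^ 3) * α 1 * α 3 + q ^ 2 * α 2 ^ 2)]
  | 5 => ofList [ε 5 / q ^ 5, a ^ 3 * ((q ^ 2 + q ^ 3) * α 2 * α 3) / (q ^ 4 * b ^ 2)]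
  | 6 => ofList [ε 6 / q ^ 6]
  | _ => 0

/-- The polynomials `Vⱼ(x)` of the solution with constant term `1`; `c₁` is the coefficient of
`x³ y`. -/
noncomputable def rowPoly (q a t c₁ : F) (s : ℕ → F) : ℕ → F[X]
  | 0 => 1
  -- Neither ε nor α occurs separately: only a, t and the symmetric functions s₁, s₂, s₇, s₈ of the
  -- nine numbers, and these are invariant under every s_i with i ≠ 0.
  | 1 => ofList [(1 + q + q ^ 2) * a, (1 + q) * a * s 1, a * (s 2 + s 8 / t ^ 2), c₁,
      q⁻¹ * a * (t * s 1 + s 7 / t), q⁻¹ ^ 2 * (1 + q) * a * s 8 / t,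
      q⁻¹ ^ 3 * (1 + q + q ^ 2) * a * t ^ 2]
  | 2 => ofList [q * a ^ 2 * (1 + q + q ^ 2), q ^ 2 * a ^ 2 * s 1, q ^ 2 * a ^ 2 * (s 8 / t ^ 2),
      q * a ^ 2 * (1 + q + q ^ 2) * t]
  | 3 => ofList [q ^ 3 * a ^ 3]
  | _ => 0

/-- The invariant cube root of the product of the nine numbers `1/e_k`, `e_k/h₁`. -/
noncomputable def tParam (p : Params F) : Fˣ :=
  p.e 6 / p.h₁ * (p.e 7 / p.h₁ * (p.e 8 / p.h₁)) * p.e 10 / (p.h₂ / p.e 9)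

/-- `Uᵢ(y)` for the parameters `p`. -/
noncomputable def solCol (q : Fˣ) (p : Params F) (c₁ : F) (i : ℕ) : F[X] :=
  colPoly q (p.e 10) (p.h₂ / p.e 9 : Fˣ) c₁ (polyE p).coeff (polyA p).coeff i

/-- `Vⱼ(x)` for the parameters `p`. -/
noncomputable def solRow (q : Fˣ) (p : Params F) (c₁ : F) (j : ℕ) : F[X] :=
  rowPoly q (p.e 10) (tParam p) c₁ (polyE p * polyA p).coeff j

theorem one_eq_ofList : (1 : F[X]) = ofList [1] := by simp [ofList]

theorem polyE_mul_polyA (p : Params F) (ε1 ε2 ε3 ε4 ε5 ε6 α1 α2 α3 : F)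
    (hE : polyE p = ofList [1, ε1, ε2, ε3, ε4, ε5, ε6]) (hA : polyA p = ofList [1, α1, α2, α3]) :
    polyE p * polyA p = ofList [1, ε1 + α1, ε2 + ε1 * α1 + α2, ε3 + ε2 * α1 + ε1 * α2 + α3,
      ε4 + ε3 * α1 + ε2 * α2 + ε1 * α3, ε5 + ε4 * α1 + ε3 * α2 + ε2 * α3,
      ε6 + ε5 * α1 + ε4 * α2 + ε3 * α3, ε6 * α1 + ε5 * α2 + ε4 * α3, ε6 * α2 + ε5 * α3,
      ε6 * α3] := by
  rw [hE, hA]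
  simp [ofList, Finset.sum_range_succ]
  ring

theorem ofList_mul_ofList_one (u0 u1 u2 u3 u4 u5 u6 v : F) :
    ofList [u0, u1, u2, u3, u4, u5, u6] * ofList [v] =
      ofList [u0 * v, u1 * v, u2 * v, u3 * v, u4 * v, u5 * v, u6 * v] := by
  simp [ofList, Finset.sum_range_succ]
  ring

/-- Twenty-eight rational identities. With t = α₃ a / b, sₙ expanded in ε and α, and ε₆ eliminated
by the constraint, all remaining quantities are treated as free variables and each identity follows
by clearing denominators. -/
theorem solCol_coeff_eq (q : Fˣ) (p : Params F) (hp : p.Constraint) (c₁ : F) {i j : ℕ}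
    (hi : i < 7) (hj : j < 4) :
    (colFactor q (p.e 10) (p.h₂ / p.e 9) i * solCol q p c₁ i).coeff j =
      (rowFactor q p j * solRow q p c₁ j).coeff i := by
  have hε6 := polyE_coeff_six_mul p hp
  have ht : (tParam p : F) = (polyA p).coeff 3 * p.e 10 / (p.h₂ / p.e 9 : Fˣ) := by
    rw [polyA_coeff_three, tParam, Units.val_div_eq_div_val, Units.val_mul]
  have hR := rowFactor_zero_coeff q p
  have hA := polyA_eq p
  have hE := polyE_eq p
  have hS := polyE_mul_polyA p _ _ _ _ _ _ _ _ _ hE hA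
  have h3 := rowFactor_three_eq q p _ _ _ hA
  have α0 : (polyA p).coeff 3 ≠ 0 := by rw [polyA_coeff_three]; exact Units.ne_zero _
  have hE0 : (polyE p).coeff 0 = 1 := prod_lin_coeff_zero _ _
  simp only [solCol, solRow, hS]
  rw [ht]
  generalize hb : p.h₂ / p.e 9 = b at *
  generalize ha : p.e 10 = a at *
  have q0 : (q : F) ≠ 0 := q.ne_zero
  have a0 : (a : F) ≠ 0 := a.ne_zero
  have b0 : (b : F) ≠ 0 := b.ne_zero
  have hε6' : (polyE p).coeff 6 = (polyA p).coeff 3 ^ 2 * (a : F) ^ 3 / (b : F) ^ 3 := by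
    rw [eq_div_iff (pow_ne_zero 3 b0), hε6]
  have hR2 := rowFactor_two q p
  rw [hA] at hR2
  obtain rfl | rfl | rfl | rfl : j = 0 ∨ j = 1 ∨ j = 2 ∨ j = 3 := by omega
  all_goals
    simp only [rowPoly, mul_one, hR, rowFactor_one, one_mul, hR2, h3, ofList_mul_ofList_four,
      ofList_mul_ofList_one]
    interval_cases i
    all_goals
      simp only [colPoly, one_eq_ofList, colFactor_zero_mul, colFactor_one_mul, colFactor_two_mul,
        colFactor_three_mul, colFactor_four_mul, colFactor_five_mul, colFactor_six_mul,
        coeff_ofList, List.getD_cons_zero, List.getD_cons_succ, hε6', hE0]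
  all_goals
    clear hε6 ht hR hA hE hS h3 hE0 hε6' hR2
    generalize (polyA p).coeff 3 = α3 at *
    first
      | (field_simp; done)
      | (field_simp; ring1)

end ExplicitSolution

/-! ### Existence, the space of all solutions, and part (a). -/

section ExplicitSolution

open QPlane

variable {F : Type u} [Field F] (q : Fˣ) (p : Params F)

/-- The solution with constant term `1` whose coefficient of `x³ y` is `c₁`. -/
noncomputable def solution (c₁ : F) : QPlane F q :=
  ∑ j ∈ Finset.range 4, evalX (rowFactor q p j * solRow q p c₁ j) * y F q ^ j

theorem coeff_colFactor_mul_solCol_of_le (c₁ : F) {i j : ℕ} (hi : i < 7) (hj : 4 ≤ j) :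
    (colFactor q (p.e 10) (p.h₂ / p.e 9) i * solCol q p c₁ i).coeff j = 0 := by
  interval_cases i
  all_goals
    simp only [solCol, colPoly, one_eq_ofList, colFactor_zero_mul, colFactor_one_mul,
      colFactor_two_mul, colFactor_three_mul, colFactor_four_mul, colFactor_five_mul,
      colFactor_six_mul, coeff_ofList]
    exact List.getD_eq_default _ _ hj

theorem coeff_rowFactor_mul_solRow_of_le (c₁ : F) {i j : ℕ} (hi : 7 ≤ i) (hj : j < 4) :
    (rowFactor q p j * solRow q p c₁ j).coeff i = 0 := by
  have hA := polyA_eq p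
  have hR2 := rowFactor_two q p
  rw [hA] at hR2
  interval_cases j
  · simp only [solRow, rowPoly, mul_one, rowFactor_zero_coeff]
    rw [polyE, prod_lin_coeff_of_lt _ _ hi, mul_zero]
  all_goals
    simp only [solRow, rowPoly, rowFactor_one, one_mul, hR2, rowFactor_three_eq q p _ _ _ hA,
      ofList_mul_ofList_four, ofList_mul_ofList_one, coeff_ofList]
    exact List.getD_eq_default _ _ hi

theorem degLE_solCol (c₁ : F) {i : ℕ} (hi : i ≤ 6) : DegLE (solCol q p c₁ i) (colDegree i) := by
  interval_cases i
  all_goals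
    simp only [solCol, colPoly, one_eq_ofList]
    exact DegLE.ofList (by simp [colDegree])

theorem degLE_solRow (c₁ : F) {j : ℕ} (hj : j ≤ 3) : DegLE (solRow q p c₁ j) (rowDegree j) := by
  interval_cases j
  all_goals
    simp only [solRow, rowPoly, one_eq_ofList]
    exact DegLE.ofList (by simp [rowDegree])

variable {p}

theorem solution_eq_sum_col (hp : p.Constraint) (c₁ : F) :
    solution q p c₁ = ∑ i ∈ Finset.range 7,
      x F q ^ i * evalY (colFactor q (p.e 10) (p.h₂ / p.e 9) i * solCol q p c₁ i) := by
  refine ext_coeff fun i j => ?_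
  rw [solution, coeff_sum_evalX_mul_y_pow, coeff_sum_x_pow_mul_evalY]
  by_cases hi : i < 7 <;> by_cases hj : j < 4
  · rw [if_pos hi, if_pos hj, solCol_coeff_eq q p hp c₁ hi hj]
  · rw [if_pos hi, if_neg hj, coeff_colFactor_mul_solCol_of_le q p c₁ hi (not_lt.1 hj)]
  · rw [if_neg hi, if_pos hj, coeff_rowFactor_mul_solRow_of_le q p c₁ (not_lt.1 hi) hj]
  · rw [if_neg hi, if_neg hj]

theorem isSolution_solution (hp : p.Constraint) (c₁ : F) :
    IsSolution e8Data p (solution q p c₁) :=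
  ⟨(condX_iff p _).2 ⟨_, fun _ => degLE_solCol q p c₁, solution_eq_sum_col q hp c₁⟩,
    (condY_iff p _).2 ⟨_, fun _ => degLE_solRow q p c₁, rfl⟩⟩

variable (p)

theorem coeff_solution_zero_zero (c₁ : F) : (solution q p c₁).coeff 0 0 = 1 := by
  rw [solution, coeff_sum_evalX_mul_y_pow, if_pos (by omega), solRow, rowPoly, mul_one,
    rowFactor_zero_coeff, pow_zero, one_mul, polyE, prod_lin_coeff_zero]

theorem coeff_solution_three_one (c₁ : F) : (solution q p c₁).coeff 3 1 = c₁ := by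
  rw [solution, coeff_sum_evalX_mul_y_pow, if_pos (by omega), solRow, rowPoly, rowFactor_one,
    one_mul, coeff_ofList]
  rfl

theorem coeff_x_cube_mul_y (i j : ℕ) :
    (x F q ^ 3 * y F q).coeff i j = if (3, 1) = (i, j) then 1 else 0 := by
  rw [← one_smul F (x F q ^ 3 * y F q), ← pow_one (y F q), ← term_eq, coeff_term]

variable {p}

/-- In the row formula c₁ occurs only as the x³-coefficient of V₁, and row 1 has no prescribed
factor. -/
theorem solution_eq_add_smul (p : Params F) (c₁ : F) :
    solution q p c₁ = solution q p 0 + c₁ • (x F q ^ 3 * y F q) := by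
  refine ext_coeff fun i j => ?_
  rw [QPlane.coeff_add, QPlane.coeff_smul, coeff_x_cube_mul_y, solution, solution,
    coeff_sum_evalX_mul_y_pow, coeff_sum_evalX_mul_y_pow]
  split_ifs with hj h h
  · obtain ⟨rfl, rfl⟩ := Prod.mk.inj h
    simp [rowFactor_one, solRow, rowPoly, coeff_ofList]
  · rw [mul_zero, add_zero]
    interval_cases j
    · rfl
    · simp only [rowFactor_one, solRow, rowPoly, coeff_ofList, one_mul]
      rcases i with _ | _ | _ | _ | i
      iterate 3 rfl
      · exact absurd rfl h
      · rfl
    · rfl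
    · rfl
  · obtain ⟨rfl, rfl⟩ := Prod.mk.inj h
    omega
  · simp

/-- It is the difference of the explicit solutions with c₁ = 1 and c₁ = 0. -/
theorem isSolution_x_cube_mul_y (hp : p.Constraint) :
    IsSolution e8Data p (x F q ^ 3 * y F q) := by
  have h := (isSolution_solution q hp 1).add ((isSolution_solution q hp 0).smul (-1))
  rwa [solution_eq_add_smul q p, one_smul, add_comm (solution q p 0), add_assoc, neg_one_smul,
    add_neg_cancel, add_zero] at h

variable {q}

theorem isBasePolynomial_iff (hp : p.Constraint) (P : QPlane F q) :
    IsBasePolynomial p P ↔ P = solution q p 0 := by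
  constructor
  · rintro ⟨h, h31, h00⟩
    refine sub_eq_zero.1 (eq_zero_of_isSolution (p := p) ?_ ?_ ?_)
    · rw [sub_eq_add_neg, ← neg_one_smul F]
      exact h.add ((isSolution_solution q hp 0).smul _)
    · rw [QPlane.coeff_sub, h00, coeff_solution_zero_zero, sub_self]
    · rw [QPlane.coeff_sub, h31, coeff_solution_three_one, sub_self]
  · rintro rfl
    exact ⟨isSolution_solution q hp 0, coeff_solution_three_one q p 0,
      coeff_solution_zero_zero q p 0⟩

theorem isSolution_iff (hp : p.Constraint) (P : QPlane F q) :
    IsSolution e8Data p P ↔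
      ∃ c₀ c₁ : F, P = c₀ • solution q p 0 + c₁ • (x F q ^ 3 * y F q) := by
  have hs : ∀ c₀ c₁ : F, IsSolution e8Data p (c₀ • solution q p 0 + c₁ • (x F q ^ 3 * y F q)) :=
    fun c₀ c₁ => ((isSolution_solution q hp 0).smul c₀).add ((isSolution_x_cube_mul_y q hp).smul c₁)
  constructor
  · intro h
    -- These are the two coefficients by which a solution is determined.
    refine ⟨P.coeff 0 0, P.coeff 3 1, sub_eq_zero.1 (eq_zero_of_isSolution (p := p) ?_ ?_ ?_)⟩
    · rw [sub_eq_add_neg, ← neg_one_smul F]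
      exact h.add ((hs _ _).smul _)
    · simp [QPlane.coeff_sub, QPlane.coeff_add, QPlane.coeff_smul, coeff_solution_zero_zero,
        coeff_x_cube_mul_y]
    · simp [QPlane.coeff_sub, QPlane.coeff_add, QPlane.coeff_smul, coeff_solution_three_one,
        coeff_x_cube_mul_y]
  · rintro ⟨c₀, c₁, rfl⟩
    exact hs c₀ c₁

theorem existsUnique_isBasePolynomial (hp : p.Constraint) :
    ∃! P₀ : QPlane F q, IsBasePolynomial p P₀ ∧ ∀ P : QPlane F q, IsSolution e8Data p P ↔
      ∃ c₀ c₁ : F, P = c₀ • P₀ + c₁ • (x F q ^ 3 * y F q) :=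
  ⟨solution q p 0, ⟨(isBasePolynomial_iff hp _).2 rfl, isSolution_iff hp⟩,
    fun _ h => (isBasePolynomial_iff hp _).1 h.1⟩

/-- A combination of the base polynomial and `x³ y` with constant term `1`. -/
theorem eq_solution (hp : p.Constraint) {P₀ P : QPlane F q} {c₀ c₁ : F}
    (h₀ : IsBasePolynomial p P₀) (h : P = c₀ • P₀ + c₁ • (x F q ^ 3 * y F q))
    (h00 : P.coeff 0 0 = 1) : P = solution q p c₁ := by
  rw [(isBasePolynomial_iff hp _).1 h₀] at h
  have : c₀ = 1 := by
    rw [h] at h00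
    simpa [QPlane.coeff_add, QPlane.coeff_smul, coeff_solution_zero_zero,
      coeff_x_cube_mul_y] using h00
  rw [h, this, one_smul, ← solution_eq_add_smul q p]

end ExplicitSolution

/-! ### Action of the reflections on the column and row polynomials. -/

section Invariance

open QPlane

variable {F : Type u} [Field F]

theorem ofList_map {K : Type*} [Field K] (σ : F →+* K) (l : List F) :
    (ofList l).map σ = ofList (l.map σ) := by
  ext j
  rw [coeff_map, coeff_ofList, coeff_ofList, ← map_zero σ, List.getD_map]

theorem rowPoly_map {K : Type*} [Field K] (σ : F →+* K) (q a t c₁ : F) (s : ℕ → F) (j : ℕ) :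
    (rowPoly q a t c₁ s j).map σ =
      rowPoly (σ q) (σ a) (σ t) (σ c₁) (fun n => σ (s n)) j := by
  rcases j with _ | _ | _ | _ | j <;> simp [rowPoly, ofList_map]

theorem colPoly_map {K : Type*} [Field K] (σ : F →+* K) (q a b c₁ : F) (ε α : ℕ → F) (i : ℕ) :
    (colPoly q a b c₁ ε α i).map σ =
      colPoly (σ q) (σ a) (σ b) (σ c₁) (fun n => σ (ε n)) (fun n => σ (α n)) i := by
  rcases i with _ | _ | _ | _ | _ | _ | _ | i <;> simp [colPoly, ofList_map]

/-- The polynomials `Uᵢ` are unchanged when `a` and `b` are exchanged and `α n` is multiplied by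
`(a / b) ^ n`. -/
theorem colPoly_swap {q a b : F} (c₁ : F) (ε α : ℕ → F) (hq : q ≠ 0) (ha : a ≠ 0) (hb : b ≠ 0)
    (h3 : α 3 ≠ 0) (i : ℕ) :
    colPoly q b a c₁ ε (fun n => (a / b) ^ n * α n) i = colPoly q a b c₁ ε α i := by
  match i with
  | 0 => simp only [colPoly]
  | 1 =>
    refine congrArg ofList ?_
    simp only [List.cons.injEq, and_true, true_and]
    field_simp
  | 2 =>
    refine congrArg ofList ?_
    simp only [List.cons.injEq, and_true, true_and]
    refine ⟨?_, ?_⟩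
    all_goals field_simp
    ring
  | 3 =>
    refine congrArg ofList ?_
    simp only [List.cons.injEq, and_true, true_and]
    refine ⟨?_, ?_⟩
    all_goals field_simp
    ring
  | 4 =>
    refine congrArg ofList ?_
    simp only [List.cons.injEq, and_true, true_and]
    refine ⟨?_, ?_⟩
    all_goals field_simp
    ring
  | 5 =>
    refine congrArg ofList ?_
    simp only [List.cons.injEq, and_true, true_and]
    field_simp
  | 6 => simp only [colPoly]
  | _ + 7 => simp only [colPoly]

theorem colFactor_map_of_eq {σ : F →+* F} {q a b a' b' : Fˣ} (hq : σ q = q) (ha : σ a = a')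
    (hb : σ b = b') (i : ℕ) : (colFactor q a b i).map σ = colFactor q a' b' i := by
  have h : ∀ {z z' : Fˣ}, σ z = z' → ∀ t : ℕ, (lin (q ^ t * z)).map σ = lin (q ^ t * z') :=
    fun hz t => ReflectionData.lin_map_of_eq (by push_cast; rw [map_mul, map_pow, hq, hz])
  simp only [colFactor, Polynomial.map_mul, Polynomial.map_prod, h ha, h hb]

theorem polyE_expand (p : Params F) : polyE p = lin (p.e 0)⁻¹ * (lin (p.e 1)⁻¹ *
    (lin (p.e 2)⁻¹ * (lin (p.e 3)⁻¹ * (lin (p.e 4)⁻¹ * lin (p.e 5)⁻¹)))) := by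
  rw [polyE, Finset.prod_insert (by decide), Finset.prod_insert (by decide),
    Finset.prod_insert (by decide), Finset.prod_insert (by decide), Finset.prod_insert (by decide),
    Finset.prod_singleton]

theorem polyA_expand (p : Params F) : polyA p = lin (p.e 6 / p.h₁) *
    (lin (p.e 7 / p.h₁) * lin (p.e 8 / p.h₁)) := by
  rw [polyA, Finset.prod_insert (by decide), Finset.prod_insert (by decide),
    Finset.prod_singleton]

theorem polyE_refl (p : Params F) {i : Fin 9} (hi : i ≠ 3) : polyE (p.refl i) = polyE p := by
  rw [polyE_expand, polyE_expand]
  have : i = 0 ∨ i = 1 ∨ i = 2 ∨ i = 4 ∨ i = 5 ∨ i = 6 ∨ i = 7 ∨ i = 8 := by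
    revert i; decide
  obtain rfl | rfl | rfl | rfl | rfl | rfl | rfl | rfl := this
  iterate 3 rfl
  · exact mul_left_comm _ _ _
  · exact congrArg (lin (p.e 0)⁻¹ * ·) (mul_left_comm _ _ _)
  · exact congrArg (fun z => lin (p.e 0)⁻¹ * (lin (p.e 1)⁻¹ * z)) (mul_left_comm _ _ _)
  · exact congrArg (fun z => lin (p.e 0)⁻¹ * (lin (p.e 1)⁻¹ * (lin (p.e 2)⁻¹ * z)))
      (mul_left_comm _ _ _)
  · exact congrArg (fun z => lin (p.e 0)⁻¹ * (lin (p.e 1)⁻¹ * (lin (p.e 2)⁻¹ *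
      (lin (p.e 3)⁻¹ * z)))) (mul_comm _ _)

theorem polyA_refl (p : Params F) {i : Fin 9} (h0 : i ≠ 0) (h3 : i ≠ 3) :
    polyA (p.refl i) = polyA p := by
  rw [polyA_expand, polyA_expand]
  have : i = 1 ∨ i = 2 ∨ i = 4 ∨ i = 5 ∨ i = 6 ∨ i = 7 ∨ i = 8 := by
    revert i; decide
  obtain rfl | rfl | rfl | rfl | rfl | rfl | rfl := this
  · exact congrArg (lin (p.e 6 / p.h₁) * ·) (mul_comm _ _)
  · exact mul_left_comm _ _ _
  all_goals rfl

/-- The reflection s₃ exchanges 1/e₁ and e₇/h₁, moving a linear factor from E to A and back; only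
the product is preserved, which is why the row formula is written in its coefficients. -/
theorem polyE_mul_polyA_refl_three (p : Params F) :
    polyE (p.refl 3) * polyA (p.refl 3) = polyE p * polyA p := by
  have h0 : ((p.refl 3).e 0)⁻¹ = p.e 6 / p.h₁ := by simp [Params.refl]
  have h6 : (p.refl 3).e 6 / (p.refl 3).h₁ = (p.e 0)⁻¹ := by simp [Params.refl]
  rw [polyE_expand, polyE_expand, polyA_expand, polyA_expand, h0, h6]
  change lin (p.e 6 / p.h₁) * (lin (p.e 1)⁻¹ * (lin (p.e 2)⁻¹ * (lin (p.e 3)⁻¹ *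
    (lin (p.e 4)⁻¹ * lin (p.e 5)⁻¹)))) * (lin (p.e 0)⁻¹ * (lin (p.e 7 / p.h₁) *
      lin (p.e 8 / p.h₁))) = _
  ring

/-- The reflection s₀ multiplies h₁ by b/a and fixes e₇, e₈, e₉, so each slope e_k/h₁ is multiplied
by a/b. -/
theorem polyA_refl_zero_coeff (p : Params F) (n : ℕ) : (polyA (p.refl 0)).coeff n =
    ((p.e 10 : F) / (p.h₂ / p.e 9 : Fˣ)) ^ n * (polyA p).coeff n := by
  have h : ∀ k ∈ ({6, 7, 8} : Finset (Fin 11)), (p.refl 0).e k / (p.refl 0).h₁ =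
      p.e 10 / (p.h₂ / p.e 9) * (p.e k / p.h₁) := by
    intro k hk
    have hk' : (p.refl 0).e k = p.e k := by
      revert k; intro k hk; fin_cases hk <;> rfl
    rw [hk']
    change p.e k / (p.h₁ * p.h₂ / (p.e 9 * p.e 10)) = _
    simp only [div_eq_mul_inv, mul_inv, inv_inv]
    ac_rfl
  rw [polyA, Finset.prod_congr rfl fun k hk => by rw [h k hk],
    prod_lin_scale_coeff _ fun k => p.e k / p.h₁, Units.val_div_eq_div_val]
  rfl

theorem tParam_refl (p : Params F) {i : Fin 9} (h0 : i ≠ 0) : tParam (p.refl i) = tParam p := by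
  have : i = 1 ∨ i = 2 ∨ i = 3 ∨ i = 4 ∨ i = 5 ∨ i = 6 ∨ i = 7 ∨ i = 8 := by
    revert i; decide
  obtain rfl | rfl | rfl | rfl | rfl | rfl | rfl | rfl := this
  · exact congrArg (fun z => p.e 6 / p.h₁ * z * p.e 10 / (p.h₂ / p.e 9)) (mul_comm _ _)
  · exact congrArg (fun z => z * p.e 10 / (p.h₂ / p.e 9)) (mul_left_comm _ _ _)
  · have h6 : (p.refl 3).e 6 / (p.refl 3).h₁ = (p.e 0)⁻¹ := by simp [Params.refl]
    rw [tParam, h6]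
    change (p.e 0)⁻¹ * (p.e 7 / p.h₁ * (p.e 8 / p.h₁)) * p.e 10 /
      (p.h₁ * p.h₂ / (p.e 0 * p.e 6) / p.e 9) = _
    rw [tParam]
    ext
    push_cast
    field_simp
  all_goals rfl

theorem refl_e_ten (p : Params F) {i : Fin 9} (h0 : i ≠ 0) : (p.refl i).e 10 = p.e 10 := by
  fin_cases i
  · exact absurd rfl h0
  all_goals rfl

namespace ReflectionData

variable {q : Fˣ} {p : Params F} (D : ReflectionData q p)

theorem map_polyE (i : Fin 9) : (polyE p).map (D.aut i : F →+* F) = polyE (p.refl i) := by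
  rw [polyE, Polynomial.map_prod, polyE]
  refine Finset.prod_congr rfl fun k _ => lin_map_of_eq ?_
  change D.aut i _ = _
  rw [Units.val_inv_eq_inv_val, map_inv₀, D.map_e, Units.val_inv_eq_inv_val]

theorem map_polyA (i : Fin 9) : (polyA p).map (D.aut i : F →+* F) = polyA (p.refl i) := by
  rw [polyA, Polynomial.map_prod, polyA]
  refine Finset.prod_congr rfl fun k _ => lin_map_of_eq ?_
  change D.aut i _ = _
  rw [Units.val_div_eq_div_val, map_div₀, D.map_e, D.map_h₁, Units.val_div_eq_div_val]

theorem map_tParam (i : Fin 9) : D.aut i (tParam p : F) = tParam (p.refl i) := by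
  simp only [tParam, Units.val_div_eq_div_val, Units.val_mul, map_div₀, map_mul, D.map_e,
    D.map_h₁, D.map_h₂]

/-- Everything entering the row formula is fixed: q, a, t, c₁ and the coefficients of EA. The node 3
is included, unlike for the prescribed row factors. -/
theorem map_solRow {i : Fin 9} (h0 : i ≠ 0) {c₁ : F} (hc : D.aut i c₁ = c₁) (j : ℕ) :
    (solRow q p c₁ j).map (D.aut i : F →+* F) = solRow q p c₁ j := by
  have hs : (polyE p * polyA p).map (D.aut i : F →+* F) = polyE p * polyA p := by
    rw [Polynomial.map_mul, map_polyE, map_polyA]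
    by_cases h3 : i = 3
    · rw [h3, polyE_mul_polyA_refl_three]
    · rw [polyE_refl p h3, polyA_refl p h0 h3]
  rw [solRow, rowPoly_map]
  change rowPoly (D.aut i q) (D.aut i (p.e 10 : F)) (D.aut i (tParam p : F)) (D.aut i c₁) _ j = _
  rw [D.map_q, D.map_e, map_tParam, tParam_refl p h0, refl_e_ten p h0, hc]
  simp only [← coeff_map, hs]

theorem map_rowFactor {i : Fin 9} (h0 : i ≠ 0) (h3 : i ≠ 3) {j : ℕ} (hj : j < 4) :
    (rowFactor q p j).map (D.aut i : F →+* F) = rowFactor q p j := by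
  have hE := (D.map_polyE i).trans (polyE_refl p h3)
  have hA := (D.map_polyA i).trans (polyA_refl p h0 h3)
  have hq : (D.aut i : F →+* F) q = q := D.map_q i
  interval_cases j
  · ext n
    rw [coeff_map, rowFactor_zero_coeff, map_mul, map_pow, map_inv₀, hq, ← coeff_map, hE]
  · rw [rowFactor_one, Polynomial.map_one]
  · rw [rowFactor_two, hA]
  · have hc : ∀ n, (D.aut i : F →+* F) ((polyA p).coeff n) = (polyA p).coeff n := fun n => by
      rw [← coeff_map, hA]
    rw [rowFactor_three_eq q p _ _ _ (polyA_eq p), ofList_map]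
    simp only [List.map_cons, List.map_nil, map_mul, map_add, map_pow, map_one, hc, hq]

theorem map_solCol {c₁ : F} (hc : D.aut 0 c₁ = c₁) (i : ℕ) :
    (solCol q p c₁ i).map (D.aut 0 : F →+* F) = solCol q p c₁ i := by
  have hE := (D.map_polyE 0).trans (polyE_refl p (by decide))
  have α0 : (polyA p).coeff 3 ≠ 0 := by rw [polyA_coeff_three]; exact Units.ne_zero _
  rw [solCol, colPoly_map]
  change colPoly (D.aut 0 q) (D.aut 0 (p.e 10 : F)) (D.aut 0 (p.h₂ / p.e 9 : Fˣ)) (D.aut 0 c₁)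
    _ _ i = _
  rw [D.map_q, aut_zero_e, aut_zero_div, hc]
  simp only [← coeff_map, hE, map_polyA, polyA_refl_zero_coeff]
  exact colPoly_swap c₁ _ _ q.ne_zero (Units.ne_zero _) (Units.ne_zero _) α0 i

theorem simpleReflection_solution {i : Fin 9} (h0 : i ≠ 0) (h3 : i ≠ 3) {c₁ : F}
    (hc : D.aut i c₁ = c₁) :
    D.simpleReflection i (solution q p c₁).toQField = (solution q p c₁).toQField := by
  rw [solution, map_sum, map_sum]
  refine Finset.sum_congr rfl fun j hj => ?_
  rw [map_mul, map_mul, D.simpleReflection_evalX h0, map_pow, map_pow,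
    D.simpleReflection_y_of_ne h3, Polynomial.map_mul, D.map_solRow h0 hc,
    D.map_rowFactor h0 h3 (Finset.mem_range.1 hj)]

end ReflectionData

/-! ### Powers of the reflected variables and the cancellation of commuting factors. -/

section Shift

variable {q : Fˣ}

theorem evalX_toQField_ne_zero {f : F[X]} (hf : f ≠ 0) : (evalX f : QPlane F q).toQField ≠ 0 :=
  QField.toQField_ne_zero (evalX_ne_zero hf)

theorem evalY_toQField_ne_zero {f : F[X]} (hf : f ≠ 0) : (evalY f : QPlane F q).toQField ≠ 0 :=
  QField.toQField_ne_zero (evalY_ne_zero hf)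

/-- Reduces the comparison of two fractions in a single variable to an identity of commutative
polynomials. -/
theorem mul_div_eq_mul_div_of_commute {K : Type*} [DivisionRing K] {f g c d c' d' : K}
    (hd : d ≠ 0) (hd' : d' ≠ 0) (h : Commute d d') (H : f * c * d' = g * c' * d) :
    f * (c / d) = g * (c' / d') := by
  have h' : Commute d'⁻¹ d := h.symm.inv_left₀
  rw [div_eq_mul_inv, div_eq_mul_inv, ← mul_assoc, ← mul_assoc, mul_inv_eq_iff_eq_mul₀ hd,
    mul_assoc _ d'⁻¹, h'.eq, ← mul_assoc, eq_mul_inv_iff_mul_eq₀ hd', H]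

theorem evalX_mul_div_eq {f g c d c' d' : F[X]} (hd : d ≠ 0) (hd' : d' ≠ 0)
    (H : f * c * d' = g * c' * d) :
    (evalX f : QPlane F q).toQField * ((evalX c : QPlane F q).toQField /
      (evalX d : QPlane F q).toQField) = (evalX g : QPlane F q).toQField *
        ((evalX c' : QPlane F q).toQField / (evalX d' : QPlane F q).toQField) := by
  refine mul_div_eq_mul_div_of_commute (evalX_toQField_ne_zero hd) (evalX_toQField_ne_zero hd')
    (ReflectionData.toQField_evalX_comm _ _) ?_
  simp only [← map_mul, ← evalX_mul, H]

theorem evalY_div_mul_eq {f g c d c' d' : F[X]} (hd : d ≠ 0) (hd' : d' ≠ 0)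
    (H : f * c * d' = g * c' * d) :
    (evalY c : QPlane F q).toQField / (evalY d : QPlane F q).toQField *
      (evalY f : QPlane F q).toQField = (evalY g : QPlane F q).toQField *
        ((evalY c' : QPlane F q).toQField / (evalY d' : QPlane F q).toQField) := by
  rw [(show Commute _ _ from .div_left (ReflectionData.toQField_evalY_comm _ _)
    (ReflectionData.toQField_evalY_comm _ _)).eq]
  refine mul_div_eq_mul_div_of_commute (evalY_toQField_ne_zero hd) (evalY_toQField_ne_zero hd')
    (ReflectionData.toQField_evalY_comm _ _) ?_
  simp only [← map_mul, ← evalY_mul, H]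

theorem y_pow_mul_evalX_lin (c : Fˣ) (j : ℕ) :
    y F q ^ j * evalX (lin c) = evalX (lin (q ^ j * c)) * y F q ^ j := by
  induction j with
  | zero => simp
  | succ j ih =>
    rw [pow_succ', mul_assoc, ih, ← mul_assoc, y_mul_evalX_lin, mul_assoc, ← mul_assoc q,
      ← pow_succ']

theorem evalY_lin_mul_x_pow (a : Fˣ) (i : ℕ) :
    evalY (lin a) * x F q ^ i = x F q ^ i * evalY (lin (q ^ i * a)) := by
  induction i with
  | zero => simp
  | succ i ih =>
    rw [pow_succ, ← mul_assoc, ih, mul_assoc, evalY_lin_mul_x, ← mul_assoc, ← mul_assoc q,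
      ← pow_succ']

theorem y_pow_mul_evalX_lin_div (c d : Fˣ) (j : ℕ) :
    (y F q).toQField ^ j * ((evalX (lin c) : QPlane F q).toQField /
      (evalX (lin d) : QPlane F q).toQField) =
    (evalX (lin (q ^ j * c)) : QPlane F q).toQField /
      (evalX (lin (q ^ j * d)) : QPlane F q).toQField * (y F q).toQField ^ j := by
  have h : ∀ z : Fˣ, SemiconjBy ((y F q).toQField ^ j) (evalX (lin z) : QPlane F q).toQField
      (evalX (lin (q ^ j * z)) : QPlane F q).toQField := fun z => by
    rw [SemiconjBy, ← map_pow, ← map_mul, y_pow_mul_evalX_lin, map_mul]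
  exact SemiconjBy.div_right (h c) (h d)

theorem evalY_lin_div_mul_x_pow (b a : Fˣ) (i : ℕ) :
    (evalY (lin b) : QPlane F q).toQField / (evalY (lin a) : QPlane F q).toQField *
      (x F q).toQField ^ i =
    (x F q).toQField ^ i * ((evalY (lin (q ^ i * b)) : QPlane F q).toQField /
      (evalY (lin (q ^ i * a)) : QPlane F q).toQField) := by
  have h : ∀ z : Fˣ, SemiconjBy ((x F q).toQField ^ i)
      (evalY (lin (q ^ i * z)) : QPlane F q).toQField
      (evalY (lin z) : QPlane F q).toQField := fun z => by
    rw [SemiconjBy, ← map_pow, ← map_mul, ← evalY_lin_mul_x_pow, map_mul]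
  exact (SemiconjBy.div_right (h b) (h a)).symm

theorem prod_lin_ne_zero {ι : Type*} (s : Finset ι) (z : ι → Fˣ) : ∏ k ∈ s, lin (z k) ≠ 0 :=
  Finset.prod_ne_zero_iff.2 fun _ _ => lin_ne_zero _

/-- Moving each new factor to the left past the powers of y already present shifts its slope by that
power of q. -/
theorem reflY_three_pow (p : Params F) (j : ℕ) : reflY (q := q) p 3 ^ j =
    (evalX (∏ t ∈ Finset.range j, lin (q ^ t * (p.e 6 / p.h₁))) : QPlane F q).toQField /
      (evalX (∏ t ∈ Finset.range j, lin (q ^ t * (p.e 0)⁻¹)) : QPlane F q).toQField *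
        (y F q).toQField ^ j := by
  induction j with
  | zero => simp [evalX_one]
  | succ j ih =>
    rw [pow_succ, ih, ReflectionData.reflY_three, mul_assoc, ← mul_assoc (_ ^ j),
      y_pow_mul_evalX_lin_div, mul_assoc, ← pow_succ, ← mul_assoc, Finset.prod_range_succ,
      Finset.prod_range_succ, evalX_mul, evalX_mul, map_mul, map_mul]
    congr 1
    exact Commute.div_mul_div_comm (ReflectionData.toQField_evalX_comm _ _)
      (ReflectionData.toQField_evalX_comm _ _).inv_left₀

theorem reflX_zero_pow (p : Params F) (i : ℕ) : (reflX p 0 : QField F q) ^ i =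
    (x F q).toQField ^ i *
      ((evalY (∏ t ∈ Finset.range i, lin (q ^ t * (p.h₂ / p.e 9))) : QPlane F q).toQField /
        (evalY (∏ t ∈ Finset.range i, lin (q ^ t * p.e 10)) : QPlane F q).toQField) := by
  induction i with
  | zero => simp [evalY_one]
  | succ i ih =>
    rw [pow_succ', ih, ReflectionData.reflX_zero, mul_assoc, ← mul_assoc (_ / _),
      evalY_lin_div_mul_x_pow, mul_assoc, ← mul_assoc, ← pow_succ', Finset.prod_range_succ_comm,
      Finset.prod_range_succ_comm, evalY_mul, evalY_mul, map_mul, map_mul]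
    congr 1
    exact Commute.div_mul_div_comm (ReflectionData.toQField_evalY_comm _ _)
      (ReflectionData.toQField_evalY_comm _ _).inv_left₀

end Shift

/-! ### Transformation of the solution under s₀ and s₃. -/

namespace ReflectionData

variable {q : Fˣ} {p : Params F} (D : ReflectionData q p)

/-- Compared column by column. The power xⁱ contributes ∏_{t<i}(1 + qᵗby)/(1 + qᵗay), and the
prescribed factor has a and b exchanged; completing both products to t < 3, or cutting them there,
gives the same quotient for every i. -/
theorem simpleReflection_zero_solution (hp : p.Constraint) {c₁ : F} (hc : D.aut 0 c₁ = c₁) :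
    D.simpleReflection 0 (solution q p c₁).toQField = (solution q p c₁).toQField *
      ((evalY (∏ t ∈ Finset.range 3, lin (q ^ t * (p.h₂ / p.e 9))) : QPlane F q).toQField /
        (evalY (∏ t ∈ Finset.range 3, lin (q ^ t * p.e 10)) : QPlane F q).toQField) := by
  rw [solution_eq_sum_col q hp, map_sum, map_sum, Finset.sum_mul]
  refine Finset.sum_congr rfl fun i _ => ?_
  rw [map_mul, map_mul, map_pow, map_pow, simpleReflection_x, reflX_zero_pow,
    D.simpleReflection_evalY (by decide), Polynomial.map_mul, D.map_solCol hc,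
    colFactor_map_of_eq (D.map_q 0) D.aut_zero_e D.aut_zero_div, mul_assoc, mul_assoc]
  congr 1
  refine evalY_div_mul_eq (prod_lin_ne_zero _ _) (prod_lin_ne_zero _ _) ?_
  rcases le_total i 3 with hi | hi
  · simp only [colFactor, Finset.Ico_eq_empty_of_le hi, Finset.prod_empty, mul_one]
    rw [← Finset.prod_range_mul_prod_Ico (fun t => lin (q ^ t * (p.h₂ / p.e 9))) hi,
      ← Finset.prod_range_mul_prod_Ico (fun t => lin (q ^ t * p.e 10)) hi]
    ring
  · simp only [colFactor, Finset.Ico_eq_empty_of_le hi, Finset.prod_empty, one_mul]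
    rw [← Finset.prod_range_mul_prod_Ico (fun t => lin (q ^ t * (p.h₂ / p.e 9))) hi,
      ← Finset.prod_range_mul_prod_Ico (fun t => lin (q ^ t * p.e 10)) hi]
    ring

/-- With c = e₇/h₁ and d = 1/e₁, only the factors with slopes in c and d change. For j = 0 this
replaces 1 + q⁻¹dx by 1 + q⁻¹cx; for j > 0 the products over t < j and t < j - 1 differ in the
single index t = j - 1. Both cases give the slopes q^{j-1}c and q^{j-1}d. -/
theorem map_rowFactor_three_mul (j : ℕ) :
    (rowFactor q p j).map (D.aut 3 : F →+* F) *
        (∏ t ∈ Finset.range j, lin (q ^ t * (p.e 6 / p.h₁))) * lin (q ^ j * (q * p.e 0)⁻¹) =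
      rowFactor q p j * lin (q ^ j * (p.e 6 / (q * p.h₁))) *
        ∏ t ∈ Finset.range j, lin (q ^ t * (p.e 0)⁻¹) := by
  have hq : (D.aut 3 : F →+* F) q = q := D.map_q 3
  have h : ∀ {w z z' : Fˣ}, D.aut 3 (w : F) = w → D.aut 3 (z : F) = z' →
      (lin (w * z)).map (D.aut 3 : F →+* F) = lin (w * z') := fun hw hz =>
    lin_map_of_eq (by
      push_cast
      rw [map_mul]
      exact congrArg₂ _ hw hz)
  have hqi : D.aut 3 ((q⁻¹ : Fˣ) : F) = (q⁻¹ : Fˣ) := by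
    rw [Units.val_inv_eq_inv_val, map_inv₀, D.map_q]
  have hqp : ∀ t : ℕ, D.aut 3 ((q ^ t : Fˣ) : F) = (q ^ t : Fˣ) := fun t => by
    rw [Units.val_pow_eq_pow_val, map_pow, D.map_q]
  have hE : ∀ k ∈ ({1, 2, 3, 4, 5} : Finset (Fin 11)),
      D.aut 3 (((p.e k)⁻¹ : Fˣ) : F) = ((p.e k)⁻¹ : Fˣ) := fun k hk => by
    rw [Units.val_inv_eq_inv_val, map_inv₀, D.map_e]
    fin_cases hk <;> rfl
  have hA : ∀ k ∈ ({7, 8} : Finset (Fin 11)),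
      D.aut 3 ((p.e k / p.h₁ : Fˣ) : F) = (p.e k / p.h₁ : Fˣ) := fun k hk => by
    rw [Units.val_div_eq_div_val, map_div₀, D.map_e, D.map_h₁]
    fin_cases hk <;> rfl
  have hEs : ({0, 1, 2, 3, 4, 5} : Finset (Fin 11)) = insert 0 {1, 2, 3, 4, 5} := rfl
  have hAs : ({6, 7, 8} : Finset (Fin 11)) = insert 6 {7, 8} := rfl
  have e1 : p.e 6 / (q * p.h₁) = q⁻¹ * (p.e 6 / p.h₁) := by
    rw [div_eq_mul_inv, div_eq_mul_inv, mul_inv, mul_left_comm]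
  rw [rowFactor, hEs, hAs, Finset.prod_insert (a := 0) (s := {1, 2, 3, 4, 5}) (by decide),
    Finset.prod_insert (a := 6) (s := {7, 8}) (by decide),
    e1, mul_inv]
  simp only [Polynomial.map_mul, Polynomial.map_prod, h hqi D.aut_three_inv,
    h (hqp _) D.aut_three_div]
  rw [Finset.prod_congr (s₁ := ({1, 2, 3, 4, 5} : Finset (Fin 11))) rfl fun k hk => by
      rw [h hqi (hE k hk)],
    Finset.prod_congr (s₁ := ({7, 8} : Finset (Fin 11))) rfl fun k hk =>
      Finset.prod_congr rfl fun t _ => h (hqp t) (hA k hk)]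
  rcases j with _ | j
  · simp only [Nat.Ico_zero_eq_range, Finset.prod_range_one, zero_tsub, Finset.range_zero,
      Finset.prod_empty, pow_zero, one_mul, mul_one]
    ring
  · rw [← mul_assoc (q ^ (j + 1)), ← mul_assoc (q ^ (j + 1)), pow_succ, mul_inv_cancel_right,
      Finset.prod_range_succ, Finset.prod_range_succ, Nat.add_sub_cancel,
      Finset.Ico_eq_empty_of_le (by omega : 1 ≤ j + 1)]
    simp only [Finset.prod_empty]
    ring

/-- Compared row by row. The common right factor has slopes c/q and d/q, which become q^{j-1}c and
q^{j-1}d on passing yʲ and so match the change of row j. -/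
theorem simpleReflection_three_solution {c₁ : F} (hc : D.aut 3 c₁ = c₁) :
    D.simpleReflection 3 (solution q p c₁).toQField = (solution q p c₁).toQField *
      ((evalX (lin (p.e 6 / (q * p.h₁))) : QPlane F q).toQField /
        (evalX (lin (q * p.e 0)⁻¹) : QPlane F q).toQField) := by
  rw [solution, map_sum, map_sum, Finset.sum_mul]
  refine Finset.sum_congr rfl fun j _ => ?_
  rw [map_mul, map_mul, map_pow, map_pow, simpleReflection_y, reflY_three_pow,
    D.simpleReflection_evalX (by decide), Polynomial.map_mul, D.map_solRow (by decide) hc,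
    mul_assoc _ (_ ^ j), y_pow_mul_evalX_lin_div, ← mul_assoc, ← mul_assoc]
  congr 1
  refine evalX_mul_div_eq (prod_lin_ne_zero _ _) (lin_ne_zero _) ?_
  have := D.map_rowFactor_three_mul j
  linear_combination solRow q p c₁ j * this

end ReflectionData

end Invariance

theorem mainTheorem5 :
    (∀ (F : Type u) [Field F] (q : Fˣ) (p : Params F), p.Constraint →
      ∃! P₀ : QPlane F q, IsBasePolynomial p P₀ ∧
        ∀ P : QPlane F q, IsSolution e8Data p P ↔
          ∃ c₀ c₁ : F, P = c₀ • P₀ + c₁ • (QPlane.x F q ^ 3 * QPlane.y F q)) ∧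
    (∀ (k : Type u) [Field k] (q : kˣ),
      ∃ ρ : affineE8.Group →* RingAut (QField (ParamField k) (qParam q)),
        (∀ i, IsSimpleReflection k (genericParams k) i (ρ (affineE8.simple i))) ∧
        (∀ i φ, IsSimpleReflection k (genericParams k) i φ → φ = ρ (affineE8.simple i)) ∧
        ∀ (P₀ P : QPlane (ParamField k) (qParam q)) (c₀ : ParamField k) (c₁ : k),
          IsBasePolynomial (genericParams k) P₀ →
          P = c₀ • P₀ + algebraMap k (ParamField k) c₁ •
            (QPlane.x (ParamField k) (qParam q) ^ 3 * QPlane.y (ParamField k) (qParam q)) →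
          P.coeff 0 0 = 1 →
          (∀ i : Fin 9, i ≠ 0 → i ≠ 3 →
            ρ (affineE8.simple i) P.toQField = P.toQField) ∧
          ρ (affineE8.simple 0) P.toQField = P.toQField *
            (QPlane.toQField (QPlane.evalY (∏ t ∈ Finset.range 3,
                lin (qParam q ^ t * ((genericParams k).h₂ / (genericParams k).e 9)))) /
              QPlane.toQField (QPlane.evalY (∏ t ∈ Finset.range 3,
                lin (qParam q ^ t * (genericParams k).e 10)))) ∧
          ρ (affineE8.simple 3) P.toQField = P.toQField *
            (QPlane.toQField (QPlane.evalX
                (lin ((genericParams k).e 6 / (qParam q * (genericParams k).h₁)))) /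
              QPlane.toQField (QPlane.evalX
                (lin (qParam q * (genericParams k).e 0)⁻¹)))) := by
  refine ⟨fun F _ q p hp => existsUnique_isBasePolynomial hp, fun k _ q => ?_⟩
  have hs : ∀ i, IsSimpleReflection k (genericParams k) i
      ((genericReflectionData q).action (affineE8.simple i)) := fun i => by
    rw [ReflectionData.action_simple]
    exact (genericReflectionData q).isSimpleReflection reflAut_algebraMap i
  refine ⟨(genericReflectionData q).action, hs,
    fun i φ hφ => QField.isSimpleReflection_ext hφ (hs i), fun P₀ P c₀ c₁ h₀ hP h00 => ?_⟩
  -- P(0,0) = 1 forces c₀ = 1, so P is the explicit solution whose x³y-coefficient is the constant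
  -- c₁, fixed by every reflection.
  rw [eq_solution (genericParams_constraint k) h₀ hP h00]
  refine ⟨fun i i0 i3 => ?_, ?_, ?_⟩
  · rw [ReflectionData.action_simple]
    exact (genericReflectionData q).simpleReflection_solution i0 i3 (reflAut_algebraMap i c₁)
  · rw [ReflectionData.action_simple]
    exact (genericReflectionData q).simpleReflection_zero_solution (genericParams_constraint k)
      (reflAut_algebraMap 0 c₁)
  · rw [ReflectionData.action_simple]
    exact (genericReflectionData q).simpleReflection_three_solution (reflAut_algebraMap 3 c₁)
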